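/- Let $p$ be a prime, let $F$ and $E$ be finite extensions of $\mathbb{Q}_p$, and let $S$ be the set of $\mathbb{Q}_p$-algebra embeddings $F\to E$; assume $|S|=[F:\mathbb{Q}_p]$. Let $\mathcal{O}_F,\mathcal{O}_E$ be the rings of integers, $\mathfrak{p}_E$ the maximal ideal of $\mathcal{O}_E$, $k_F$ the residue field of $F$, $f=[k_F:\mathbb{F}_p]$, and $\varpi$ a uniformizer of $F$. For $\zeta\in k_F$ let $[\zeta]\in\mathcal{O}_F$ be its Teichmüller representative. Put $G=\mathrm{GL}_2(F)$, $K=\mathrm{GL}_2(\mathcal{O}_F)$, $Z$ the centre of $G$, and $\alpha=\mathrm{diag}(1,\varpi)$. Fix $\iota\in S$, integers $d_\sigma\ge 0$ for $\sigma\in S$ (write $\vec d=(d_\sigma)_{\sigma\in S}$), and $a_p\in\mathfrak{p}_E$. Let $\rho_{\vec d}=\bigotimes_{\sigma\in S}\mathrm{Sym}^{d_\sigma}E^2$ be the representation of $KZ$ in which $\mathrm{Sym}^{d_\sigma}E^2$ is the space of homogeneous polynomials of degree $d_\sigma$ in $x_\sigma,y_\sigma$ over $E$, a matrix $\begin{pmatrix}a&b\\c&d\end{pmatrix}\in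 K$ acts on the factor $\sigma$ by $x_\sigma\mapsto\sigma(a)x_\sigma+\sigma(c)y_\sigma$, $y_\sigma\mapsto\sigma(b)x_\sigma+\sigma(d)y_\sigma$, and the scalar matrix $\varpi$ acts trivially. Let $\rho^0_{\vec d}\subset\rho_{\vec d}$ be the $KZ$-stable $\mathcal{O}_E$-lattice $\bigotimes_\sigma\mathrm{Sym}^{d_\sigma}\mathcal{O}_E^2$ of tensors of polynomials with coefficients in $\mathcal{O}_E$. Let $\mathrm{ind}_{KZ}^G\rho_{\vec d}$ be the space of functions $h:G\to\rho_{\vec d}$ with support compact modulo $Z$ and $h(\kappa g)=\rho_{\vec d}(\kappa)h(g)$ for $\kappa\in KZ$, on which $G$ acts by right translation, and let $\mathrm{ind}_{KZ}^G\rho^0_{\vec d}$ be the $\mathcal{O}_E$-submodule of functions with values in $\rho^0_{\vec d}$. Let $\psi:G\to\mathrm{End}_E(\rho_{\vec d})$ be the unique function supported on $KZ\alpha^{-1}KZ$ with $\psi(\kappa_1\alpha^{-1}\kappa_2)=\rho_{\vec d}(\kappa_1)\circ U\circ\rho_{\vec d}(\kappa_2)$ for $\kappa_1,\kappa_2\in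 KZ$, where $U=\bigotimes_\sigma U_{d_\sigma}$ and $U_{d_\sigma}(x_\sigma^{d_\sigma-i}y_\sigma^{i})=\sigma(\varpi)^{d_\sigma-i}x_\sigma^{d_\sigma-i}y_\sigma^{i}$. The Hecke operator is $$(Th)(g)=\sum_{xKZ\in G/KZ}\psi(x)\bigl(h(x^{-1}g)\bigr);$$ it is a $G$-equivariant endomorphism of $\mathrm{ind}_{KZ}^G\rho_{\vec d}$ preserving $\mathrm{ind}_{KZ}^G\rho^0_{\vec d}$. Let $\Theta_{\vec d,a_p}$ be the image of $\mathrm{ind}_{KZ}^G\rho^0_{\vec d}$ in $\mathrm{ind}_{KZ}^G\rho_{\vec d}/(T-a_p)(\mathrm{ind}_{KZ}^G\rho_{\vec d})$, and let $$\theta:\ \frac{\mathrm{ind}_{KZ}^G\rho^0_{\vec d}}{(T-a_p)(\mathrm{ind}_{KZ}^G\rho^0_{\vec d})}\longrightarrow\Theta_{\vec d,a_p}$$ be the natural $\mathcal{O}_E[G]$-linear map. For $l\in\{0,\dots,f-1\}$ put $$J_l=\{\sigma\in S:\ d_\sigma\neq 0\ \text{and}\ \sigma([\zeta])=\iota([\zeta])^{p^l}\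 \text{for all}\ \zeta\in k_F\},$$ and for $\sigma\in J_l$ let $v_\sigma$ be the least $i\in\{1,\dots,f\}$ such that $J_{l+i}\neq\emptyset$, the index $l+i$ being read modulo $f$. Then $\theta$ is surjective, and $\theta$ is injective (hence an isomorphism) if and only if both of the following hold: (i) $|J_l|\le 1$ for every $l\in\{0,\dots,f-1\}$; (ii) $d_\sigma+1\le p^{v_\sigma}$ for every $l\in\{0,\dots,f-1\}$ and every $\sigma\in J_l$. -/

import Mathlib

set_option maxSynthPendingDepth 3
set_option linter.unusedSectionVars false

namespace HeckeLattice

open scoped Pointwise TensorProduct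

noncomputable section

section LocalField

variable (K : Type*) [NormedField K] [IsUltrametricDist K]

/-- The ring of integers `{x | ‖x‖ ≤ 1}` of a nonarchimedean normed field. -/
abbrev integers : ValuationSubring K := (NormedField.valuation (K := K)).valuationSubring

/-- The residue field. -/
abbrev residueField : Type _ := IsLocalRing.ResidueField (integers K)

/-- The residue degree `f`, i.e. the degree of the residue field over its prime field. -/
def residueDegree : ℕ := Module.finrank (⊥ : Subfield (residueField K)) (residueField K)

variable {K}

/-- `ϖ` is a uniformizer: a nonzero generator of the maximal ideal `{x | ‖x‖ < 1}`. -/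
structure IsUniformizer (ϖ : K) : Prop where
  ne_zero : ϖ ≠ 0
  norm_lt_one : ‖ϖ‖ < 1
  norm_le : ∀ x : K, ‖x‖ < 1 → ‖x‖ ≤ ‖ϖ‖

/-- `x` is the Teichmüller representative `[ζ]`: the lift of `ζ` with `x ^ q = x`, where `q` is
the cardinality of the residue field. -/
def IsTeichmuller (ζ : residueField K) (x : integers K) : Prop :=
  IsLocalRing.residue (integers K) x = ζ ∧ x ^ Nat.card (residueField K) = x

theorem mem_integers {x : K} : x ∈ integers K ↔ ‖x‖ ≤ 1 := by
  rw [Valuation.mem_valuationSubring_iff, NormedField.valuation_apply]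
  rfl

theorem IsUniformizer.exists_zpow {ϖ : K} (hϖ : IsUniformizer ϖ) {a : K} (ha : a ≠ 0) :
    ∃ n : ℤ, ‖ϖ ^ (-n) * a‖ = 1 := by
  have h0 : 0 < ‖ϖ‖ := norm_pos_iff.mpr hϖ.ne_zero
  have hinv : 1 < ‖ϖ‖⁻¹ := (one_lt_inv₀ h0).mpr hϖ.norm_lt_one
  obtain ⟨n, hn1, hn2⟩ := exists_mem_Ioc_zpow (norm_pos_iff.mpr ha) hinv
  rw [inv_zpow'] at hn1 hn2
  refine ⟨-(n + 1), ?_⟩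
  rw [neg_neg, norm_mul, norm_zpow]
  have hle : ‖ϖ‖ ^ (n + 1) * ‖a‖ ≤ 1 := by
    calc ‖ϖ‖ ^ (n + 1) * ‖a‖ ≤ ‖ϖ‖ ^ (n + 1) * ‖ϖ‖ ^ (-(n + 1)) := by gcongr
      _ = 1 := by rw [← zpow_add₀ h0.ne']; simp
  have hgt : ‖ϖ‖ < ‖ϖ‖ ^ (n + 1) * ‖a‖ := by
    calc ‖ϖ‖ = ‖ϖ‖ ^ (n + 1) * ‖ϖ‖ ^ (-n) := by rw [← zpow_add₀ h0.ne']; simp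
      _ < _ := by gcongr
  refine le_antisymm hle (not_lt.mp fun hlt => ?_)
  have := hϖ.norm_le (ϖ ^ (n + 1) * a) (by rwa [norm_mul, norm_zpow])
  rw [norm_mul, norm_zpow] at this
  linarith

theorem IsUniformizer.zpow_injective {ϖ : K} (hϖ : IsUniformizer ϖ) {n : ℤ}
    (h : ‖ϖ ^ n‖ = 1) : n = 0 := by
  have h0 : 0 < ‖ϖ‖ := norm_pos_iff.mpr hϖ.ne_zero
  rw [norm_zpow] at h
  exact (zpow_eq_one_iff_right₀ h0.le hϖ.norm_lt_one.ne).mp h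

end LocalField

section Groups

variable (F : Type*) [NormedField F] [IsUltrametricDist F]

/-- `G = GL₂(F)`. -/
abbrev G : Type _ := Matrix.GeneralLinearGroup (Fin 2) F

/-- `K = GL₂(𝒪_F)`, as a subgroup of `G`. -/
def maxCompact : Subgroup (G F) :=
  (Matrix.GeneralLinearGroup.map (n := Fin 2) (integers F).subtype).range

/-- `KZ`, where `Z` is the centre of `G`. -/
def KZ : Subgroup (G F) := maxCompact F ⊔ Subgroup.center (G F)

variable {F}

theorem mem_maxCompact {g : G F} :
    g ∈ maxCompact F ↔ (∀ i j, ‖g.val i j‖ ≤ 1) ∧ ∀ i j, ‖g⁻¹.val i j‖ ≤ 1 := by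
  constructor
  · rintro ⟨u, rfl⟩
    rw [← map_inv]
    exact ⟨fun i j => mem_integers.mp (u i j).2, fun i j => mem_integers.mp (u⁻¹ i j).2⟩
  · rintro ⟨h1, h2⟩
    let A : Matrix (Fin 2) (Fin 2) (integers F) := fun i j => ⟨g.val i j, mem_integers.mpr (h1 i j)⟩
    let B : Matrix (Fin 2) (Fin 2) (integers F) :=
      fun i j => ⟨g⁻¹.val i j, mem_integers.mpr (h2 i j)⟩
    have hinj : Function.Injective ((integers F).subtype.mapMatrix (m := Fin 2)) := by
      intro M N h
      ext i j
      exact congrFun (congrFun h i) j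
    have hA : (integers F).subtype.mapMatrix A = g.val := rfl
    have hB : (integers F).subtype.mapMatrix B = g⁻¹.val := rfl
    refine ⟨⟨A, B, hinj ?_, hinj ?_⟩, ?_⟩
    · rw [map_mul, hA, hB, map_one, ← Units.val_mul, mul_inv_cancel, Units.val_one]
    · rw [map_mul, hA, hB, map_one, ← Units.val_mul, inv_mul_cancel, Units.val_one]
    · ext i j
      rfl

/-- The uniformizer as a unit of `F`. -/
def IsUniformizer.unit {ϖ : F} (hϖ : IsUniformizer ϖ) : Fˣ := Units.mk0 ϖ hϖ.ne_zero

/-- The central element `ϖ ^ n` of `G`. -/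
def IsUniformizer.central {ϖ : F} (hϖ : IsUniformizer ϖ) (n : ℤ) : G F :=
  Matrix.GeneralLinearGroup.scalar (Fin 2) (hϖ.unit ^ n)

/-- `α = diag(1, ϖ)`. -/
def IsUniformizer.alpha {ϖ : F} (hϖ : IsUniformizer ϖ) : G F :=
  Matrix.GeneralLinearGroup.mkOfDetNeZero !![1, 0; 0, ϖ] (by simpa using hϖ.ne_zero)

section

variable {ϖ : F} (hϖ : IsUniformizer ϖ)

theorem central_val (n : ℤ) : (hϖ.central n).val = Matrix.scalar (Fin 2) (ϖ ^ n) := by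
  rw [IsUniformizer.central, Matrix.GeneralLinearGroup.coe_scalar, Units.val_zpow_eq_zpow_val]
  rfl

theorem central_add (m n : ℤ) : hϖ.central (m + n) = hϖ.central m * hϖ.central n := by
  simp only [IsUniformizer.central, zpow_add, map_mul]

theorem central_zero : hϖ.central 0 = 1 := by
  simp only [IsUniformizer.central, zpow_zero, map_one]

theorem central_comm (n : ℤ) (g : G F) : hϖ.central n * g = g * hϖ.central n :=
  Matrix.GeneralLinearGroup.scalar_commute _ _

theorem central_eq_zero_of_mem {n : ℤ} (h : hϖ.central n ∈ maxCompact F) : n = 0 := by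
  obtain ⟨h1, h2⟩ := mem_maxCompact.mp h
  have hinv : (hϖ.central n)⁻¹ = hϖ.central (-n) := by
    rw [inv_eq_iff_mul_eq_one, ← central_add, add_neg_cancel, central_zero]
  have a := h1 0 0
  have b := h2 0 0
  rw [hinv] at b
  rw [central_val] at a b
  simp only [Matrix.scalar_apply, Matrix.diagonal_apply_eq, norm_inv, norm_zpow, zpow_neg] at a b
  have hp : 0 < ‖ϖ‖ ^ n := zpow_pos (norm_pos_iff.mpr hϖ.ne_zero) n
  refine hϖ.zpow_injective (le_antisymm ?_ ?_)
  · rwa [norm_zpow]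
  · rw [norm_zpow]
    exact (inv_le_one₀ hp).mp b

theorem exists_central_mul_mem {g : G F} (hg : g ∈ KZ F) :
    ∃ n : ℤ, hϖ.central (-n) * g ∈ maxCompact F := by
  rw [KZ, Subgroup.mem_sup_of_normal_right] at hg
  obtain ⟨k, hk, z, hz, rfl⟩ := hg
  rw [Matrix.GeneralLinearGroup.center_eq_range_scalar] at hz
  obtain ⟨a, rfl⟩ := hz
  obtain ⟨n, hn⟩ := hϖ.exists_zpow a.ne_zero
  refine ⟨n, ?_⟩
  rw [← mul_assoc, central_comm, mul_assoc]
  refine mul_mem hk ?_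
  rw [IsUniformizer.central, ← map_mul]
  have key : ∀ u : Fˣ, ‖(u : F)‖ = 1 →
      ∀ i j, ‖(Matrix.GeneralLinearGroup.scalar (Fin 2) u).val i j‖ ≤ 1 := by
    intro u hu i j
    rw [Matrix.GeneralLinearGroup.coe_scalar, Matrix.scalar_apply, Matrix.diagonal_apply]
    split_ifs
    · exact hu.le
    · simp
  have hu : ‖((hϖ.unit ^ (-n) * a : Fˣ) : F)‖ = 1 := by
    rw [Units.val_mul, Units.val_zpow_eq_zpow_val]
    exact hn
  refine mem_maxCompact.mpr ⟨key _ hu, ?_⟩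
  rw [← map_inv]
  refine key _ ?_
  rw [Units.val_inv_eq_inv_val, norm_inv, hu, inv_one]

/-- The integer `n` with `ϖ ^ (-n) * g ∈ K`, for `g ∈ KZ`. -/
def IsUniformizer.exponent (g : KZ F) : ℤ := (exists_central_mul_mem hϖ g.2).choose

theorem exponent_spec (g : KZ F) : hϖ.central (-hϖ.exponent g) * g.1 ∈ maxCompact F :=
  (exists_central_mul_mem hϖ g.2).choose_spec

theorem exponent_unique (g : KZ F) {n : ℤ} (hn : hϖ.central (-n) * g.1 ∈ maxCompact F) :
    hϖ.exponent g = n := by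
  have h := mul_mem hn (inv_mem (exponent_spec hϖ g))
  rw [mul_inv_rev, mul_assoc, mul_inv_cancel_left] at h
  have hinv : (hϖ.central (-hϖ.exponent g))⁻¹ = hϖ.central (hϖ.exponent g) := by
    rw [inv_eq_iff_mul_eq_one, ← central_add, neg_add_cancel, central_zero]
  rw [hinv, ← central_add] at h
  have := central_eq_zero_of_mem hϖ h
  lia

theorem exponent_mul (g h : KZ F) : hϖ.exponent (g * h) = hϖ.exponent g + hϖ.exponent h := by
  apply exponent_unique
  have := mul_mem (exponent_spec hϖ g) (exponent_spec hϖ h)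
  rw [neg_add, central_add]
  convert! this using 1
  rw [mul_assoc, mul_assoc, Subgroup.coe_mul, ← mul_assoc (hϖ.central _) g.1 h.1,
    central_comm hϖ _ g.1, mul_assoc]

theorem exponent_one : hϖ.exponent 1 = 0 := by
  apply exponent_unique
  rw [neg_zero, central_zero, one_mul]
  exact one_mem _

end

end Groups
section Topology

variable {F : Type*} [NormedField F] [IsUltrametricDist F]

theorem isOpen_maxCompact : IsOpen (maxCompact F : Set (G F)) := by
  have h : (maxCompact F : Set (G F)) =
      (⋂ i, ⋂ j, (fun g : G F => g.val i j) ⁻¹' Metric.closedBall 0 1) ∩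
        ⋂ i, ⋂ j, (fun g : G F => g⁻¹.val i j) ⁻¹' Metric.closedBall 0 1 := by
    ext g
    simp [mem_maxCompact]
  have hc : ∀ i j, Continuous fun g : G F => g.val i j := fun i j =>
    (Units.continuous_val (M := Matrix (Fin 2) (Fin 2) F)).matrix_elem i j
  have hb : IsOpen (Metric.closedBall (0 : F) 1) :=
    IsUltrametricDist.isOpen_closedBall _ one_ne_zero
  rw [h]
  refine IsOpen.inter ?_ ?_
  · exact isOpen_iInter_of_finite fun i => isOpen_iInter_of_finite fun j => hb.preimage (hc i j)
  · exact isOpen_iInter_of_finite fun i => isOpen_iInter_of_finite fun j =>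
      hb.preimage ((hc i j).comp continuous_inv)

theorem isOpen_KZ : IsOpen (KZ F : Set (G F)) :=
  Subgroup.isOpen_mono (le_sup_left : maxCompact F ≤ KZ F) isOpen_maxCompact

theorem isCompact_maxCompact [ProperSpace F] : IsCompact (maxCompact F : Set (G F)) := by
  let B : Set (Matrix (Fin 2) (Fin 2) F) := {M | ∀ i j, M i j ∈ Metric.closedBall (0 : F) 1}
  have hB : IsCompact B := by
    have hpi : IsCompact (Set.univ.pi fun _ : Fin 2 => Set.univ.pi fun _ : Fin 2 =>
        Metric.closedBall (0 : F) 1) :=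
      isCompact_univ_pi fun _ => isCompact_univ_pi fun _ => isCompact_closedBall _ _
    have e : (B : Set (Fin 2 → Fin 2 → F)) = Set.univ.pi fun _ : Fin 2 => Set.univ.pi fun _ : Fin 2 =>
        Metric.closedBall (0 : F) 1 := by
      apply Set.ext
      intro M
      exact ⟨fun h i _ j _ => h i j, fun h i j => h i trivial j trivial⟩
    rw [← e] at hpi
    exact hpi
  have hB' : IsCompact (MulOpposite.op '' B) := hB.image MulOpposite.continuous_op
  have h : (maxCompact F : Set (G F)) =
      Units.embedProduct (Matrix (Fin 2) (Fin 2) F) ⁻¹' (B ×ˢ (MulOpposite.op '' B)) := by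
    ext g
    rw [SetLike.mem_coe, mem_maxCompact, Set.mem_preimage, Set.mem_prod]
    refine and_congr ?_ ?_
    · exact forall₂_congr fun i j => mem_closedBall_zero_iff.symm
    · constructor
      · exact fun h => ⟨g⁻¹.val, fun i j => mem_closedBall_zero_iff.mpr (h i j), rfl⟩
      · rintro ⟨M, hM, he⟩ i j
        have he' : M = g⁻¹.val := MulOpposite.op_injective he
        rw [← he']
        exact mem_closedBall_zero_iff.mp (hM i j)
  rw [h]
  exact Units.isClosedEmbedding_embedProduct.isCompact_preimage (hB.prod hB')

/-- The double coset `KZ a KZ` consists of finitely many left cosets of `KZ`. -/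
theorem finite_doubleCoset [ProperSpace F] (a : G F) :
    {y : G F ⧸ KZ F | ∃ κ : KZ F, y = (κ.1 * a : G F)}.Finite := by
  have : DiscreteTopology (G F ⧸ KZ F) := QuotientGroup.discreteTopology isOpen_KZ
  have hc : Continuous fun k : G F => ((k * a : G F) : G F ⧸ KZ F) :=
    QuotientGroup.continuous_mk.comp (continuous_mul_const a)
  refine ((isCompact_maxCompact (F := F)).image hc).finite_of_discrete.subset ?_
  rintro _ ⟨⟨g, hg⟩, rfl⟩
  have hκ := hg
  rw [KZ, Subgroup.mem_sup_of_normal_right] at hκ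
  obtain ⟨k, hk, z, hz, hkz⟩ := hκ
  refine ⟨k, hk, ?_⟩
  have hzK : z ∈ KZ F := (le_sup_right : Subgroup.center (G F) ≤ KZ F) hz
  have e : (k * a)⁻¹ * (g * a) = z := by
    rw [← hkz, mul_assoc k z a, ← Subgroup.mem_center_iff.mp hz a]
    group
  refine QuotientGroup.eq.mpr ?_
  change (k * a)⁻¹ * (g * a) ∈ KZ F
  rwa [e]

theorem central_rearrange {k₁ k₂ z₁ z₂ a c z : G F} (h₁ : z₁ ∈ Subgroup.center (G F))
    (h₂ : z₂ ∈ Subgroup.center (G F)) :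
    k₁ * a * k₂ * c * (z₁ * z₂ * z) = k₁ * z₁ * a * (k₂ * z₂) * (c * z) := by
  have c₁ := Subgroup.mem_center_iff.mp h₁
  have c₂ := Subgroup.mem_center_iff.mp h₂
  calc k₁ * a * k₂ * c * (z₁ * z₂ * z) = k₁ * (a * k₂ * c * z₁) * z₂ * z := by group
    _ = k₁ * z₁ * a * k₂ * (c * z₂) * z := by rw [c₁]; group
    _ = _ := by rw [c₂]; group

end Topology

section Induction

variable {F : Type*} [NormedField F] [IsUltrametricDist F]
variable {R W : Type*} [CommRing R] [AddCommGroup W] [Module R W]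

/-- The support of `f` is compact modulo the centre `Z`: it lies in `C * Z` with `C` compact. -/
def CompactModCenter (f : G F → W) : Prop :=
  ∃ C : Set (G F), IsCompact C ∧ Function.support f ⊆ C * (Subgroup.center (G F) : Set (G F))

/-- The compact induction `ind_{KZ}^G ρ`: the functions `f : G → W` with support compact modulo `Z`
and `f(κ g) = ρ(κ) f(g)` for `κ ∈ KZ`. -/
def compactInd (ρ : Representation R (KZ F) W) : Submodule R (G F → W) where
  carrier := {f | (∀ (κ : KZ F) (g : G F), f (κ.1 * g) = ρ κ (f g)) ∧ CompactModCenter f}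
  zero_mem' := ⟨fun κ g => by simp, ∅, isCompact_empty, by simp⟩
  add_mem' := by
    rintro f f' ⟨h1, C, hC, hs⟩ ⟨h1', C', hC', hs'⟩
    refine ⟨fun κ g => by simp [h1, h1'], C ∪ C', hC.union hC', ?_⟩
    rw [Set.union_mul]
    exact (Function.support_add f f').trans (Set.union_subset_union hs hs')
  smul_mem' := by
    rintro r f ⟨h1, C, hC, hs⟩
    exact ⟨fun κ g => by simp [h1], C, hC, (Function.support_const_smul_subset r f).trans hs⟩

/-- The action of `G` on `ind_{KZ}^G ρ` by right translation, `(g f)(x) = f(x g)`. -/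
def compactIndRep (ρ : Representation R (KZ F) W) : Representation R (G F) (compactInd ρ) where
  toFun g :=
    { toFun := fun f => ⟨fun x => f.1 (x * g), by
        obtain ⟨h1, C, hC, hs⟩ := f.2
        refine ⟨fun κ x => by
          change f.1 (κ.1 * x * g) = _
          rw [mul_assoc, h1], (fun x => x * g⁻¹) '' C,
          hC.image (continuous_mul_const _), ?_⟩
        intro x hx
        obtain ⟨c, hc, z, hz, hcz⟩ := hs (show x * g ∈ Function.support f.1 from hx)
        refine ⟨c * g⁻¹, ⟨c, hc, rfl⟩, z, hz, ?_⟩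
        have hcz' : c * z = x * g := hcz
        change c * g⁻¹ * z = x
        rw [mul_assoc, Subgroup.mem_center_iff.mp hz g⁻¹, ← mul_assoc, hcz', mul_inv_cancel_right]⟩
      map_add' := fun _ _ => rfl
      map_smul' := fun _ _ => rfl }
  map_one' := by
    ext f x
    exact congrArg f.1 (mul_one x)
  map_mul' g h := by
    ext f x
    exact congrArg f.1 (mul_assoc x g h).symm

end Induction

section SymmetricPowers

variable (E : Type*) [Field E]

/-- `Sym^d E²`: homogeneous polynomials of degree `d` in `x = X 0` and `y = X 1`. -/
abbrev Sym (d : ℕ) : Submodule E (MvPolynomial (Fin 2) E) :=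
  MvPolynomial.homogeneousSubmodule (Fin 2) E d

variable {E}

/-- The substitution `x ↦ a x + c y`, `y ↦ b x + d y` for the matrix `!![a, b; c, d]`. -/
def substitution (M : Matrix (Fin 2) (Fin 2) E) :
    MvPolynomial (Fin 2) E →ₐ[E] MvPolynomial (Fin 2) E :=
  MvPolynomial.aeval fun j => ∑ i, MvPolynomial.C (M i j) * MvPolynomial.X i

theorem substitution_mem (M : Matrix (Fin 2) (Fin 2) E) (d : ℕ) :
    ∀ P ∈ Sym E d, (substitution M).toLinearMap P ∈ Sym E d := by
  intro P hP
  rw [MvPolynomial.mem_homogeneousSubmodule] at hP ⊢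
  have := hP.aeval (n := 1) (fun j => ∑ i, MvPolynomial.C (M i j) * MvPolynomial.X i) (by
    intro j
    refine MvPolynomial.IsHomogeneous.sum _ _ _ fun i _ => ?_
    simpa using MvPolynomial.isHomogeneous_C_mul_X (M i j) i)
  rwa [one_mul] at this

/-- The action of a matrix on `Sym^d E²`. -/
def symMap (d : ℕ) (M : Matrix (Fin 2) (Fin 2) E) : Sym E d →ₗ[E] Sym E d :=
  (substitution M).toLinearMap.restrict (substitution_mem M d)

theorem substitution_mul (M N : Matrix (Fin 2) (Fin 2) E) :
    substitution (M * N) = (substitution M).comp (substitution N) := by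
  apply MvPolynomial.algHom_ext
  intro j
  simp only [substitution, AlgHom.comp_apply, MvPolynomial.aeval_X, map_mul,
    MvPolynomial.algHom_C, MvPolynomial.algebraMap_eq, Fin.sum_univ_two, Matrix.mul_apply, map_add]
  ring

theorem substitution_one : substitution (1 : Matrix (Fin 2) (Fin 2) E) = AlgHom.id E _ := by
  apply MvPolynomial.algHom_ext
  intro j
  fin_cases j <;> simp [substitution, Fin.sum_univ_two]

theorem symMap_mul (d : ℕ) (M N : Matrix (Fin 2) (Fin 2) E) :
    symMap d (M * N) = symMap d M ∘ₗ symMap d N := by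
  ext1 P
  apply Subtype.ext
  change substitution (M * N) P.1 = substitution M (substitution N P.1)
  rw [substitution_mul]
  rfl

theorem symMap_one (d : ℕ) : symMap d (1 : Matrix (Fin 2) (Fin 2) E) = LinearMap.id := by
  ext1 P
  apply Subtype.ext
  change substitution 1 P.1 = P.1
  rw [substitution_one]
  rfl

end SymmetricPowers

section Algebraic

variable (p : ℕ) [Fact p.Prime]
variable (F : Type*) [NormedField F] [IsUltrametricDist F] [NormedAlgebra ℚ_[p] F]
variable (E : Type*) [NormedField E] [IsUltrametricDist E] [NormedAlgebra ℚ_[p] E]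

/-- The set `S` of embeddings of `F` into `E`. -/
abbrev Emb : Type _ := F →ₐ[ℚ_[p]] E

variable {p F E}

/-- The space `⨂_σ Sym^{d_σ} E²` of `ρ_d`. -/
def V (d : Emb p F E → ℕ) : Type _ := ⨂[E] σ : Emb p F E, Sym E (d σ)

instance (d : Emb p F E → ℕ) : AddCommGroup (V d) :=
  inferInstanceAs (AddCommGroup (⨂[E] σ : Emb p F E, Sym E (d σ)))

instance (d : Emb p F E → ℕ) : Module E (V d) :=
  inferInstanceAs (Module E (⨂[E] σ : Emb p F E, Sym E (d σ)))

/-- The pure tensor `⨂_σ v_σ`. -/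
def pureTensor {d : Emb p F E → ℕ} (v : (σ : Emb p F E) → Sym E (d σ)) : V d :=
  PiTensorProduct.tprod E v

/-- The action of a matrix over `F` on `⨂_σ Sym^{d_σ} E²`, through `σ` on the factor `σ`. -/
def tensorMap (d : Emb p F E → ℕ) (M : Matrix (Fin 2) (Fin 2) F) : V d →ₗ[E] V d :=
  PiTensorProduct.map fun σ => symMap (d σ) (M.map σ)

theorem tensorMap_mul (d : Emb p F E → ℕ) (M N : Matrix (Fin 2) (Fin 2) F) :
    tensorMap d (M * N) = tensorMap d M ∘ₗ tensorMap d N := by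
  have h : (fun σ : Emb p F E => symMap (d σ) ((M * N).map σ)) =
      fun σ => symMap (d σ) (M.map σ) ∘ₗ symMap (d σ) (N.map σ) := by
    funext σ
    rw [← symMap_mul, Matrix.map_mul]
  rw [tensorMap, h]
  exact PiTensorProduct.map_comp _ _

theorem tensorMap_one (d : Emb p F E → ℕ) :
    tensorMap d (1 : Matrix (Fin 2) (Fin 2) F) = LinearMap.id := by
  have h : (fun σ : Emb p F E => symMap (d σ) ((1 : Matrix (Fin 2) (Fin 2) F).map σ)) =
      fun σ => LinearMap.id := by
    funext σ
    rw [Matrix.map_one _ (map_zero σ) (map_one σ), symMap_one]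
  rw [tensorMap, h]
  exact PiTensorProduct.map_id

section

variable {ϖ : F} (hϖ : IsUniformizer ϖ) (d : Emb p F E → ℕ)

/-- The representation `ρ_d` of `KZ`: an element of `K` acts through the embeddings `σ` on the
factors `Sym^{d_σ} E²`, and the central element `ϖ` acts trivially. -/
def rho : Representation E (KZ F) (V d) where
  toFun g := tensorMap d (hϖ.central (-hϖ.exponent g) * g.1).val
  map_one' := by
    rw [exponent_one, neg_zero, central_zero, one_mul]
    exact tensorMap_one d
  map_mul' g h := by
    rw [Module.End.mul_eq_comp, ← tensorMap_mul, ← Units.val_mul, exponent_mul, neg_add,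
      central_add]
    congr 2
    rw [mul_assoc, mul_assoc, Subgroup.coe_mul, ← mul_assoc (hϖ.central _) g.1 h.1,
      central_comm hϖ _ g.1, mul_assoc]

theorem rho_mul (g h : KZ F) : rho hϖ d (g * h) = rho hϖ d g ∘ₗ rho hϖ d h :=
  map_mul (rho hϖ d) g h

/-- `U_d = ⨂_σ U_{d_σ}`, where `U_{d_σ}` sends `x` to `σ(ϖ) x` and `y` to `y`; on the monomials
`x ^ (d_σ - i) * y ^ i` it is the diagonal matrix with entries `σ(ϖ) ^ (d_σ - i)`. -/
def heckeU (ϖ : F) : V d →ₗ[E] V d := tensorMap d !![ϖ, 0; 0, 1]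

open Classical in
/-- The function `ψ : G → End V` with support in `KZ α⁻¹ KZ` and
`ψ(κ₁ α⁻¹ κ₂) = ρ(κ₁) U_d ρ(κ₂)`. -/
def psi (g : G F) : V d →ₗ[E] V d :=
  if h : ∃ κ : KZ F × KZ F, g = κ.1.1 * hϖ.alpha⁻¹ * κ.2.1 then
    rho hϖ d h.choose.1 ∘ₗ heckeU d ϖ ∘ₗ rho hϖ d h.choose.2
  else 0

theorem central_one_mul_alpha_inv :
    (hϖ.central 1 * hϖ.alpha⁻¹).val = !![ϖ, 0; 0, 1] := by
  have h : hϖ.central 1 * hϖ.alpha⁻¹ =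
      Matrix.GeneralLinearGroup.mkOfDetNeZero !![ϖ, 0; 0, 1] (by simpa using hϖ.ne_zero) := by
    rw [mul_inv_eq_iff_eq_mul]
    ext i j
    rw [central_val, zpow_one, Units.val_mul]
    fin_cases i <;> fin_cases j <;>
      simp [IsUniformizer.alpha, Matrix.GeneralLinearGroup.mkOfDetNeZero, Matrix.mul_apply,
        Fin.sum_univ_two]
  rw [h]
  rfl

theorem rho_heckeU_rho (κ₁ κ₂ : KZ F) :
    rho hϖ d κ₁ ∘ₗ heckeU d ϖ ∘ₗ rho hϖ d κ₂ =
      tensorMap d (hϖ.central (1 - hϖ.exponent κ₁ - hϖ.exponent κ₂) *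
        (κ₁.1 * hϖ.alpha⁻¹ * κ₂.1)).val := by
  rw [heckeU, ← central_one_mul_alpha_inv hϖ]
  change tensorMap d _ ∘ₗ tensorMap d _ ∘ₗ tensorMap d _ = _
  rw [← tensorMap_mul, ← tensorMap_mul, ← Units.val_mul, ← Units.val_mul]
  congr 2
  rw [show (1 - hϖ.exponent κ₁ - hϖ.exponent κ₂ : ℤ) =
    -hϖ.exponent κ₁ + (1 + -hϖ.exponent κ₂) by ring, central_add, central_add]
  simp only [mul_assoc]
  congr 1
  rw [← mul_assoc κ₁.1, ← central_comm, mul_assoc]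
  congr 1
  rw [← mul_assoc hϖ.alpha⁻¹, ← central_comm, mul_assoc, ← mul_assoc κ₁.1, ← central_comm,
    mul_assoc]

theorem norm_det_eq_one {k : G F} (hk : k ∈ maxCompact F) : ‖k.val.det‖ = 1 := by
  have key : ∀ {k : G F}, k ∈ maxCompact F → ‖k.val.det‖ ≤ 1 := by
    rintro _ ⟨u, rfl⟩
    have : ((Matrix.GeneralLinearGroup.map (n := Fin 2) (integers F).subtype u).val).det
        = (integers F).subtype u.val.det := (RingHom.map_det _ _).symm
    rw [this]
    exact mem_integers.mp (u.val.det).2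
  have h1 := key hk
  have h2 := key (inv_mem hk)
  have h3 : k.val.det * k⁻¹.val.det = 1 := by
    rw [← Matrix.det_mul, ← Units.val_mul, mul_inv_cancel, Units.val_one, Matrix.det_one]
  have h4 : ‖k.val.det‖ * ‖k⁻¹.val.det‖ = 1 := by rw [← norm_mul, h3, norm_one]
  nlinarith [norm_nonneg k.val.det, norm_nonneg k⁻¹.val.det]

theorem norm_det_KZ (g : KZ F) : ‖g.1.val.det‖ = ‖ϖ‖ ^ (2 * hϖ.exponent g) := by
  have h := norm_det_eq_one (exponent_spec hϖ g)
  rw [Units.val_mul, Matrix.det_mul, central_val, norm_mul] at h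
  have h0 : ‖ϖ‖ ≠ 0 := norm_ne_zero_iff.mpr hϖ.ne_zero
  rw [show (Matrix.scalar (Fin 2) (ϖ ^ (-hϖ.exponent g))).det = ϖ ^ (-(2 * hϖ.exponent g)) by
    rw [Matrix.scalar_apply, Matrix.det_diagonal, Fin.prod_univ_two, ← zpow_add₀ hϖ.ne_zero]
    congr 1
    ring, norm_zpow, zpow_neg] at h
  exact (inv_mul_eq_one₀ (zpow_ne_zero _ h0)).mp h |>.symm

theorem exponent_add_eq {κ₁ κ₂ κ₁' κ₂' : KZ F}
    (h : κ₁.1 * hϖ.alpha⁻¹ * κ₂.1 = κ₁'.1 * hϖ.alpha⁻¹ * κ₂'.1) :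
    hϖ.exponent κ₁ + hϖ.exponent κ₂ = hϖ.exponent κ₁' + hϖ.exponent κ₂' := by
  have hd := congrArg (fun g : G F => ‖g.val.det‖) h
  have h0 : 0 < ‖ϖ‖ := norm_pos_iff.mpr hϖ.ne_zero
  simp only [Units.val_mul, Matrix.det_mul, norm_mul, norm_det_KZ hϖ] at hd
  have ha : ‖(hϖ.alpha⁻¹).val.det‖ ≠ 0 := by
    rw [norm_ne_zero_iff]
    exact ((Matrix.isUnit_iff_isUnit_det _).mp (hϖ.alpha⁻¹).isUnit).ne_zero
  rw [mul_right_comm, mul_right_comm (‖ϖ‖ ^ (2 * hϖ.exponent κ₁'))] at hd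
  have hd := mul_right_cancel₀ ha hd
  rw [← zpow_add₀ h0.ne', ← zpow_add₀ h0.ne'] at hd
  have := zpow_right_injective₀ h0 hϖ.norm_lt_one.ne hd
  lia

theorem psi_apply (κ₁ κ₂ : KZ F) : psi hϖ d (κ₁.1 * hϖ.alpha⁻¹ * κ₂.1) =
    rho hϖ d κ₁ ∘ₗ heckeU d ϖ ∘ₗ rho hϖ d κ₂ := by
  have h : ∃ κ : KZ F × KZ F, κ₁.1 * hϖ.alpha⁻¹ * κ₂.1 = κ.1.1 * hϖ.alpha⁻¹ * κ.2.1 :=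
    ⟨(κ₁, κ₂), rfl⟩
  rw [psi, dif_pos h, rho_heckeU_rho, rho_heckeU_rho, ← h.choose_spec]
  have := exponent_add_eq hϖ h.choose_spec
  congr 4
  lia

/-- `ψ(α⁻¹) = U_d`. -/
theorem psi_alpha_inv : psi hϖ d hϖ.alpha⁻¹ = heckeU d ϖ := by
  have := psi_apply hϖ d 1 1
  rw [Subgroup.coe_one, one_mul, mul_one, map_one, Module.End.one_eq_id, LinearMap.id_comp,
    LinearMap.comp_id] at this
  exact this

theorem comp_comp_assoc {d : Emb p F E → ℕ} (a b u c e : V d →ₗ[E] V d) :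
    (a ∘ₗ b) ∘ₗ u ∘ₗ (c ∘ₗ e) = a ∘ₗ (b ∘ₗ u ∘ₗ c) ∘ₗ e := by
  simp only [LinearMap.comp_assoc]

theorem mul_mem_doubleCoset {H : Subgroup (G F)} {a : G F} (κ₁ κ₂ : H) {g : G F}
    (h : ∃ κ : H × H, κ₁.1 * g * κ₂.1 = κ.1.1 * a * κ.2.1) :
    ∃ κ : H × H, g = κ.1.1 * a * κ.2.1 := by
  obtain ⟨κ, hκ⟩ := h
  refine ⟨(κ₁⁻¹ * κ.1, κ.2 * κ₂⁻¹), ?_⟩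
  have : g = κ₁.1⁻¹ * (κ₁.1 * g * κ₂.1) * κ₂.1⁻¹ := by group
  rw [this, hκ]
  simp only [Subgroup.coe_mul, Subgroup.coe_inv, mul_assoc]

/-- `ψ(κ₁ g κ₂) = ρ(κ₁) ψ(g) ρ(κ₂)`. -/
theorem psi_mul (κ₁ κ₂ : KZ F) (g : G F) :
    psi hϖ d (κ₁.1 * g * κ₂.1) = rho hϖ d κ₁ ∘ₗ psi hϖ d g ∘ₗ rho hϖ d κ₂ := by
  by_cases h : ∃ κ : KZ F × KZ F, g = κ.1.1 * hϖ.alpha⁻¹ * κ.2.1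
  · obtain ⟨κ, rfl⟩ := h
    have e : κ₁.1 * (κ.1.1 * hϖ.alpha⁻¹ * κ.2.1) * κ₂.1 =
        (κ₁ * κ.1).1 * hϖ.alpha⁻¹ * (κ.2 * κ₂).1 := by
      simp only [Subgroup.coe_mul, mul_assoc]
    rw [e, psi_apply, psi_apply, rho_mul, rho_mul]
    exact comp_comp_assoc _ _ _ _ _
  · rw [psi, psi, dif_neg h, dif_neg fun h' => h (mul_mem_doubleCoset κ₁ κ₂ h'),
      LinearMap.zero_comp, LinearMap.comp_zero]

theorem exists_of_psi_ne_zero {g : G F} (h : psi hϖ d g ≠ 0) :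
    ∃ κ : KZ F × KZ F, g = κ.1.1 * hϖ.alpha⁻¹ * κ.2.1 := by
  by_contra hn
  exact h (by rw [psi, dif_neg hn])

end
section Hecke

variable {ϖ : F} (hϖ : IsUniformizer ϖ) (d : Emb p F E → ℕ)

/-- `ind_{KZ}^G ρ_d`. -/
abbrev indRho : Submodule E (G F → V d) := compactInd (R := E) (W := V d) (rho hϖ d)

/-- The action of `G` on `ind_{KZ}^G ρ_d`. -/
abbrev indRhoRep : Representation E (G F) (indRho hϖ d) :=
  compactIndRep (R := E) (W := V d) (rho hϖ d)

/-- The value at `g` of the Hecke operator on `f`: the sum of `ψ(x) f(x⁻¹ g)` over the cosets `x KZ`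
in `G / KZ`, where the summand depends only on the coset. -/
def heckeFun (f : G F → V d) (g : G F) : V d :=
  ∑ᶠ y : G F ⧸ KZ F, psi hϖ d y.out (f (y.out⁻¹ * g))

variable {d}

theorem summand_eq {f : G F → V d} (hf : f ∈ indRho hϖ d) (g x : G F) :
    psi hϖ d (x : G F ⧸ KZ F).out (f ((x : G F ⧸ KZ F).out⁻¹ * g)) =
      psi hϖ d x (f (x⁻¹ * g)) := by
  obtain ⟨κ, hκ⟩ := QuotientGroup.mk_out_eq_mul (KZ F) x
  rw [hκ]
  have h1 := psi_mul hϖ d 1 κ x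
  rw [Subgroup.coe_one, one_mul, map_one, Module.End.one_eq_id, LinearMap.id_comp] at h1
  rw [h1, LinearMap.comp_apply, ← hf.1]
  congr 2
  group

theorem finite_psi_support [ProperSpace F] :
    {y : G F ⧸ KZ F | psi hϖ d y.out ≠ 0}.Finite := by
  refine (finite_doubleCoset hϖ.alpha⁻¹).subset fun y hy => ?_
  obtain ⟨κ, hκ⟩ := exists_of_psi_ne_zero hϖ d hy
  refine ⟨κ.1, ?_⟩
  have hy' : ((y.out : G F) : G F ⧸ KZ F) = y := QuotientGroup.out_eq' y
  rw [← hy', hκ]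
  refine QuotientGroup.eq.mpr ?_
  rw [mul_inv_rev, mul_assoc, inv_mul_cancel, mul_one]
  exact inv_mem κ.2.2

theorem summand_finite [ProperSpace F] (f : G F → V d) (g : G F) :
    (Function.support fun y : G F ⧸ KZ F => psi hϖ d y.out (f (y.out⁻¹ * g))).Finite := by
  refine (finite_psi_support hϖ (d := d)).subset fun y hy h0 => hy ?_
  change psi hϖ d y.out (f (y.out⁻¹ * g)) = 0
  rw [h0, LinearMap.zero_apply]

theorem heckeFun_mem [ProperSpace F] {f : G F → V d} (hf : f ∈ indRho hϖ d) :
    heckeFun hϖ d f ∈ indRho hϖ d := by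
  constructor
  · intro κ g
    have h1 : rho hϖ d κ (heckeFun hϖ d f g) =
        ∑ᶠ y : G F ⧸ KZ F, rho hϖ d κ (psi hϖ d y.out (f (y.out⁻¹ * g))) :=
      (rho hϖ d κ).toAddMonoidHom.map_finsum (summand_finite hϖ f g)
    rw [h1, heckeFun, ← finsum_comp_equiv (MulAction.toPerm κ.1 : Equiv.Perm (G F ⧸ KZ F))]
    refine finsum_congr fun y => ?_
    have hy : (MulAction.toPerm κ.1 : Equiv.Perm (G F ⧸ KZ F)) y =
        ((κ.1 * y.out : G F) : G F ⧸ KZ F) := by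
      conv_lhs => rw [← QuotientGroup.out_eq' y]
      rfl
    rw [hy, summand_eq hϖ hf]
    have h2 := psi_mul hϖ d κ 1 y.out
    rw [Subgroup.coe_one, mul_one, map_one, Module.End.one_eq_id, LinearMap.comp_id] at h2
    rw [h2, LinearMap.comp_apply]
    congr 3
    group
  · obtain ⟨C, hC, hs⟩ := hf.2
    refine ⟨(maxCompact F : Set (G F)) * {hϖ.alpha⁻¹} * (maxCompact F : Set (G F)) * C,
      ((isCompact_maxCompact.mul isCompact_singleton).mul isCompact_maxCompact).mul hC, ?_⟩
    intro g hg
    have : ∃ y : G F ⧸ KZ F, psi hϖ d y.out (f (y.out⁻¹ * g)) ≠ 0 := by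
      by_contra! hn
      exact hg (by rw [heckeFun, finsum_congr hn, finsum_zero])
    obtain ⟨y, hy⟩ := this
    have hpsi : psi hϖ d y.out ≠ 0 := fun h => hy (by rw [h, LinearMap.zero_apply])
    have hfy : f (y.out⁻¹ * g) ≠ 0 := fun h => hy (by rw [h, map_zero])
    obtain ⟨⟨⟨κ₁, hκ₁⟩, ⟨κ₂, hκ₂⟩⟩, hκ⟩ := exists_of_psi_ne_zero hϖ d hpsi
    obtain ⟨c, hc, z, hz, hcz⟩ := hs hfy
    rw [KZ, Subgroup.mem_sup_of_normal_right] at hκ₁ hκ₂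
    obtain ⟨k₁, hk₁, z₁, hz₁, e₁⟩ := hκ₁
    obtain ⟨k₂, hk₂, z₂, hz₂, e₂⟩ := hκ₂
    refine ⟨k₁ * hϖ.alpha⁻¹ * k₂ * c, ⟨_, ⟨_, ⟨_, hk₁, _, rfl, rfl⟩, _, hk₂, rfl⟩, _, hc, rfl⟩,
      z₁ * z₂ * z, mul_mem (mul_mem hz₁ hz₂) hz, ?_⟩
    have hg' : g = y.out * (c * z) := by
      have hcz' : c * z = y.out⁻¹ * g := hcz
      rw [hcz', mul_inv_cancel_left]
    have hκ' : y.out = k₁ * z₁ * hϖ.alpha⁻¹ * (k₂ * z₂) := by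
      rw [hκ, e₁, e₂]
    rw [hg', hκ']
    exact central_rearrange hz₁ hz₂

variable [FiniteDimensional ℚ_[p] F]

theorem properSpace_of_finiteDimensional (p : ℕ) [Fact p.Prime] (F : Type*) [NormedField F]
    [NormedAlgebra ℚ_[p] F] [FiniteDimensional ℚ_[p] F] : ProperSpace F :=
  FiniteDimensional.proper ℚ_[p] F

variable (d)

/-- The Hecke operator `T` on `ind_{KZ}^G ρ_d`. -/
def heckeT : Module.End E (indRho hϖ d) where
  toFun f := ⟨heckeFun hϖ d f.1, by
    have := properSpace_of_finiteDimensional p F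
    exact heckeFun_mem hϖ f.2⟩
  map_add' f f' := by
    have := properSpace_of_finiteDimensional p F
    ext g
    change heckeFun hϖ d (f.1 + f'.1) g = heckeFun hϖ d f.1 g + heckeFun hϖ d f'.1 g
    rw [heckeFun, heckeFun, heckeFun, ← finsum_add_distrib (summand_finite hϖ f.1 g)
      (summand_finite hϖ f'.1 g)]
    exact finsum_congr fun y => by rw [Pi.add_apply, map_add]
  map_smul' r f := by
    have := properSpace_of_finiteDimensional p F
    ext g
    change heckeFun hϖ d (r • f.1) g = r • heckeFun hϖ d f.1 g
    rw [heckeFun, heckeFun, smul_finsum' r (summand_finite hϖ f.1 g)]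
    exact finsum_congr fun y => by rw [Pi.smul_apply, map_smul]

theorem heckeT_comm (g : G F) (f : indRho hϖ d) :
    heckeT hϖ d (indRhoRep hϖ d g f) = indRhoRep hϖ d g (heckeT hϖ d f) := by
  ext x
  exact finsum_congr fun y => congrArg (psi hϖ d y.out) (congrArg f.1 (mul_assoc _ x g))

end Hecke
section Lattice

variable [FiniteDimensional ℚ_[p] F]

/-- Embeddings preserve integrality. -/
theorem norm_emb_le_one (σ : Emb p F E) {x : F} (hx : ‖x‖ ≤ 1) : ‖σ x‖ ≤ 1 := by
  let φ : F →L[ℚ_[p]] E := LinearMap.toContinuousLinearMap σ.toLinearMap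
  have hb : ∀ n : ℕ, ‖σ x‖ ^ n ≤ ‖φ‖ := by
    intro n
    calc ‖σ x‖ ^ n = ‖φ (x ^ n)‖ := by
          rw [← norm_pow, ← map_pow]
          rfl
      _ ≤ ‖φ‖ * ‖x ^ n‖ := φ.le_opNorm _
      _ ≤ ‖φ‖ * 1 := by
          gcongr
          rw [norm_pow]
          exact pow_le_one₀ (norm_nonneg x) hx
      _ = ‖φ‖ := mul_one _
  by_contra! h
  obtain ⟨n, hn⟩ := pow_unbounded_of_one_lt ‖φ‖ h
  exact absurd (hb n) (not_le.mpr hn)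

/-- The polynomial `P` has coefficients in `𝒪_E`. -/
def IsIntegralPoly (P : MvPolynomial (Fin 2) E) : Prop := ∀ m, P.coeff m ∈ integers E

theorem isIntegralPoly_iff (P : MvPolynomial (Fin 2) E) :
    IsIntegralPoly P ↔ P ∈ (MvPolynomial.map (σ := Fin 2) (integers E).subtype).range := by
  change _ ↔ P ∈ Set.range _
  rw [MvPolynomial.mem_range_map_iff_coeffs_subset]
  constructor
  · intro h c hc
    obtain ⟨m, -, rfl⟩ := MvPolynomial.mem_coeffs_iff.mp hc
    exact ⟨⟨_, h m⟩, rfl⟩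
  · intro h m
    by_cases hm : P.coeff m = 0
    · rw [hm]
      exact zero_mem _
    · obtain ⟨y, hy⟩ := h (MvPolynomial.coeff_mem_coeffs m hm)
      rw [← hy]
      exact y.2

theorem isIntegralPoly_substitution {M : Matrix (Fin 2) (Fin 2) E} (hM : ∀ i j, ‖M i j‖ ≤ 1)
    {P : MvPolynomial (Fin 2) E} (hP : IsIntegralPoly P) : IsIntegralPoly (substitution M P) := by
  rw [isIntegralPoly_iff] at hP ⊢
  obtain ⟨Q, rfl⟩ := hP
  induction Q using MvPolynomial.induction_on with
  | C a =>
    refine ⟨MvPolynomial.C a, ?_⟩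
    rw [MvPolynomial.map_C, substitution, MvPolynomial.algHom_C, MvPolynomial.algebraMap_eq]
  | add Q Q' h h' =>
    rw [map_add, map_add]
    exact add_mem h h'
  | mul_X Q i h =>
    rw [map_mul, map_mul]
    refine mul_mem h ?_
    rw [MvPolynomial.map_X, substitution, MvPolynomial.aeval_X]
    refine sum_mem fun j _ => mul_mem ⟨MvPolynomial.C ⟨M j i, mem_integers.mpr (hM j i)⟩, ?_⟩
      ⟨MvPolynomial.X j, MvPolynomial.map_X _ _⟩
    rw [MvPolynomial.map_C]
    rfl

/-- The lattice `ρ⁰_d = ⨂_σ Sym^{d_σ} 𝒪_E²` in `ρ_d`: the `𝒪_E`-span of the tensors of polynomials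
with coefficients in `𝒪_E`. -/
def lattice (d : Emb p F E → ℕ) : Submodule (integers E) (V d) :=
  Submodule.span (integers E)
    {t | ∃ v : (σ : Emb p F E) → Sym E (d σ),
      (∀ σ, IsIntegralPoly (v σ).1) ∧ t = pureTensor v}

theorem tensorMap_mem_lattice (d : Emb p F E → ℕ) {M : Matrix (Fin 2) (Fin 2) F}
    (hM : ∀ i j, ‖M i j‖ ≤ 1) {t : V d} (ht : t ∈ lattice d) : tensorMap d M t ∈ lattice d := by
  induction ht using Submodule.span_induction with
  | mem t ht =>
    obtain ⟨v, hv, rfl⟩ := ht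
    refine Submodule.subset_span ⟨fun σ => symMap (d σ) (M.map σ) (v σ), fun σ => ?_, ?_⟩
    · exact isIntegralPoly_substitution (fun i j => norm_emb_le_one σ (hM i j)) (hv σ)
    · exact PiTensorProduct.map_tprod _ _
  | zero =>
    rw [map_zero]
    exact zero_mem _
  | add x y _ _ hx hy =>
    rw [map_add]
    exact add_mem hx hy
  | smul a x _ hx =>
    rw [LinearMap.map_smul_of_tower]
    exact Submodule.smul_mem _ a hx

variable {ϖ : F} (hϖ : IsUniformizer ϖ) (d : Emb p F E → ℕ)

theorem rho_mem_lattice (κ : KZ F) {t : V d} (ht : t ∈ lattice d) : rho hϖ d κ t ∈ lattice d :=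
  tensorMap_mem_lattice d (mem_maxCompact.mp (exponent_spec hϖ κ)).1 ht

theorem psi_mem_lattice (g : G F) {t : V d} (ht : t ∈ lattice d) : psi hϖ d g t ∈ lattice d := by
  by_cases h : psi hϖ d g = 0
  · rw [h, LinearMap.zero_apply]
    exact zero_mem _
  · obtain ⟨κ, rfl⟩ := exists_of_psi_ne_zero hϖ d h
    rw [psi_apply]
    refine rho_mem_lattice hϖ d _ (tensorMap_mem_lattice d ?_ (rho_mem_lattice hϖ d _ ht))
    intro i j
    fin_cases i <;> fin_cases j <;> simp [hϖ.norm_lt_one.le]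

/-- The lattice `ind_{KZ}^G ρ⁰_d` in `ind_{KZ}^G ρ_d`: the functions with values in `ρ⁰_d`. -/
def indLattice : Submodule (integers E) (indRho hϖ d) where
  carrier := {f | ∀ g, f.1 g ∈ lattice d}
  zero_mem' _ := zero_mem _
  add_mem' hf hf' g := add_mem (hf g) (hf' g)
  smul_mem' a _ hf g := Submodule.smul_mem _ a (hf g)

theorem heckeT_mem_indLattice {f : indRho hϖ d} (hf : f ∈ indLattice hϖ d) :
    heckeT hϖ d f ∈ indLattice hϖ d := by
  intro g
  exact finsum_induction (· ∈ lattice d) (zero_mem _) (fun _ _ => add_mem)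
    fun y => psi_mem_lattice hϖ d _ (hf _)

/-- The Hecke operator `T` on `ind_{KZ}^G ρ⁰_d`. -/
def heckeTLattice : Module.End (integers E) (indLattice hϖ d) :=
  ((heckeT hϖ d).restrictScalars (integers E)).restrict fun _ hf => heckeT_mem_indLattice hϖ d hf

/-- The action of `G` on `ind_{KZ}^G ρ⁰_d`. -/
def indLatticeRep : Representation (integers E) (G F) (indLattice hϖ d) where
  toFun g := ((indRhoRep hϖ d g).restrictScalars (integers E)).restrict fun _ hf x => hf (x * g)
  map_one' := by
    ext f : 2
    exact LinearMap.congr_fun (map_one (indRhoRep hϖ d)) f.1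
  map_mul' g h := by
    ext f : 2
    exact LinearMap.congr_fun (map_mul (indRhoRep hϖ d) g h) f.1

variable (a : integers E)

/-- `(T - a)(ind ρ_d)`. -/
def imageT : Submodule E (indRho hϖ d) := LinearMap.range (heckeT hϖ d - (a : E) • 1)

/-- `(T - a)(ind ρ⁰_d)`. -/
def imageTLattice : Submodule (integers E) (indLattice hϖ d) :=
  LinearMap.range (heckeTLattice hϖ d - a • 1)

theorem imageT_le_comap (g : G F) :
    imageT hϖ d a ≤ (imageT hϖ d a).comap (indRhoRep hϖ d g) := by
  rintro _ ⟨f, rfl⟩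
  refine ⟨indRhoRep hϖ d g f, ?_⟩
  change heckeT hϖ d (indRhoRep hϖ d g f) - (a : E) • indRhoRep hϖ d g f =
    indRhoRep hϖ d g (heckeT hϖ d f - (a : E) • f)
  rw [heckeT_comm, map_sub, map_smul]

theorem imageTLattice_le_comap (g : G F) :
    imageTLattice hϖ d a ≤ (imageTLattice hϖ d a).comap (indLatticeRep hϖ d g) := by
  rintro _ ⟨f, rfl⟩
  refine ⟨indLatticeRep hϖ d g f, Subtype.ext ?_⟩
  change heckeT hϖ d (indRhoRep hϖ d g f.1) - (a : E) • indRhoRep hϖ d g f.1 =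
    indRhoRep hϖ d g (heckeT hϖ d f.1 - (a : E) • f.1)
  rw [heckeT_comm, map_sub, map_smul]

/-- `Π_{d,a} = ind ρ_d / (T - a)(ind ρ_d)`. -/
abbrev PiRep : Type _ := indRho hϖ d ⧸ imageT hϖ d a

/-- The natural map `ind ρ⁰_d → Π_{d,a}`. -/
def toPi : indLattice hϖ d →ₗ[integers E] PiRep hϖ d a :=
  ((imageT hϖ d a).mkQ.restrictScalars (integers E)) ∘ₗ (indLattice hϖ d).subtype

/-- The lattice `Θ_{d,a}`, the image of `ind ρ⁰_d` in `Π_{d,a}`. -/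
def Theta : Submodule (integers E) (PiRep hϖ d a) := LinearMap.range (toPi hϖ d a)

/-- The action of `G` on `Π_{d,a}`. -/
def piRep : Representation E (G F) (PiRep hϖ d a) :=
  (indRhoRep hϖ d).quotient (imageT hϖ d a) (imageT_le_comap hϖ d a)

/-- The action of `G` on `Θ_{d,a}`. -/
def thetaRep : Representation (integers E) (G F) (Theta hϖ d a) where
  toFun g := ((piRep hϖ d a g).restrictScalars (integers E)).restrict (by
    rintro _ ⟨f, rfl⟩
    exact ⟨indLatticeRep hϖ d g f, rfl⟩)
  map_one' := by
    ext f : 2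
    exact LinearMap.congr_fun (map_one (piRep hϖ d a)) f.1
  map_mul' g h := by
    ext f : 2
    exact LinearMap.congr_fun (map_mul (piRep hϖ d a) g h) f.1

/-- The action of `G` on `ind ρ⁰_d / (T - a)(ind ρ⁰_d)`. -/
def quotientRep : Representation (integers E) (G F) (indLattice hϖ d ⧸ imageTLattice hϖ d a) :=
  (indLatticeRep hϖ d).quotient (imageTLattice hϖ d a) (imageTLattice_le_comap hϖ d a)

theorem imageTLattice_le_ker :
    imageTLattice hϖ d a ≤ LinearMap.ker (toPi hϖ d a).rangeRestrict := by
  rintro _ ⟨f, rfl⟩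
  rw [LinearMap.ker_rangeRestrict, LinearMap.mem_ker]
  exact (Submodule.Quotient.mk_eq_zero (imageT hϖ d a)).mpr ⟨f.1, rfl⟩

/-- The natural `𝒪_E[G]`-linear map `θ : ind ρ⁰_d / (T - a)(ind ρ⁰_d) → Θ_{d,a}`. -/
def theta : (quotientRep hϖ d a).IntertwiningMap (thetaRep hϖ d a) where
  toLinearMap := (imageTLattice hϖ d a).liftQ (toPi hϖ d a).rangeRestrict
    (imageTLattice_le_ker hϖ d a)
  isIntertwining' g := by
    apply Submodule.linearMap_qext
    ext f : 1
    rfl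

end Lattice

section Conditions

variable (ι : Emb p F E) (d : Emb p F E → ℕ)

/-- `J_l`: the `σ` with `d_σ ≠ 0` and `σ([ζ]) = ι([ζ]) ^ (p ^ l)` for every `ζ` in the residue field
of `F`. -/
def J (l : ℕ) : Set (Emb p F E) :=
  {σ | d σ ≠ 0 ∧ ∀ (ζ : residueField F) (x : integers F), IsTeichmuller ζ x →
    σ (x : F) = ι (x : F) ^ p ^ l}

/-- `v_σ` for `σ ∈ J_l`: the least `1 ≤ i ≤ f` with `J_{l+i}` nonempty, where the index `l + i` is
taken modulo `f`. -/
def v (l : ℕ) : ℕ :=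
  sInf {i | 1 ≤ i ∧ i ≤ residueDegree F ∧ (J ι d ((l + i) % residueDegree F)).Nonempty}

end Conditions

end Algebraic

end

end HeckeLattice

/-! Everything reduces to one question about functions on the tree. Since `T - a` is injective on
the full induction, the kernel of `theta` vanishes exactly when integrality of `(T - a) f` forces
integrality of `f` (`theta_injective_iff`).

Sufficiency. The tree has vertex set `KZ \ G`, and `height` is multiplicatively a Busemann function
for the end fixed by the upper triangular matrices: every vertex has one lower neighbour, and its
other neighbours are higher. Suppose `(T - a) f` is integral but `f` is not. As the support of `f`
is finite modulo `KZ`, there is a non-integral vertex of greatest height, which may be translated to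
the base vertex. At a higher neighbour, `T f` is the image of `f 1` under `!![1, c; 0, ϖ]` plus
contributions of vertices higher than the base, which are integral. Hence that image is integral,
and evaluating it at `(1, 0)` shows that the multihomogeneous polynomial `f 1` takes integral values
at all `(1, c)` with `c` integral. On Teichmüller representatives, conditions (i) and (ii) turn the
monomials `∏ σ(c) ^ i_σ` into distinct powers, of exponent below `q = p ^ residueDegree F`, of a
single Frobenius twist of `ι c`: the exponents are mixed-radix expansions (`mixedRadix`,
`exists_weights`). A one-variable polynomial of degree below `q` with integral values at `q` points
pairwise at distance one has integral coefficients by Lagrange interpolation, so `f 1` is integral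
(`mem_lattice_of_ev`), a contradiction. The same descent with the zero subgroup in place of the
lattice gives the injectivity of `T - a`.

Necessity. Injectivity of `theta` together with `a` in the maximal ideal implies that an integral
`f` with `T f` zero modulo `𝔭_E` is itself zero modulo `𝔭_E`. Modulo `𝔭_E` the map `U` keeps only
the coefficient of `⨂ y_σ ^ d_σ`, which is the value at `(0, 1)`. So a polynomial that is nonzero
modulo `𝔭_E` but whose values at integral points all lie in `𝔭_E` contradicts injectivity, through
the function supported on one vertex. If (i) or (ii) fails, a difference of two monomials congruent
as functions is such a polynomial, with one exception: a single nonzero degree, equal to `q`. There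
`y ^ q - x ^ (q - 1) * y` has value 1 at `(0, 1)`, and three translates are combined so that the
surviving terms cancel through `y ^ q + x ^ q ≡ (x + y) ^ q` (`not_injective_of_critical`). -/

namespace HeckeLattice

open scoped Pointwise TensorProduct

noncomputable section

/-! ### Congruences and Teichmüller lifts in a nonarchimedean field -/

section NormedField

variable {K : Type*} [NormedField K] [IsUltrametricDist K]

theorem mem_maximalIdeal_iff {x : integers K} :
    x ∈ IsLocalRing.maximalIdeal (integers K) ↔ ‖(x : K)‖ < 1 := by
  rw [Valuation.mem_maximalIdeal_iff, NormedField.valuation_apply]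
  rfl

theorem residue_eq_iff {x y : integers K} :
    IsLocalRing.residue (integers K) x = IsLocalRing.residue (integers K) y ↔
      ‖(x : K) - y‖ < 1 := by
  rw [← sub_eq_zero, ← map_sub, IsLocalRing.residue_eq_zero_iff, mem_maximalIdeal_iff]
  rfl

theorem norm_sub_lt_one_trans {x y z : K} (h₁ : ‖x - y‖ < 1) (h₂ : ‖y - z‖ < 1) :
    ‖x - z‖ < 1 := by
  rw [← sub_add_sub_cancel x y z]
  exact (IsUltrametricDist.norm_add_le_max _ _).trans_lt (max_lt h₁ h₂)

theorem norm_pow_sub_pow_le {x y : K} (hx : ‖x‖ ≤ 1) (hy : ‖y‖ ≤ 1) (n : ℕ) :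
    ‖x ^ n - y ^ n‖ ≤ ‖x - y‖ := by
  obtain ⟨z, hz⟩ := sub_dvd_pow_sub_pow (⟨x, mem_integers.mpr hx⟩ : integers K)
    ⟨y, mem_integers.mpr hy⟩ n
  have h : x ^ n - y ^ n = (x - y) * z := congrArg Subtype.val hz
  rw [h, norm_mul]
  exact mul_le_of_le_one_right (norm_nonneg _) (mem_integers.mp z.2)

/-- In the binomial expansion of `(y + (x - y)) ^ p`, all middle terms are divisible by `p * (x -
y)`. Hence `p`-th powering contracts distances below one when `p` is small. -/
theorem norm_pow_prime_sub_pow_le {p : ℕ} (hp : p.Prime) {x y : K} (hx : ‖x‖ ≤ 1)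
    (hy : ‖y‖ ≤ 1) :
    ‖x ^ p - y ^ p‖ ≤ max ‖(p : K)‖ ‖x - y‖ * ‖x - y‖ := by
  have hxy : ‖x - y‖ ≤ 1 := by
    rw [sub_eq_add_neg]
    exact (IsUltrametricDist.norm_add_le_max _ _).trans (max_le hx (by rwa [norm_neg]))
  obtain ⟨z, hz⟩ := exists_add_pow_prime_eq hp
    (⟨y, mem_integers.mpr hy⟩ : integers K) ⟨x - y, mem_integers.mpr hxy⟩
  have h : (y + (x - y)) ^ p = y ^ p + (x - y) ^ p + p * y * (x - y) * z :=
    congrArg Subtype.val hz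
  have h' : x ^ p - y ^ p = (x - y) ^ p + p * y * (x - y) * z := by
    rw [add_sub_cancel] at h
    rw [h]
    ring
  rw [h', max_mul_of_nonneg _ _ (norm_nonneg _), max_comm]
  refine (IsUltrametricDist.norm_add_le_max _ _).trans (max_le_max ?_ ?_)
  · rw [norm_pow, ← sq]
    exact pow_le_pow_of_le_one (norm_nonneg _) hxy hp.two_le
  · rw [norm_mul, norm_mul, norm_mul, mul_right_comm _ ‖y‖, mul_assoc]
    exact mul_le_of_le_one_right (by positivity)
      (mul_le_one₀ hy (norm_nonneg _) (mem_integers.mp z.2))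

theorem norm_pow_sub_pow_le_of_prime_dvd {p n : ℕ} (hp : p.Prime) (hn : p ∣ n) {x y : K}
    (hx : ‖x‖ ≤ 1) (hy : ‖y‖ ≤ 1) :
    ‖x ^ n - y ^ n‖ ≤ max ‖(p : K)‖ ‖x - y‖ * ‖x - y‖ := by
  obtain ⟨m, rfl⟩ := hn
  rw [pow_mul, pow_mul]
  refine (norm_pow_sub_pow_le ?_ ?_ m).trans (norm_pow_prime_sub_pow_le hp hx hy)
  · rw [norm_pow]
    exact pow_le_one₀ (norm_nonneg _) hx
  · rw [norm_pow]
    exact pow_le_one₀ (norm_nonneg _) hy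

/-- Uniqueness of Teichmüller lifts: two fixed points of a strict contraction coincide. -/
theorem eq_of_pow_eq_self {p q : ℕ} (hp : p.Prime) (hpK : ‖(p : K)‖ < 1) (hq : p ∣ q) {x y : K}
    (hx : ‖x‖ ≤ 1) (hy : ‖y‖ ≤ 1) (hxq : x ^ q = x) (hyq : y ^ q = y) (h : ‖x - y‖ < 1) :
    x = y := by
  have h1 := norm_pow_sub_pow_le_of_prime_dvd hp hq hx hy
  rw [hxq, hyq] at h1
  by_contra hne
  have h2 : 0 < ‖x - y‖ := norm_pos_iff.mpr (sub_ne_zero.mpr hne)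
  nlinarith [max_lt hpK h]

/-- Existence of Teichmüller lifts: the limit of the iterates `x ^ q ^ n`. -/
theorem exists_pow_eq_self [CompleteSpace K] {p q : ℕ} (hp : p.Prime) (hpK : ‖(p : K)‖ < 1)
    (hq : p ∣ q) {x : K} (hx : ‖x‖ ≤ 1) (hxq : ‖x ^ q - x‖ < 1) :
    ∃ y : K, ‖y‖ ≤ 1 ∧ y ^ q = y ∧ ‖y - x‖ < 1 := by
  -- `c` bounds both the first step and the contraction ratio, so the steps decay geometrically.
  set c := max ‖(p : K)‖ ‖x ^ q - x‖ with hc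
  have hc1 : c < 1 := max_lt hpK hxq
  have hc0 : 0 ≤ c := (norm_nonneg _).trans (le_max_left _ _)
  let u : ℕ → K := fun n => x ^ q ^ n
  have hu : ∀ n, ‖u n‖ ≤ 1 := fun n => by
    change ‖x ^ q ^ n‖ ≤ 1
    rw [norm_pow]
    exact pow_le_one₀ (norm_nonneg _) hx
  have hus : ∀ n, u (n + 1) = u n ^ q := fun n => by
    change x ^ q ^ (n + 1) = (x ^ q ^ n) ^ q
    rw [← pow_mul, pow_succ]
  have hstep : ∀ n, ‖u (n + 1) - u n‖ ≤ c * c ^ n := by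
    intro n
    induction n with
    | zero =>
      change ‖x ^ q ^ 1 - x ^ q ^ 0‖ ≤ _
      rw [pow_one, pow_zero, pow_one, pow_zero, mul_one]
      exact le_max_right _ _
    | succ n ih =>
      rw [hus (n + 1), hus n]
      rw [hus n] at ih
      have hle : c * c ^ n ≤ c := mul_le_of_le_one_right hc0 (pow_le_one₀ hc0 hc1.le)
      refine (norm_pow_sub_pow_le_of_prime_dvd hp hq (hus n ▸ hu (n + 1)) (hu n)).trans ?_
      calc max ‖(p : K)‖ ‖u n ^ q - u n‖ * ‖u n ^ q - u n‖ ≤ c * (c * c ^ n) :=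
            mul_le_mul (max_le (le_max_left _ _) (ih.trans hle)) ih (norm_nonneg _) hc0
        _ = c * c ^ (n + 1) := by ring
  have hcau : CauchySeq u := cauchySeq_of_le_geometric c c hc1 fun n => by
    rw [dist_comm, dist_eq_norm]
    exact hstep n
  obtain ⟨y, hy⟩ := cauchySeq_tendsto_of_complete hcau
  have hx0 : ∀ n, ‖u n - x‖ ≤ c := by
    intro n
    induction n with
    | zero =>
      change ‖x ^ q ^ 0 - x‖ ≤ c
      simpa using hc0
    | succ n ih =>
      rw [← sub_add_sub_cancel _ (u n)]
      refine (IsUltrametricDist.norm_add_le_max _ _).trans (max_le ((hstep n).trans ?_) ih)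
      exact mul_le_of_le_one_right hc0 (pow_le_one₀ hc0 hc1.le)
  refine ⟨y, le_of_tendsto hy.norm (Filter.Eventually.of_forall hu), ?_,
    (le_of_tendsto (hy.sub_const x).norm (Filter.Eventually.of_forall hx0)).trans_lt hc1⟩
  refine tendsto_nhds_unique (hy.pow q) ?_
  refine ((Filter.tendsto_add_atTop_iff_nat 1).mpr hy).congr hus

/-- The open unit ball is also closed, hence compact, and the norm attains its maximum on it. -/
theorem exists_isUniformizer [ProperSpace K] {x : K} (hx : x ≠ 0) (hx1 : ‖x‖ < 1) :
    ∃ π : K, IsUniformizer π := by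
  have hc : IsCompact (Metric.ball (0 : K) 1) :=
    (isCompact_closedBall (0 : K) 1).of_isClosed_subset
      (IsUltrametricDist.isClosed_ball _ _) Metric.ball_subset_closedBall
  obtain ⟨π, hπ, hmax⟩ := hc.exists_isMaxOn ⟨x, mem_ball_zero_iff.mpr hx1⟩ continuous_norm.continuousOn
  have hle : ∀ y : K, ‖y‖ < 1 → ‖y‖ ≤ ‖π‖ := fun y hy => hmax (mem_ball_zero_iff.mpr hy)
  exact ⟨π, norm_pos_iff.mp ((norm_pos_iff.mpr hx).trans_le (hle x hx1)),
    mem_ball_zero_iff.mp hπ, hle⟩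

instance finite_residueField [ProperSpace K] : Finite (residueField K) := by
  have : CompactSpace (integers K) := by
    have h : ((integers K : ValuationSubring K) : Set K) = Metric.closedBall 0 1 := by
      ext x
      rw [mem_closedBall_zero_iff]
      exact mem_integers
    exact isCompact_iff_compactSpace.mp (h ▸ isCompact_closedBall (0 : K) 1)
  have ho : IsOpen ((IsLocalRing.maximalIdeal (integers K)).toAddSubgroup : Set (integers K)) := by
    have h : ((IsLocalRing.maximalIdeal (integers K)).toAddSubgroup : Set (integers K)) =
        Subtype.val ⁻¹' Metric.ball (0 : K) 1 := by
      ext x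
      rw [Set.mem_preimage, mem_ball_zero_iff]
      exact mem_maximalIdeal_iff
    rw [h]
    exact Metric.isOpen_ball.preimage continuous_subtype_val
  exact AddSubgroup.quotient_finite_of_isOpen _ ho

end NormedField

/-! ### Residue fields and Frobenius -/

section Padic

variable {p : ℕ} [hp : Fact p.Prime]
variable {F : Type*} [NormedField F] [IsUltrametricDist F] [NormedAlgebra ℚ_[p] F]

theorem norm_natCast_prime_lt_one (p : ℕ) [hp : Fact p.Prime] (F : Type*) [NormedField F]
    [NormedAlgebra ℚ_[p] F] : ‖(p : F)‖ < 1 := by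
  rw [← map_natCast (algebraMap ℚ_[p] F), norm_algebraMap', Padic.norm_p]
  exact inv_lt_one_of_one_lt₀ (mod_cast hp.out.one_lt)

theorem charP_residueField (p : ℕ) [hp : Fact p.Prime] (F : Type*) [NormedField F]
    [IsUltrametricDist F] [NormedAlgebra ℚ_[p] F] : CharP (residueField F) p := by
  have h : ((p : ℕ) : residueField F) = 0 := by
    rw [← map_natCast (IsLocalRing.residue (integers F)), IsLocalRing.residue_eq_zero_iff,
      mem_maximalIdeal_iff]
    exact norm_natCast_prime_lt_one p F
  exact (CharP.charP_iff_prime_eq_zero hp.out).mpr h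

theorem card_residueField (p : ℕ) [hp : Fact p.Prime] (F : Type*) [NormedField F]
    [IsUltrametricDist F] [NormedAlgebra ℚ_[p] F] [ProperSpace F] :
    Nat.card (residueField F) = p ^ residueDegree F := by
  have := charP_residueField p F
  rw [residueDegree, Module.natCard_eq_pow_finrank (K := (⊥ : Subfield (residueField F))), Subfield.card_bot _ p]

theorem residueDegree_pos (F : Type*) [NormedField F] [IsUltrametricDist F] [ProperSpace F] :
    0 < residueDegree F := Module.finrank_pos

/-- The Frobenius twists of `ψ` are as many distinct embeddings as the degree of `k` over its prime
field, which is also an upper bound for the number of embeddings; so they exhaust them. -/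
theorem exists_lt_finrank_pow_eq {k L : Type*} [Field k] [Finite k] [Field L] (p : ℕ)
    [hp : Fact p.Prime] [CharP k p] (φ ψ : k →+* L) :
    ∃ l < Module.finrank (⊥ : Subfield k) k, ∀ x, φ x = ψ x ^ p ^ l := by
  let k₀ : Subfield k := ⊥
  let _ : Fintype k₀ := Fintype.ofFinite _
  have hcard : Fintype.card k₀ = p := by
    rw [Fintype.card_eq_nat_card]
    exact Subfield.card_bot k p
  let _ : Algebra k₀ L := (ψ.comp k₀.subtype).toAlgebra
  let ψ' : k →ₐ[k₀] L := { ψ with commutes' := fun _ => rfl }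
  let φ' : k →ₐ[k₀] L :=
    { φ with
      commutes' := by
        rintro ⟨x, hx⟩
        obtain ⟨n, rfl⟩ := (mem_bot_iff_intCast p k).mp hx
        change φ (n : k) = ψ (n : k)
        rw [map_intCast, map_intCast] }
  let e : Fin (Module.finrank k₀ k) → (k →ₐ[k₀] L) := fun n =>
    ψ'.comp (FiniteField.frobeniusAlgHom k₀ k ^ n.1)
  have he : Function.Injective e := by
    intro m n hmn
    refine (FiniteField.bijective_frobeniusAlgHom_pow k₀ k).1 ?_
    ext x
    exact ψ.injective (DFunLike.congr_fun hmn x)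
  have hb : Function.Bijective e :=
    he.bijective_of_nat_card_le ((card_algHom_le_finrank k₀ k L).trans_eq (by simp))
  obtain ⟨n, hn⟩ := hb.2 φ'
  refine ⟨n.1, n.2, fun x => ?_⟩
  have h : φ x = ψ ((FiniteField.frobeniusAlgHom k₀ k ^ n.1) x) := (DFunLike.congr_fun hn x).symm
  rw [h, AlgHom.coe_pow, FiniteField.coe_frobeniusAlgHom, pow_iterate, hcard, map_pow]

end Padic

/-! ### Embeddings and the residue fields -/

section Embeddings

variable {p : ℕ} [hp : Fact p.Prime]
variable {F : Type*} [NormedField F] [IsUltrametricDist F] [NormedAlgebra ℚ_[p] F]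
variable [FiniteDimensional ℚ_[p] F]
variable {E : Type*} [NormedField E] [IsUltrametricDist E] [NormedAlgebra ℚ_[p] E]

/-- A high power of `x` is divisible by `p`, and integrality of the quotient is preserved by `σ`. -/
theorem norm_emb_lt_one (σ : Emb p F E) {x : F} (hx : ‖x‖ < 1) : ‖σ x‖ < 1 := by
  have hp0 : (p : F) ≠ 0 := by
    rw [← map_natCast (algebraMap ℚ_[p] F)]
    exact (map_ne_zero _).mpr (mod_cast hp.out.ne_zero)
  obtain ⟨n, hn⟩ := exists_pow_lt_of_lt_one (norm_pos_iff.mpr hp0) hx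
  have h1 : ‖σ (x ^ n / p)‖ ≤ 1 := norm_emb_le_one σ (by
    rw [norm_div, norm_pow]
    exact div_le_one_of_le₀ hn.le (norm_nonneg _))
  have hpE : 0 < ‖(p : E)‖ := by
    rw [← map_natCast σ]
    exact norm_pos_iff.mpr ((map_ne_zero _).mpr hp0)
  rw [map_div₀, map_natCast, map_pow, norm_div, norm_pow, div_le_one hpE] at h1
  by_contra! h
  exact absurd (one_le_pow₀ h) (not_le.mpr (h1.trans_lt (norm_natCast_prime_lt_one p E)))

theorem norm_emb_sub_lt_one (σ : Emb p F E) {x y : F} (h : ‖x - y‖ < 1) :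
    ‖σ x - σ y‖ < 1 := by
  rw [← map_sub]
  exact norm_emb_lt_one σ h

theorem norm_emb_eq_one (σ : Emb p F E) {x : F} (hx : ‖x‖ = 1) : ‖σ x‖ = 1 := by
  refine le_antisymm (norm_emb_le_one σ hx.le) ?_
  have h := norm_emb_le_one σ (x := x⁻¹) (by rw [norm_inv, hx, inv_one])
  have h0 : σ x ≠ 0 := (map_ne_zero σ).mpr (norm_pos_iff.mp (hx ▸ one_pos))
  rw [map_inv₀, norm_inv] at h
  exact (inv_le_one₀ (norm_pos_iff.mpr h0)).mp h

theorem norm_pow_card_sub_lt_one {x : F} (hx : ‖x‖ ≤ 1) :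
    ‖x ^ p ^ residueDegree F - x‖ < 1 := by
  have := properSpace_of_finiteDimensional p F
  have h : IsLocalRing.residue (integers F) (⟨x, mem_integers.mpr hx⟩ ^ p ^ residueDegree F) =
      IsLocalRing.residue (integers F) ⟨x, mem_integers.mpr hx⟩ := by
    let _ : Fintype (residueField F) := Fintype.ofFinite _
    rw [map_pow, ← card_residueField p F, ← Fintype.card_eq_nat_card, FiniteField.pow_card]
  exact residue_eq_iff.mp h

theorem dvd_pow_residueDegree (p : ℕ) (F : Type*) [Fact p.Prime] [NormedField F]
    [IsUltrametricDist F] [NormedAlgebra ℚ_[p] F] [FiniteDimensional ℚ_[p] F] :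
    p ∣ p ^ residueDegree F := by
  have := properSpace_of_finiteDimensional p F
  exact dvd_pow_self p (residueDegree_pos F).ne'

theorem exists_teichmuller {x : F} (hx : ‖x‖ ≤ 1) :
    ∃ y : F, ‖y‖ ≤ 1 ∧ y ^ p ^ residueDegree F = y ∧ ‖y - x‖ < 1 := by
  have := properSpace_of_finiteDimensional p F
  exact exists_pow_eq_self hp.out (norm_natCast_prime_lt_one p F) (dvd_pow_residueDegree p F) hx
    (norm_pow_card_sub_lt_one hx)

/-- The homomorphism `𝒪_F → k_E` induced by an embedding. -/
def embResidue (σ : Emb p F E) : integers F →+* residueField E :=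
  (IsLocalRing.residue (integers E)).comp
    ((σ.toRingHom.comp (integers F).subtype).codRestrict (integers E) fun x =>
      mem_integers.mpr (norm_emb_le_one σ (mem_integers.mp x.2)))

/-- The homomorphism of residue fields induced by an embedding. -/
def residueEmb (σ : Emb p F E) : residueField F →+* residueField E :=
  Ideal.Quotient.lift _ (embResidue σ) fun _ hx =>
    (IsLocalRing.residue_eq_zero_iff _).mpr <| mem_maximalIdeal_iff.mpr <|
      norm_emb_lt_one σ (mem_maximalIdeal_iff.mp hx)

/-- The residual embeddings differ by a power of Frobenius; uniqueness of Teichmüller lifts turns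
this congruence into an equality. -/
theorem exists_emb_eq_pow (σ ι : Emb p F E) :
    ∃ l < residueDegree F, ∀ x : F, ‖x‖ ≤ 1 → x ^ p ^ residueDegree F = x →
      σ x = ι x ^ p ^ l := by
  have := properSpace_of_finiteDimensional p F
  have := charP_residueField p F
  obtain ⟨l, hl, h⟩ := exists_lt_finrank_pow_eq p (residueEmb σ) (residueEmb ι)
  refine ⟨l, hl, fun x hx hxq => ?_⟩
  have hι := norm_emb_le_one ι hx
  refine eq_of_pow_eq_self hp.out (norm_natCast_prime_lt_one p E) (dvd_pow_residueDegree p F)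
    (norm_emb_le_one σ hx) ?_ ?_ ?_ ?_
  · rw [norm_pow]
    exact pow_le_one₀ (norm_nonneg _) hι
  · rw [← map_pow, hxq]
  · rw [pow_right_comm, ← map_pow, hxq]
  · have h1 := h (IsLocalRing.residue _ ⟨x, mem_integers.mpr hx⟩)
    have h2 : IsLocalRing.residue (integers E) ⟨σ x, mem_integers.mpr (norm_emb_le_one σ hx)⟩ =
        IsLocalRing.residue (integers E) (⟨ι x, mem_integers.mpr hι⟩ ^ p ^ l) := by
      rw [map_pow]
      exact h1
    exact residue_eq_iff.mp h2

end Embeddings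

/-! ### Mixed-radix expansions -/

section MixedRadix

/-- Induction removing the largest weight: the remaining digits sum to less than it, so Euclidean
division by it recovers its digit. The free bound `W` is specialised to that weight in the
induction. -/
theorem mixedRadix {S : Type*} (w d : S → ℕ) (s : Finset S) (W : ℕ)
    (hw : ∀ σ ∈ s, 0 < w σ) (hinj : Set.InjOn w s)
    (hlt : ∀ σ ∈ s, ∀ τ ∈ s, w σ < w τ → (d σ + 1) * w σ ≤ w τ)
    (hle : ∀ σ ∈ s, (d σ + 1) * w σ ≤ W) (hW : 0 < W) :
    (∀ i : S → ℕ, (∀ σ ∈ s, i σ ≤ d σ) → ∑ σ ∈ s, i σ * w σ < W) ∧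
      ∀ i j : S → ℕ, (∀ σ ∈ s, i σ ≤ d σ) → (∀ σ ∈ s, j σ ≤ d σ) →
        ∑ σ ∈ s, i σ * w σ = ∑ σ ∈ s, j σ * w σ → ∀ σ ∈ s, i σ = j σ := by
  classical
  induction s using Finset.induction_on_max_value w generalizing W with
  | empty => simp [hW]
  | insert a s ha hmax ih =>
    have hlt' : ∀ σ ∈ s, w σ < w a := fun σ hσ => (hmax σ hσ).lt_of_ne fun h =>
      ha (hinj (Finset.mem_insert_of_mem hσ) (Finset.mem_insert_self a s) h ▸ hσ)
    have hwa := hw a (Finset.mem_insert_self a s)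
    obtain ⟨h1, h2⟩ := ih (w a) (fun σ hσ => hw σ (Finset.mem_insert_of_mem hσ))
      (hinj.mono (by simp))
      (fun σ hσ τ hτ => hlt σ (Finset.mem_insert_of_mem hσ) τ (Finset.mem_insert_of_mem hτ))
      (fun σ hσ => hlt σ (Finset.mem_insert_of_mem hσ) a (Finset.mem_insert_self a s) (hlt' σ hσ))
      hwa
    have hrest : ∀ {i : S → ℕ}, (∀ σ ∈ insert a s, i σ ≤ d σ) → ∀ σ ∈ s, i σ ≤ d σ :=
      fun h σ hσ => h σ (Finset.mem_insert_of_mem hσ)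
    refine ⟨fun i hi => ?_, fun i j hi hj hij => ?_⟩
    · rw [Finset.sum_insert ha]
      have h3 := h1 i (hrest hi)
      have h4 := Nat.mul_le_mul_right (w a) (hi a (Finset.mem_insert_self a s))
      have h5 := hle a (Finset.mem_insert_self a s)
      rw [add_mul, one_mul] at h5
      omega
    · rw [Finset.sum_insert ha, Finset.sum_insert ha] at hij
      have hi' := h1 i (hrest hi)
      have hj' := h1 j (hrest hj)
      rw [mul_comm (i a), mul_comm (j a)] at hij
      have hdiv := congrArg (· / w a) hij
      have hmod := congrArg (· % w a) hij
      simp only [Nat.mul_add_div hwa, Nat.div_eq_of_lt hi', Nat.div_eq_of_lt hj',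
        Nat.mul_add_mod, Nat.mod_eq_of_lt hi', Nat.mod_eq_of_lt hj', add_zero] at hdiv hmod
      intro σ hσ
      rcases Finset.mem_insert.mp hσ with rfl | hσ
      · exact hdiv
      · exact h2 i j (hrest hi) (hrest hj) hmod σ hσ

end MixedRadix

/-! ### The sets `J_l` and the numerical conditions -/

section Conditions

variable {p : ℕ} [hp : Fact p.Prime]
variable {F : Type*} [NormedField F] [IsUltrametricDist F] [NormedAlgebra ℚ_[p] F]
variable [FiniteDimensional ℚ_[p] F]
variable {E : Type*} [NormedField E] [IsUltrametricDist E] [NormedAlgebra ℚ_[p] E]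
variable {ι : Emb p F E} {d : Emb p F E → ℕ}

/-- Each integral solution of `x ^ q = x` is the Teichmüller representative of its own residue, so
the residue can be eliminated. -/
theorem mem_J_iff {l : ℕ} {σ : Emb p F E} :
    σ ∈ J ι d l ↔ d σ ≠ 0 ∧ ∀ x : F, ‖x‖ ≤ 1 → x ^ p ^ residueDegree F = x →
      σ x = ι x ^ p ^ l := by
  have := properSpace_of_finiteDimensional p F
  refine and_congr_right fun _ => ⟨fun h x hx hxq => ?_, fun h ζ x hx => ?_⟩
  · refine h _ ⟨x, mem_integers.mpr hx⟩ ⟨rfl, ?_⟩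
    rw [card_residueField p F]
    exact Subtype.ext hxq
  · refine h x (mem_integers.mp x.2) ?_
    have h2 := hx.2
    rw [card_residueField p F] at h2
    exact congrArg Subtype.val h2

variable (ι) in
theorem exists_mem_J {σ : Emb p F E} (hσ : d σ ≠ 0) : ∃ l < residueDegree F, σ ∈ J ι d l := by
  obtain ⟨l, hl, h⟩ := exists_emb_eq_pow σ ι
  exact ⟨l, hl, mem_J_iff.mpr ⟨hσ, h⟩⟩

/-- As `ι` is injective and Teichmüller elements represent every residue, the `l`-th and `m`-th
powers of Frobenius agree on the residue field. -/
theorem eq_of_mem_J {l m : ℕ} (hl : l < residueDegree F) (hm : m < residueDegree F)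
    {σ : Emb p F E} (h₁ : σ ∈ J ι d l) (h₂ : σ ∈ J ι d m) : l = m := by
  have := properSpace_of_finiteDimensional p F
  have := charP_residueField p F
  let k₀ : Subfield (residueField F) := ⊥
  let _ : Fintype k₀ := Fintype.ofFinite _
  have hcard : Fintype.card k₀ = p := by
    rw [Fintype.card_eq_nat_card]
    exact Subfield.card_bot _ p
  have key : (⟨l, hl⟩ : Fin (Module.finrank k₀ (residueField F))) = ⟨m, hm⟩ := by
    refine (FiniteField.bijective_frobeniusAlgHom_pow k₀ (residueField F)).1 ?_
    ext ζ
    obtain ⟨x, rfl⟩ := IsLocalRing.residue_surjective ζ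
    obtain ⟨y, hy, hyq, hyx⟩ := exists_teichmuller (p := p) (mem_integers.mp x.2)
    have e : IsLocalRing.residue (integers F) x =
        IsLocalRing.residue (integers F) ⟨y, mem_integers.mpr hy⟩ :=
      (residue_eq_iff.mpr hyx).symm
    have hpow : y ^ p ^ l = y ^ p ^ m := by
      refine (ι : F →+* E).injective ?_
      change ι (y ^ p ^ l) = ι (y ^ p ^ m)
      rw [map_pow, map_pow, ← (mem_J_iff.mp h₁).2 y hy hyq, (mem_J_iff.mp h₂).2 y hy hyq]
    change (FiniteField.frobeniusAlgHom k₀ (residueField F) ^ l) _ =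
      (FiniteField.frobeniusAlgHom k₀ (residueField F) ^ m) _
    rw [AlgHom.coe_pow, AlgHom.coe_pow, FiniteField.coe_frobeniusAlgHom, pow_iterate, pow_iterate,
      hcard, e]
    change _ ^ p ^ l = _ ^ p ^ m
    rw [← map_pow, ← map_pow]
    exact congrArg _ (Subtype.ext hpow)
  exact congrArg Fin.val key

theorem pow_pow_mod {x : F} (hx : x ^ p ^ residueDegree F = x) (n : ℕ) :
    x ^ p ^ (n % residueDegree F) = x ^ p ^ n := by
  have h : ∀ k, x ^ p ^ (residueDegree F * k) = x := by
    intro k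
    induction k with
    | zero => simp
    | succ k ih => rw [mul_add, mul_one, pow_add, pow_mul, ih, hx]
  conv_rhs => rw [← Nat.div_add_mod n (residueDegree F), pow_add, pow_mul, h]

/-- The relation is an equality on Teichmüller representatives, and every integer of `F` is
congruent to one of them. -/
theorem norm_emb_pow_sub_lt_one {l n : ℕ} {σ τ : Emb p F E} (hσ : σ ∈ J ι d l)
    (hτ : τ ∈ J ι d ((l + n) % residueDegree F)) {x : F} (hx : ‖x‖ ≤ 1) :
    ‖σ x ^ p ^ n - τ x‖ < 1 := by
  obtain ⟨y, hy, hyq, hyx⟩ := exists_teichmuller (p := p) hx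
  have e : σ y ^ p ^ n = τ y := by
    rw [(mem_J_iff.mp hσ).2 y hy hyq, (mem_J_iff.mp hτ).2 y hy hyq, ← pow_mul, ← pow_add,
      ← map_pow, ← map_pow, pow_pow_mod hyq]
  have h1 : ‖σ x ^ p ^ n - σ y ^ p ^ n‖ < 1 :=
    (norm_pow_sub_pow_le (norm_emb_le_one σ hx) (norm_emb_le_one σ hy) _).trans_lt
      (norm_emb_sub_lt_one σ (by rwa [norm_sub_rev]))
  rw [e] at h1
  exact norm_sub_lt_one_trans h1 (norm_emb_sub_lt_one τ hyx)

theorem norm_emb_pow_card_sub_lt_one (σ : Emb p F E) {x : F} (hx : ‖x‖ ≤ 1) :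
    ‖σ x ^ p ^ residueDegree F - σ x‖ < 1 := by
  rw [← map_pow]
  exact norm_emb_sub_lt_one σ (norm_pow_card_sub_lt_one hx)

theorem v_le {l i : ℕ} (h₁ : 1 ≤ i) (h₂ : i ≤ residueDegree F)
    (h₃ : (J ι d ((l + i) % residueDegree F)).Nonempty) : v ι d l ≤ i :=
  Nat.sInf_le ⟨h₁, h₂, h₃⟩

theorem v_spec {l : ℕ} (hl : l < residueDegree F) (h : (J ι d l).Nonempty) :
    1 ≤ v ι d l ∧ v ι d l ≤ residueDegree F ∧
      (J ι d ((l + v ι d l) % residueDegree F)).Nonempty := by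
  refine Nat.sInf_mem (s := {i | 1 ≤ i ∧ i ≤ residueDegree F ∧
    (J ι d ((l + i) % residueDegree F)).Nonempty}) ⟨residueDegree F, ?_, le_rfl, ?_⟩
  · lia
  · rwa [Nat.add_mod_right, Nat.mod_eq_of_lt hl]

/-- Under the two conditions, the monomials `∏ σ(x) ^ i_σ` on Teichmüller representatives are
pairwise distinct powers of exponent less than `q` of a Frobenius twist of `ι(x)`. -/
theorem exists_weights [Fintype (Emb p F E)]
    (h₁ : ∀ l < residueDegree F, (J ι d l).encard ≤ 1)
    (h₂ : ∀ l < residueDegree F, ∀ σ ∈ J ι d l, d σ + 1 ≤ p ^ v ι d l) :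
    ∃ (l₀ : ℕ) (w : Emb p F E → ℕ), l₀ ≤ residueDegree F ∧
      (∀ x : F, ‖x‖ ≤ 1 → x ^ p ^ residueDegree F = x → ∀ σ, d σ ≠ 0 →
        σ x = (ι x ^ p ^ l₀) ^ w σ) ∧
      (∀ i : (σ : Emb p F E) → Fin (d σ + 1), ∑ σ, (i σ : ℕ) * w σ < p ^ residueDegree F) ∧
      Function.Injective fun i : (σ : Emb p F E) → Fin (d σ + 1) => ∑ σ, (i σ : ℕ) * w σ := by
  classical
  choose! l hlt hl using fun σ (h : d σ ≠ 0) => exists_mem_J ι (σ := σ) h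
  let s : Finset (Emb p F E) := Finset.univ.filter fun σ => d σ ≠ 0
  have hs : ∀ {σ}, σ ∈ s ↔ d σ ≠ 0 := by simp [s]
  have hp1 : 1 < p := hp.out.one_lt
  have hlinj : ∀ σ ∈ s, ∀ τ ∈ s, l σ = l τ → σ = τ := by
    intro σ hσ τ hτ h
    rw [hs] at hσ hτ
    exact Set.encard_le_one_iff.mp (h₁ _ (hlt σ hσ)) σ τ (hl σ hσ) (h ▸ hl τ hτ)
  -- `l₀` is the smallest occurring index, so the weights will be `p ^ (l σ - l₀)`.
  obtain ⟨l₀, hl₀, hmin, hbound⟩ : ∃ l₀ ≤ residueDegree F, (∀ σ ∈ s, l₀ ≤ l σ) ∧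
      ∀ σ ∈ s, (d σ + 1) * p ^ (l σ - l₀) ≤ p ^ residueDegree F := by
    rcases s.eq_empty_or_nonempty with h | h
    · exact ⟨0, Nat.zero_le _, by simp [h], by simp [h]⟩
    · obtain ⟨τ, hτ, hmin⟩ := s.exists_min_image l h
      have hτl := hlt τ (hs.mp hτ)
      refine ⟨l τ, hτl.le, hmin, fun σ hσ => ?_⟩
      have hσl := hlt σ (hs.mp hσ)
      have hm := hmin σ hσ
      -- Going once around the cycle from `l σ` reaches the minimal index `l τ`; this wrap-around is
      -- what keeps the top digit below `q`.
      have hv : v ι d (l σ) ≤ residueDegree F - l σ + l τ := by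
        refine v_le (by lia) (by lia) ?_
        rw [show l σ + (residueDegree F - l σ + l τ) = l τ + residueDegree F by lia,
          Nat.add_mod_right, Nat.mod_eq_of_lt hτl]
        exact ⟨τ, hl τ (hs.mp hτ)⟩
      calc (d σ + 1) * p ^ (l σ - l τ)
          ≤ p ^ (residueDegree F - l σ + l τ) * p ^ (l σ - l τ) :=
            Nat.mul_le_mul_right _ ((h₂ _ hσl σ (hl σ (hs.mp hσ))).trans
              (Nat.pow_le_pow_right hp1.le hv))
        _ = p ^ residueDegree F := by
            rw [← pow_add]
            congr 1
            lia
  obtain ⟨h3, h4⟩ := mixedRadix (fun σ => p ^ (l σ - l₀)) d s (p ^ residueDegree F)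
    (fun σ _ => pow_pos hp.out.pos _)
    (fun σ hσ τ hτ h => hlinj σ hσ τ hτ (by
      have := Nat.pow_right_injective hp.out.two_le h
      have := hmin σ hσ
      have := hmin τ hτ
      lia))
    (fun σ hσ τ hτ h => by
      have hlt' : l σ - l₀ < l τ - l₀ := (Nat.pow_lt_pow_iff_right hp1).mp h
      have hm := hmin σ hσ
      have hτl := hlt τ (hs.mp hτ)
      have hv : v ι d (l σ) ≤ l τ - l σ := by
        refine v_le (by lia) (by lia) ?_
        rw [show l σ + (l τ - l σ) = l τ by lia, Nat.mod_eq_of_lt hτl]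
        exact ⟨τ, hl τ (hs.mp hτ)⟩
      calc (d σ + 1) * p ^ (l σ - l₀) ≤ p ^ (l τ - l σ) * p ^ (l σ - l₀) :=
            Nat.mul_le_mul_right _ ((h₂ _ (by lia) σ (hl σ (hs.mp hσ))).trans
              (Nat.pow_le_pow_right hp1.le hv))
        _ = p ^ (l τ - l₀) := by
            rw [← pow_add]
            congr 1
            lia)
    hbound (pow_pos hp.out.pos _)
  have hsum : ∀ i : (σ : Emb p F E) → Fin (d σ + 1),
      ∑ σ, (i σ : ℕ) * p ^ (l σ - l₀) = ∑ σ ∈ s, (i σ : ℕ) * p ^ (l σ - l₀) := by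
    intro i
    refine (Finset.sum_subset (Finset.subset_univ s) fun σ _ hσ => ?_).symm
    have h0 : d σ = 0 := by
      by_contra h
      exact hσ (hs.mpr h)
    have := (i σ).2
    rw [show (i σ : ℕ) = 0 by lia, zero_mul]
  refine ⟨l₀, fun σ => p ^ (l σ - l₀), hl₀, fun x hx hxq σ hσ => ?_, fun i => ?_, fun i j hij => ?_⟩
  · rw [(mem_J_iff.mp (hl σ hσ)).2 x hx hxq, ← pow_mul, ← pow_add]
    congr 2
    have := hmin σ (hs.mpr hσ)
    lia
  · rw [hsum]
    exact h3 (fun σ => i σ) fun σ _ => Nat.lt_succ_iff.mp (i σ).2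
  · funext σ
    by_cases h0 : d σ = 0
    · have h1 := (i σ).2
      have h2 := (j σ).2
      apply Fin.ext
      lia
    · dsimp only at hij
      rw [hsum, hsum] at hij
      exact Fin.ext (h4 (fun σ => i σ) (fun σ => j σ) (fun σ _ => Nat.lt_succ_iff.mp (i σ).2)
        (fun σ _ => Nat.lt_succ_iff.mp (j σ).2) hij σ (hs.mpr h0))

end Conditions

/-! ### Monomial bases of symmetric powers -/

section SymBasis

variable {E : Type*} [Field E]

/-- The exponent of the monomial `x ^ (d - j) * y ^ j`. -/
def expo (d j : ℕ) : Fin 2 →₀ ℕ := Finsupp.single 0 (d - j) + Finsupp.single 1 j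

theorem expo_zero (d j : ℕ) : expo d j 0 = d - j := by simp [expo]

theorem expo_one (d j : ℕ) : expo d j 1 = j := by simp [expo]

theorem degree_expo {d j : ℕ} (h : j ≤ d) : (expo d j).degree = d := by
  rw [expo, map_add, Finsupp.degree_single, Finsupp.degree_single]
  lia

theorem eq_expo {d : ℕ} {m : Fin 2 →₀ ℕ} (h : m.degree = d) : m 1 ≤ d ∧ m = expo d (m 1) := by
  rw [Finsupp.degree_eq_sum, Fin.sum_univ_two] at h
  refine ⟨by lia, ?_⟩
  ext k
  fin_cases k
  · change m 0 = expo d (m 1) 0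
    rw [expo_zero]
    lia
  · exact (expo_one d (m 1)).symm

/-- The monomial `x ^ (d - j) * y ^ j` as an element of `Sym^d E²`. -/
def symMonomial (d : ℕ) (j : Fin (d + 1)) : Sym E d :=
  ⟨MvPolynomial.monomial (expo d j) 1,
    MvPolynomial.isHomogeneous_monomial 1 (degree_expo (Nat.lt_succ_iff.mp j.2))⟩

/-- The coefficients of a homogeneous polynomial. -/
def symCoeff (d : ℕ) : Sym E d →ₗ[E] (Fin (d + 1) → E) :=
  LinearMap.pi fun j => (MvPolynomial.lcoeff E (expo d j)) ∘ₗ (Sym E d).subtype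

theorem symCoeff_apply (d : ℕ) (P : Sym E d) (j : Fin (d + 1)) :
    symCoeff d P j = P.1.coeff (expo d j) := rfl

theorem symCoeff_injective (d : ℕ) : Function.Injective (symCoeff (E := E) d) := by
  rw [injective_iff_map_eq_zero]
  intro P hP
  ext m
  by_contra h
  have hdeg : m.degree = d := by
    rw [Finsupp.degree_eq_weight_one]
    exact P.2 h
  obtain ⟨h1, h2⟩ := eq_expo hdeg
  apply h
  rw [h2]
  exact congrFun hP ⟨m 1, Nat.lt_succ_iff.mpr h1⟩

theorem symCoeff_symMonomial (d : ℕ) (j : Fin (d + 1)) :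
    symCoeff (E := E) d (symMonomial d j) = Pi.single j 1 := by
  classical
  funext k
  rw [symCoeff_apply, symMonomial, MvPolynomial.coeff_monomial, Pi.single_apply]
  congr 1
  rw [eq_iff_iff]
  constructor
  · intro h
    apply Fin.ext
    rw [← expo_one d k, ← expo_one d j, h]
  · rintro rfl
    rfl

theorem symCoeff_surjective (d : ℕ) : Function.Surjective (symCoeff (E := E) d) := by
  intro c
  refine ⟨∑ j, c j • symMonomial d j, ?_⟩
  rw [map_sum]
  simp_rw [map_smul, symCoeff_symMonomial]
  exact (pi_eq_sum_univ' c).symm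

/-- The basis of monomials of `Sym^d E²`. -/
def symBasis (d : ℕ) : Module.Basis (Fin (d + 1)) E (Sym E d) :=
  .ofEquivFun (LinearEquiv.ofBijective (symCoeff d) ⟨symCoeff_injective d, symCoeff_surjective d⟩)

theorem symBasis_apply (d : ℕ) (j : Fin (d + 1)) : symBasis (E := E) d j = symMonomial d j := by
  rw [symBasis, Module.Basis.coe_ofEquivFun]
  apply symCoeff_injective
  rw [symCoeff_symMonomial]
  exact (LinearEquiv.ofBijective (symCoeff d) _).apply_symm_apply _

theorem eval_symBasis (d : ℕ) (j : Fin (d + 1)) (u : Fin 2 → E) :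
    MvPolynomial.eval u (symBasis d j).1 = u 0 ^ (d - j : ℕ) * u 1 ^ (j : ℕ) := by
  rw [symBasis_apply, symMonomial, MvPolynomial.eval_monomial, one_mul,
    Finsupp.prod_fintype _ _ (fun _ => pow_zero _), Fin.prod_univ_two, expo_zero, expo_one]

theorem eval_substitution (M : Matrix (Fin 2) (Fin 2) E) (u : Fin 2 → E)
    (P : MvPolynomial (Fin 2) E) :
    MvPolynomial.eval u (substitution M P) = MvPolynomial.eval (Matrix.vecMul u M) P := by
  induction P using MvPolynomial.induction_on with
  | C a => simp [substitution]
  | add P Q hP hQ => rw [map_add, map_add, map_add, hP, hQ]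
  | mul_X P i hP =>
    rw [map_mul, map_mul, map_mul, hP]
    congr 1
    simp [substitution, Matrix.vecMul, dotProduct, mul_comm]

theorem symMap_diagonal (d : ℕ) (a b : E) (j : Fin (d + 1)) :
    symMap d !![a, 0; 0, b] (symBasis d j) = (a ^ (d - j : ℕ) * b ^ (j : ℕ)) • symBasis d j := by
  rw [symBasis_apply]
  apply Subtype.ext
  change substitution _ (MvPolynomial.monomial (expo d j) 1) =
    (a ^ (d - j : ℕ) * b ^ (j : ℕ)) • MvPolynomial.monomial (expo d j) 1
  rw [substitution, MvPolynomial.aeval_monomial, map_one, one_mul,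
    Finsupp.prod_fintype _ _ (fun _ => pow_zero _), Fin.prod_univ_two, expo_zero, expo_one,
    MvPolynomial.monomial_eq, Finsupp.prod_fintype _ _ (fun _ => pow_zero _), Fin.prod_univ_two,
    expo_zero, expo_one, MvPolynomial.smul_eq_C_mul]
  simp only [Fin.sum_univ_two, Matrix.of_apply, Matrix.cons_val', Matrix.cons_val_zero,
    Matrix.cons_val_one, Matrix.cons_val_fin_one, map_zero, zero_mul, add_zero, zero_add, mul_pow,
    map_mul, map_pow, map_one, one_mul]
  ring

end SymBasis

/-! ### The lattice, its reduction and evaluation forms on the tensor product -/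

section Tensor

variable {p : ℕ} [hp : Fact p.Prime]
variable {F : Type*} [NormedField F] [IsUltrametricDist F] [NormedAlgebra ℚ_[p] F]
variable [FiniteDimensional ℚ_[p] F]
variable {E : Type*} [NormedField E] [IsUltrametricDist E] [NormedAlgebra ℚ_[p] E]

instance decidableEqEmb : DecidableEq (Emb p F E) := Classical.decEq _

/-- The basis of `ρ_d` consisting of the tensors of monomials. -/
def basisV (d : Emb p F E → ℕ) : Module.Basis ((σ : Emb p F E) → Fin (d σ + 1)) E (V d) :=
  Basis.piTensorProduct fun σ => symBasis (d σ)

theorem basisV_apply (d : Emb p F E → ℕ) (i : (σ : Emb p F E) → Fin (d σ + 1)) :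
    basisV d i = pureTensor fun σ => symBasis (d σ) (i σ) :=
  Basis.piTensorProduct_apply _ _

theorem basisV_repr_pureTensor (d : Emb p F E → ℕ) (P : (σ : Emb p F E) → Sym E (d σ))
    (i : (σ : Emb p F E) → Fin (d σ + 1)) :
    (basisV d).repr (pureTensor P) i = ∏ σ, (P σ).1.coeff (expo (d σ) (i σ)) :=
  Basis.piTensorProduct_repr_tprod_apply _ _ _

variable {d : Emb p F E → ℕ}

theorem linearMap_ext_pureTensor {W : Type*} [AddCommGroup W] [Module E W] {φ ψ : V d →ₗ[E] W}
    (h : ∀ P, φ (pureTensor P) = ψ (pureTensor P)) : φ = ψ :=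
  PiTensorProduct.ext (MultilinearMap.ext h)

theorem norm_prod_le_one {S : Type*} (s : Finset S) {f : S → E} (h : ∀ σ ∈ s, ‖f σ‖ ≤ 1) :
    ‖∏ σ ∈ s, f σ‖ ≤ 1 := by
  rw [norm_prod]
  exact Finset.prod_le_one (fun _ _ => norm_nonneg _) h

theorem norm_sum_le_one {S : Type*} (s : Finset S) {f : S → E} (h : ∀ σ ∈ s, ‖f σ‖ ≤ 1) :
    ‖∑ σ ∈ s, f σ‖ ≤ 1 :=
  mem_integers.mp (sum_mem fun σ hσ => mem_integers.mpr (h σ hσ))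

theorem norm_sum_lt_one {S : Type*} (s : Finset S) {f : S → E} (h : ∀ σ ∈ s, ‖f σ‖ < 1) :
    ‖∑ σ ∈ s, f σ‖ < 1 := by
  classical
  induction s using Finset.induction_on with
  | empty => simp
  | insert a s ha ih =>
    rw [Finset.sum_insert ha]
    exact (IsUltrametricDist.norm_add_le_max _ _).trans_lt (max_lt (h a (by simp))
      (ih fun σ hσ => h σ (Finset.mem_insert_of_mem hσ)))

theorem mul_norm_lt_one {x y : E} (hx : ‖x‖ ≤ 1) (hy : ‖y‖ < 1) : ‖x * y‖ < 1 := by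
  rw [norm_mul]
  exact (mul_le_of_le_one_left (norm_nonneg _) hx).trans_lt hy

theorem basisV_mem_lattice (i : (σ : Emb p F E) → Fin (d σ + 1)) : basisV d i ∈ lattice d := by
  classical
  refine Submodule.subset_span ⟨_, fun σ m => ?_, basisV_apply d i⟩
  rw [symBasis_apply, symMonomial, MvPolynomial.coeff_monomial]
  split_ifs
  · exact one_mem _
  · exact zero_mem _

/-- The lattice is free on the tensors of monomials, so integrality can be tested on coordinates. -/
theorem mem_lattice_iff {t : V d} : t ∈ lattice d ↔ ∀ i, ‖(basisV d).repr t i‖ ≤ 1 := by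
  constructor
  · intro ht i
    induction ht using Submodule.span_induction with
    | mem t ht =>
      obtain ⟨P, hP, rfl⟩ := ht
      rw [basisV_repr_pureTensor]
      exact norm_prod_le_one _ fun σ _ => mem_integers.mp (hP σ _)
    | zero => simp
    | add x y _ _ hx hy =>
      rw [map_add]
      exact (IsUltrametricDist.norm_add_le_max _ _).trans (max_le hx hy)
    | smul a x _ hx =>
      change ‖(basisV d).repr ((a : E) • x) i‖ ≤ 1
      rw [map_smul, Finsupp.smul_apply, smul_eq_mul, norm_mul]
      exact mul_le_one₀ (mem_integers.mp a.2) (norm_nonneg _) hx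
  · intro h
    rw [← (basisV d).sum_repr t]
    exact sum_mem fun i _ => (lattice d).smul_mem ⟨_, mem_integers.mpr (h i)⟩ (basisV_mem_lattice i)

variable (d) in
/-- The submodule `𝔭_E ρ⁰_d` of `ρ⁰_d`. -/
def smallLattice : Submodule (integers E) (V d) where
  carrier := {t | ∀ i, ‖(basisV d).repr t i‖ < 1}
  zero_mem' i := by simp
  add_mem' := by
    intro x y hx hy i
    rw [map_add]
    exact (IsUltrametricDist.norm_add_le_max _ _).trans_lt (max_lt (hx i) (hy i))
  smul_mem' := by
    intro a x hx i
    change ‖(basisV d).repr ((a : E) • x) i‖ < 1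
    rw [map_smul]
    exact mul_norm_lt_one (mem_integers.mp a.2) (hx i)

theorem smul_mem_smallLattice {a : E} (ha : ‖a‖ < 1) {t : V d} (ht : t ∈ lattice d) :
    a • t ∈ smallLattice d := by
  intro i
  rw [map_smul, Finsupp.smul_apply, smul_eq_mul, mul_comm]
  exact mul_norm_lt_one (mem_lattice_iff.mp ht i) ha

theorem mem_smallLattice_iff_of_isUniformizer {π : E} (hπ : IsUniformizer π) {t : V d} :
    t ∈ smallLattice d ↔ π⁻¹ • t ∈ lattice d := by
  have h0 : 0 < ‖π‖ := norm_pos_iff.mpr hπ.ne_zero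
  rw [mem_lattice_iff]
  refine forall_congr' fun i => ?_
  rw [map_smul, Finsupp.smul_apply, smul_eq_mul, norm_mul, norm_inv, inv_mul_le_one₀ h0]
  exact ⟨hπ.norm_le _, fun h => h.trans_lt hπ.norm_lt_one⟩

theorem map_mem_smallLattice {φ : V d →ₗ[E] V d} (hφ : ∀ t ∈ lattice d, φ t ∈ lattice d) {t : V d}
    (ht : t ∈ smallLattice d) : φ t ∈ smallLattice d := by
  intro i
  rw [← (basisV d).sum_repr t, map_sum, map_sum, Finsupp.finsetSum_apply]
  refine norm_sum_lt_one _ fun j _ => ?_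
  rw [map_smul, map_smul, Finsupp.smul_apply, smul_eq_mul, mul_comm]
  exact mul_norm_lt_one (mem_lattice_iff.mp (hφ _ (basisV_mem_lattice j)) i) (ht j)

variable (d) in
/-- The linear form `⨂ P_σ ↦ ∏ P_σ(σ(u 0), σ(u 1))` on `ρ_d`. -/
def ev (u : Fin 2 → F) : V d →ₗ[E] E :=
  PiTensorProduct.lift <| (MultilinearMap.mkPiAlgebra E (Emb p F E) E).compLinearMap fun σ =>
    (MvPolynomial.aeval (R := E) fun k => σ (u k)).toLinearMap ∘ₗ (Sym E (d σ)).subtype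

theorem ev_pureTensor (u : Fin 2 → F) (P : (σ : Emb p F E) → Sym E (d σ)) :
    ev d u (pureTensor P) = ∏ σ : Emb p F E, MvPolynomial.eval (fun k => σ (u k)) (P σ).1 :=
  PiTensorProduct.lift.tprod _

theorem ev_basisV (u : Fin 2 → F) (i : (σ : Emb p F E) → Fin (d σ + 1)) :
    ev d u (basisV d i) =
      ∏ σ : Emb p F E, σ (u 0) ^ (d σ - i σ : ℕ) * σ (u 1) ^ (i σ : ℕ) := by
  rw [basisV_apply, ev_pureTensor]
  exact Finset.prod_congr rfl fun σ _ => eval_symBasis _ _ _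

theorem ev_eq_sum (u : Fin 2 → F) (t : V d) :
    ev d u t = ∑ i, (basisV d).repr t i * ev d u (basisV d i) := by
  conv_lhs => rw [← (basisV d).sum_repr t, map_sum]
  simp_rw [map_smul, smul_eq_mul]

/-- Substitution of variables is dual to the action of matrices on row vectors. -/
theorem ev_tensorMap (u : Fin 2 → F) (M : Matrix (Fin 2) (Fin 2) F) (t : V d) :
    ev d u (tensorMap d M t) = ev d (Matrix.vecMul u M) t := by
  change (ev d u ∘ₗ tensorMap d M) t = _
  congr 1
  apply linearMap_ext_pureTensor
  intro P
  have h : tensorMap d M (pureTensor P) = pureTensor fun σ => symMap (d σ) (M.map σ) (P σ) :=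
    PiTensorProduct.map_tprod _ _
  rw [LinearMap.comp_apply, h, ev_pureTensor, ev_pureTensor]
  refine Finset.prod_congr rfl fun σ _ => ?_
  refine (eval_substitution _ _ _).trans ?_
  congr 2
  funext k
  simp [Matrix.vecMul, dotProduct]

theorem norm_ev_basisV_le_one {u : Fin 2 → F} (hu : ∀ k, ‖u k‖ ≤ 1)
    (i : (σ : Emb p F E) → Fin (d σ + 1)) : ‖ev d u (basisV d i)‖ ≤ 1 := by
  rw [ev_basisV]
  refine norm_prod_le_one _ fun σ _ => ?_
  rw [norm_mul, norm_pow, norm_pow]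
  exact mul_le_one₀ (pow_le_one₀ (norm_nonneg _) (norm_emb_le_one σ (hu 0)))
    (by positivity) (pow_le_one₀ (norm_nonneg _) (norm_emb_le_one σ (hu 1)))

theorem norm_ev_le_one {u : Fin 2 → F} (hu : ∀ k, ‖u k‖ ≤ 1) {t : V d} (ht : t ∈ lattice d) :
    ‖ev d u t‖ ≤ 1 := by
  rw [ev_eq_sum]
  refine norm_sum_le_one _ fun i _ => ?_
  rw [norm_mul]
  exact mul_le_one₀ (mem_lattice_iff.mp ht i) (norm_nonneg _) (norm_ev_basisV_le_one hu i)

theorem tensorMap_diagonal_basisV (a b : F) (i : (σ : Emb p F E) → Fin (d σ + 1)) :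
    tensorMap d !![a, 0; 0, b] (basisV d i) =
      (∏ σ : Emb p F E, σ a ^ (d σ - i σ : ℕ) * σ b ^ (i σ : ℕ)) • basisV d i := by
  have h : tensorMap d !![a, 0; 0, b] (basisV d i) =
      pureTensor fun σ => symMap (d σ) (!![a, 0; 0, b].map σ) (symBasis (d σ) (i σ)) := by
    rw [basisV_apply]
    exact PiTensorProduct.map_tprod _ _
  have h2 : ∀ σ : Emb p F E, symMap (d σ) (!![a, 0; 0, b].map σ) (symBasis (d σ) (i σ)) =
      (σ a ^ (d σ - i σ : ℕ) * σ b ^ (i σ : ℕ)) • symBasis (d σ) (i σ) := by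
    intro σ
    rw [← symMap_diagonal]
    congr 2
    ext k l
    fin_cases k <;> fin_cases l <;> simp
  simp_rw [h, h2, basisV_apply]
  exact MultilinearMap.map_smul_univ (PiTensorProduct.tprod E) _ _

theorem repr_tensorMap_diagonal (a b : F) (t : V d) (i : (σ : Emb p F E) → Fin (d σ + 1)) :
    (basisV d).repr (tensorMap d !![a, 0; 0, b] t) i =
      (∏ σ : Emb p F E, σ a ^ (d σ - i σ : ℕ) * σ b ^ (i σ : ℕ)) * (basisV d).repr t i := by
  classical
  conv_lhs => rw [← (basisV d).sum_repr t, map_sum, map_sum, Finsupp.finsetSum_apply]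
  simp_rw [map_smul, tensorMap_diagonal_basisV, map_smul, Module.Basis.repr_self,
    Finsupp.smul_apply, smul_eq_mul, Finsupp.single_apply]
  rw [Finset.sum_eq_single i]
  · simp [mul_comm]
  · intro j _ hj
    simp [hj]
  · simp

theorem repr_last (t : V d) :
    (basisV d).repr t (fun σ => Fin.last (d σ)) = ev d ![0, 1] t := by
  rw [ev_eq_sum, Finset.sum_eq_single fun σ => Fin.last (d σ)]
  · simp [ev_basisV]
  · intro i _ hi
    obtain ⟨σ, hσ⟩ := Function.ne_iff.mp hi
    have hlt : (i σ : ℕ) < d σ := Fin.val_lt_last hσ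
    rw [ev_basisV, Finset.prod_eq_zero (Finset.mem_univ σ), mul_zero]
    simp [Nat.sub_ne_zero_of_lt hlt]
  · simp

/-- `U` is diagonal, and each eigenvalue except that of `⨂ y_σ ^ d_σ` contains a factor `σ ϖ`. -/
theorem heckeU_mem_smallLattice {ϖ : F} (hϖ : ‖ϖ‖ < 1) {t : V d} (ht : t ∈ lattice d)
    (h : ‖ev d ![0, 1] t‖ < 1) : heckeU d ϖ t ∈ smallLattice d := by
  intro i
  rw [heckeU, repr_tensorMap_diagonal]
  by_cases hi : i = fun σ => Fin.last (d σ)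
  · rw [hi, repr_last]
    simpa using h
  · obtain ⟨τ, hτ⟩ := Function.ne_iff.mp hi
    have hlt : (i τ : ℕ) < d τ := Fin.val_lt_last hτ
    rw [mul_comm]
    refine mul_norm_lt_one (mem_lattice_iff.mp ht i) ?_
    simp_rw [map_one, one_pow, mul_one]
    classical
    rw [← Finset.mul_prod_erase _ _ (Finset.mem_univ τ), mul_comm]
    refine mul_norm_lt_one (norm_prod_le_one _ fun σ _ => ?_) ?_
    · rw [norm_pow]
      exact pow_le_one₀ (norm_nonneg _) (norm_emb_le_one σ hϖ.le)
    · rw [norm_pow]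
      exact pow_lt_one₀ (norm_nonneg _) (norm_emb_lt_one τ hϖ) (Nat.sub_ne_zero_of_lt hlt)

/-- Modulo `𝔭_E`, `U` is the rank-one projection onto `⨂ y_σ ^ d_σ` given by evaluation at `(0, 1)`.
-/
theorem heckeU_sub_mem_smallLattice {ϖ : F} (hϖ : ‖ϖ‖ < 1) {t : V d} (ht : t ∈ lattice d) :
    heckeU d ϖ t - ev d ![0, 1] t • basisV d (fun σ => Fin.last (d σ)) ∈ smallLattice d := by
  have hb := basisV_mem_lattice (d := d) fun σ => Fin.last (d σ)
  have e1 : ev d ![0, 1] (basisV d fun σ => Fin.last (d σ)) = 1 := by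
    rw [← repr_last, Module.Basis.repr_self, Finsupp.single_eq_same]
  have e2 : heckeU d ϖ (basisV d fun σ => Fin.last (d σ)) = basisV d fun σ => Fin.last (d σ) := by
    rw [heckeU, tensorMap_diagonal_basisV]
    simp
  have hev : ‖ev d ![0, 1] t‖ ≤ 1 := by
    rw [← repr_last]
    exact mem_lattice_iff.mp ht _
  have h := heckeU_mem_smallLattice hϖ
    (t := t - ev d ![0, 1] t • basisV d (fun σ => Fin.last (d σ)))
    (sub_mem ht ((lattice d).smul_mem ⟨_, mem_integers.mpr hev⟩ hb))
    (by rw [map_sub, map_smul, e1]; simp)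
  rwa [map_sub, map_smul, e2] at h

end Tensor

/-! ### Integral Lagrange interpolation -/

section Interpolation

variable {K : Type*} [NormedField K] [IsUltrametricDist K]

open Polynomial in
-- The denominators in Lagrange's formula are differences of nodes, hence units.
theorem norm_coeff_le_one_of_eval {A : Type*} [Fintype A] {x : A → K} (hx : ∀ a, ‖x a‖ ≤ 1)
    (hsub : ∀ a b, a ≠ b → ‖x a - x b‖ = 1) {Q : K[X]} (hdeg : Q.degree < Fintype.card A)
    (h : ∀ a, ‖Q.eval (x a)‖ ≤ 1) (n : ℕ) : ‖Q.coeff n‖ ≤ 1 := by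
  classical
  have hinj : Set.InjOn x (Finset.univ : Finset A) := by
    intro a _ b _ hab
    by_contra hne
    have := hsub a b hne
    rw [hab, sub_self, norm_zero] at this
    exact zero_ne_one this
  have hC : ∀ c : K, ‖c‖ ≤ 1 → C c ∈ lifts (integers K).subtype := fun c hc =>
    C_mem_lifts (integers K).subtype ⟨c, mem_integers.mpr hc⟩
  have hQ : Q ∈ lifts (integers K).subtype := by
    rw [Lagrange.eq_interpolate hinj (f := Q) (by simpa using hdeg), Lagrange.interpolate_apply]
    refine sum_mem fun a _ => mul_mem (hC _ (h a)) (prod_mem fun b hb => ?_)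
    rw [Lagrange.basisDivisor]
    refine mul_mem (hC _ ?_) ?_
    · rw [norm_inv, hsub a b (Finset.ne_of_mem_erase hb).symm, inv_one]
    · rw [sub_eq_add_neg, ← C_neg]
      exact add_mem (X_mem_lifts _) (hC _ (by rw [norm_neg]; exact hx b))
  obtain ⟨y, hy⟩ := (lifts_iff_coeff_lifts Q).mp hQ n
  rw [← hy]
  exact mem_integers.mp y.2

end Interpolation

/-! ### Integral values imply integral coefficients -/

section Evaluation

variable {p : ℕ} [hp : Fact p.Prime]
variable {F : Type*} [NormedField F] [IsUltrametricDist F] [NormedAlgebra ℚ_[p] F]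
variable [FiniteDimensional ℚ_[p] F]
variable {E : Type*} [NormedField E] [IsUltrametricDist E] [NormedAlgebra ℚ_[p] E]
variable {ι : Emb p F E} {d : Emb p F E → ℕ}

open Polynomial in
-- This is where conditions (i) and (ii) enter the sufficiency proof: they make restriction to
-- Teichmüller points lossless, by turning `t` into a one-variable polynomial of degree below `q`
-- with the same coefficients.
theorem mem_lattice_of_ev
    (h₁ : ∀ l < residueDegree F, (J ι d l).encard ≤ 1)
    (h₂ : ∀ l < residueDegree F, ∀ σ ∈ J ι d l, d σ + 1 ≤ p ^ v ι d l) {t : V d}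
    (ht : ∀ c : F, ‖c‖ ≤ 1 → ‖ev d ![1, c] t‖ ≤ 1) : t ∈ lattice d := by
  have := properSpace_of_finiteDimensional p F
  let _ : Fintype (residueField F) := Fintype.ofFinite _
  obtain ⟨l₀, w, hl₀, hw, hlt, hinj⟩ := exists_weights h₁ h₂
  have hT : ∀ ζ : residueField F, ∃ y : integers F, (y : F) ^ p ^ residueDegree F = y ∧
      IsLocalRing.residue _ y = ζ := by
    intro ζ
    obtain ⟨x, rfl⟩ := IsLocalRing.residue_surjective ζ
    obtain ⟨y, hy, hyq, hyx⟩ := exists_teichmuller (p := p) (mem_integers.mp x.2)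
    exact ⟨⟨y, mem_integers.mpr hy⟩, hyq, residue_eq_iff.mpr hyx⟩
  choose T hTq hTr using hT
  let e : ((σ : Emb p F E) → Fin (d σ + 1)) → ℕ := fun i => ∑ σ, (i σ : ℕ) * w σ
  let Q : E[X] := ∑ i, C ((basisV d).repr t i) * X ^ e i
  -- The exponent `f - l₀` undoes the twist by `p ^ l₀`, because `T ζ` is fixed by the `q`-th power;
  -- the nodes are then plain values of `ι`.
  have hQ : ∀ ζ, Q.eval (ι (T ζ : F)) =
      ev d ![1, (T ζ : F) ^ p ^ (residueDegree F - l₀)] t := by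
    intro ζ
    set y : F := (T ζ : F) ^ p ^ (residueDegree F - l₀) with hy
    have hyn : ‖y‖ ≤ 1 := by
      rw [hy, norm_pow]
      exact pow_le_one₀ (norm_nonneg _) (mem_integers.mp (T ζ).2)
    have hyq : y ^ p ^ residueDegree F = y := by rw [hy, pow_right_comm, hTq]
    have hyl : ι y ^ p ^ l₀ = ι (T ζ : F) := by
      rw [← map_pow, hy, ← pow_mul, ← pow_add, Nat.sub_add_cancel hl₀, hTq]
    rw [ev_eq_sum, eval_finsetSum]
    refine Finset.sum_congr rfl fun i _ => ?_
    rw [eval_mul, eval_C, eval_pow, eval_X, ev_basisV, ← Finset.prod_pow_eq_pow_sum]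
    congr 1
    refine Finset.prod_congr rfl fun σ _ => ?_
    by_cases h0 : d σ = 0
    · have hi : (i σ : ℕ) = 0 := by
        have := (i σ).2
        lia
      simp [hi]
    · simp only [Matrix.cons_val_zero, Matrix.cons_val_one, map_one, one_pow, one_mul]
      rw [hw y hyn hyq σ h0, hyl, ← pow_mul, mul_comm]
  have hcoeff : ∀ i, Q.coeff (e i) = (basisV d).repr t i := by
    intro i
    rw [finsetSum_coeff, Finset.sum_eq_single i]
    · simp
    · intro j _ hj
      rw [coeff_C_mul_X_pow, if_neg fun h => hj (hinj h.symm)]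
    · simp
  rw [mem_lattice_iff]
  intro i
  rw [← hcoeff i]
  refine norm_coeff_le_one_of_eval (x := fun ζ => ι (T ζ : F))
    (fun ζ => norm_emb_le_one ι (mem_integers.mp (T ζ).2)) ?_ ?_ ?_ _
  · intro ζ ξ hne
    rw [← map_sub]
    refine norm_emb_eq_one ι (le_antisymm (mem_integers.mp (T ζ - T ξ).2) (not_lt.mp fun hlt => ?_))
    apply hne
    rw [← hTr ζ, ← hTr ξ]
    exact residue_eq_iff.mpr hlt
  · rw [Fintype.card_eq_nat_card, card_residueField p F]
    refine (degree_sum_le _ _).trans_lt ((Finset.sup_lt_iff (WithBot.bot_lt_coe _)).mpr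
      fun i _ => ?_)
    exact (degree_C_mul_X_pow_le _ _).trans_lt (by exact_mod_cast hlt i)
  · intro ζ
    rw [hQ]
    refine ht _ ?_
    rw [norm_pow]
    exact pow_le_one₀ (norm_nonneg _) (mem_integers.mp (T ζ).2)

end Evaluation

/-! ### The height on the tree -/

section Height

variable {F : Type*} [NormedField F] [IsUltrametricDist F]

theorem mem_maxCompact_of_norm_det {g : G F} (h : ∀ i j, ‖g.val i j‖ ≤ 1)
    (hdet : ‖g.val.det‖ = 1) : g ∈ maxCompact F := by
  refine mem_maxCompact.mpr ⟨h, fun i j => ?_⟩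
  rw [Matrix.coe_units_inv, Matrix.inv_def, Matrix.smul_apply, smul_eq_mul, norm_mul,
    Ring.inverse_eq_inv', norm_inv, hdet, inv_one, one_mul, Matrix.adjugate_fin_two]
  fin_cases i <;> fin_cases j <;> simp [h]

/-- The maximum of the norms of the entries of the first column. -/
def colNorm (g : G F) : ℝ := max ‖g.val 0 0‖ ‖g.val 1 0‖

/-- The height of a vertex of the tree with respect to the end fixed by the upper triangular
matrices. -/
def height (g : G F) : ℝ := colNorm g ^ 2 / ‖g.val.det‖

theorem norm_det_pos (g : G F) : 0 < ‖g.val.det‖ :=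
  norm_pos_iff.mpr ((Matrix.isUnit_iff_isUnit_det _).mp g.isUnit).ne_zero

theorem norm_entry_le_colNorm (g : G F) (i : Fin 2) : ‖g.val i 0‖ ≤ colNorm g := by
  fin_cases i
  · exact le_max_left _ _
  · exact le_max_right _ _

theorem colNorm_mul_le {k : G F} (hk : k ∈ maxCompact F) (g : G F) :
    colNorm (k * g) ≤ colNorm g := by
  have h : ∀ i, ‖(k * g).val i 0‖ ≤ colNorm g := by
    intro i
    rw [Units.val_mul, Matrix.mul_apply, Fin.sum_univ_two]
    refine (IsUltrametricDist.norm_add_le_max _ _).trans (max_le ?_ ?_) <;> rw [norm_mul] <;>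
      exact (mul_le_of_le_one_left (norm_nonneg _) ((mem_maxCompact.mp hk).1 _ _)).trans
        (norm_entry_le_colNorm g _)
  exact max_le (h 0) (h 1)

theorem height_maxCompact_mul {k : G F} (hk : k ∈ maxCompact F) (g : G F) :
    height (k * g) = height g := by
  have h : colNorm (k * g) = colNorm g := by
    refine le_antisymm (colNorm_mul_le hk g) ?_
    have := colNorm_mul_le (inv_mem hk) (k * g)
    rwa [inv_mul_cancel_left] at this
  rw [height, height, h, Units.val_mul, Matrix.det_mul, norm_mul, norm_det_eq_one hk, one_mul]

theorem height_scalar_mul (a : Fˣ) (g : G F) :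
    height (Matrix.GeneralLinearGroup.scalar (Fin 2) a * g) = height g := by
  have ha : ‖(a : F)‖ ≠ 0 := norm_ne_zero_iff.mpr a.ne_zero
  have he : ∀ i j, (Matrix.GeneralLinearGroup.scalar (Fin 2) a * g).val i j = a * g.val i j := by
    intro i j
    rw [Units.val_mul, Matrix.GeneralLinearGroup.coe_scalar, Matrix.scalar_apply,
      Matrix.diagonal_mul]
  have hc : colNorm (Matrix.GeneralLinearGroup.scalar (Fin 2) a * g) = ‖(a : F)‖ * colNorm g := by
    rw [colNorm, colNorm, he, he, norm_mul, norm_mul, mul_max_of_nonneg _ _ (norm_nonneg _)]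
  have hd : ‖(Matrix.GeneralLinearGroup.scalar (Fin 2) a * g).val.det‖ =
      ‖(a : F)‖ ^ 2 * ‖g.val.det‖ := by
    rw [Matrix.det_fin_two, he, he, he, he, Matrix.det_fin_two, ← norm_pow, ← norm_mul]
    congr 1
    ring
  rw [height, hc, hd, mul_pow, mul_div_mul_left _ _ (pow_ne_zero 2 ha), height]

theorem height_KZ_mul {κ : G F} (hκ : κ ∈ KZ F) (g : G F) : height (κ * g) = height g := by
  rw [KZ, Subgroup.mem_sup_of_normal_right] at hκ
  obtain ⟨k, hk, z, hz, rfl⟩ := hκ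
  rw [Matrix.GeneralLinearGroup.center_eq_range_scalar] at hz
  obtain ⟨a, rfl⟩ := hz
  rw [mul_assoc, height_maxCompact_mul hk, height_scalar_mul]

/-- Right translation by the stabiliser of the end scales heights, so a vertex of maximal height can
be moved to the base vertex. -/
theorem height_mul_of_upper (x : G F) {g : G F} (hg : g.val 1 0 = 0) :
    height (x * g) = height x * height g := by
  have he : ∀ i, (x * g).val i 0 = x.val i 0 * g.val 0 0 := by
    intro i
    rw [Units.val_mul, Matrix.mul_apply, Fin.sum_univ_two, hg, mul_zero, add_zero]
  have h1 : colNorm (x * g) = colNorm x * colNorm g := by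
    rw [colNorm, colNorm, colNorm, he, he, norm_mul, norm_mul, hg, norm_zero,
      max_eq_left (norm_nonneg (g.val 0 0)), max_mul_of_nonneg _ _ (norm_nonneg _)]
  rw [height, height, height, h1, Units.val_mul, Matrix.det_mul, norm_mul, mul_pow,
    mul_div_mul_comm]

theorem height_pos_of_upper {g : G F} (hg : g.val 1 0 = 0) : 0 < height g := by
  have h : g.val 0 0 ≠ 0 := by
    intro h0
    have := norm_det_pos g
    rw [Matrix.det_fin_two, h0, hg] at this
    simp at this
  have h2 : 0 < colNorm g := (norm_pos_iff.mpr h).trans_le (norm_entry_le_colNorm g 0)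
  exact div_pos (pow_pos h2 2) (norm_det_pos g)

/-- The permutation matrix `!![0, 1; 1, 0]`. -/
def swap (F : Type*) [NormedField F] : G F :=
  Matrix.GeneralLinearGroup.mkOfDetNeZero !![0, 1; 1, 0] (by simp)

/-- The matrix `!![1, c; 0, 1]`. -/
def upper (c : F) : G F :=
  Matrix.GeneralLinearGroup.mkOfDetNeZero !![1, c; 0, 1] (by simp)

/-- The matrix `!![1, 0; c, 1]`. -/
def lower (c : F) : G F :=
  Matrix.GeneralLinearGroup.mkOfDetNeZero !![1, 0; c, 1] (by simp)

theorem swap_val : (swap F).val = !![0, 1; 1, 0] := rfl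

theorem upper_val (c : F) : (upper c).val = !![1, c; 0, 1] := rfl

theorem lower_val (c : F) : (lower c).val = !![1, 0; c, 1] := rfl

theorem swap_mem : swap F ∈ maxCompact F := by
  refine mem_maxCompact_of_norm_det (fun i j => ?_) ?_
  · rw [swap_val]
    fin_cases i <;> fin_cases j <;> simp
  · simp [swap_val]

theorem upper_mem {c : F} (hc : ‖c‖ ≤ 1) : upper c ∈ maxCompact F := by
  refine mem_maxCompact_of_norm_det (fun i j => ?_) ?_
  · rw [upper_val]
    fin_cases i <;> fin_cases j <;> simp [hc]
  · simp [upper_val]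

theorem lower_mem {c : F} (hc : ‖c‖ ≤ 1) : lower c ∈ maxCompact F := by
  refine mem_maxCompact_of_norm_det (fun i j => ?_) ?_
  · rw [lower_val]
    fin_cases i <;> fin_cases j <;> simp [hc]
  · simp [lower_val]

/-- Iwasawa decomposition: the smaller entry of the first column is cleared by the larger one. -/
theorem exists_maxCompact_mul_upper (g : G F) : ∃ k ∈ maxCompact F, (k * g).val 1 0 = 0 := by
  have key : ∀ g : G F, ‖g.val 1 0‖ ≤ ‖g.val 0 0‖ → ∃ k ∈ maxCompact F, (k * g).val 1 0 = 0 := by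
    intro g h
    refine ⟨lower (-(g.val 1 0 / g.val 0 0)), lower_mem ?_, ?_⟩
    · rw [norm_neg, norm_div]
      exact div_le_one_of_le₀ h (norm_nonneg _)
    · rw [Units.val_mul, lower_val, Matrix.mul_apply, Fin.sum_univ_two]
      by_cases h0 : g.val 0 0 = 0
      · rw [h0, norm_zero, norm_le_zero_iff] at h
        simp [h0, h]
      · simp [h0]
  rcases le_total ‖g.val 1 0‖ ‖g.val 0 0‖ with h | h
  · exact key g h
  · obtain ⟨k, hk, hkg⟩ := key (swap F * g) (by
      simpa [Units.val_mul, swap_val, Matrix.mul_apply, Fin.sum_univ_two] using h)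
    exact ⟨k * swap F, mul_mem hk swap_mem, by rw [mul_assoc, hkg]⟩

end Height

/-! ### Higher neighbours of the base vertex -/

section Neighbour

variable {F : Type*} [NormedField F] [IsUltrametricDist F]
variable {ϖ : F} (hϖ : IsUniformizer ϖ)

theorem maxCompact_le_KZ : maxCompact F ≤ KZ F := le_sup_left

theorem central_mem_KZ (n : ℤ) : hϖ.central n ∈ KZ F :=
  (le_sup_right : Subgroup.center (G F) ≤ KZ F) <|
    Subgroup.mem_center_iff.mpr fun g => (central_comm hϖ n g).symm

theorem alpha_val : hϖ.alpha.val = !![1, 0; 0, ϖ] := rfl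

theorem swap_mul_swap : swap F * swap F = 1 := by
  ext i j
  rw [Units.val_mul, swap_val]
  fin_cases i <;> fin_cases j <;> simp

theorem central_mul_swap_alpha_swap :
    hϖ.central 1 * (swap F * hϖ.alpha⁻¹ * swap F) = hϖ.alpha := by
  have h : hϖ.central 1 * hϖ.alpha⁻¹ = swap F * hϖ.alpha * swap F := by
    ext i j
    rw [central_one_mul_alpha_inv, Units.val_mul, Units.val_mul, swap_val, alpha_val]
    fin_cases i <;> fin_cases j <;> simp
  calc hϖ.central 1 * (swap F * hϖ.alpha⁻¹ * swap F)
      = swap F * (hϖ.central 1 * hϖ.alpha⁻¹) * swap F := by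
        rw [← mul_assoc, ← mul_assoc, central_comm, mul_assoc (swap F)]
    _ = (swap F * swap F) * hϖ.alpha * (swap F * swap F) := by
        rw [h]
        group
    _ = hϖ.alpha := by rw [swap_mul_swap, one_mul, mul_one]

/-- A neighbour of the base vertex of the tree, of greater height. -/
def neighbour (c : F) : G F := swap F * hϖ.alpha⁻¹ * (swap F * upper c)

theorem central_mul_neighbour (c : F) : hϖ.central 1 * neighbour hϖ c = hϖ.alpha * upper c := by
  rw [neighbour, ← mul_assoc (swap F * _), ← mul_assoc, central_mul_swap_alpha_swap]

theorem alpha_mul_upper_val (c : F) : (hϖ.alpha * upper c).val = !![1, c; 0, ϖ] := by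
  rw [Units.val_mul, alpha_val, upper_val]
  ext i j
  fin_cases i <;> fin_cases j <;> simp

theorem one_lt_height_neighbour (c : F) : 1 < height (neighbour hϖ c) := by
  have h0 : 0 < ‖ϖ‖ := norm_pos_iff.mpr hϖ.ne_zero
  rw [← height_KZ_mul (central_mem_KZ hϖ 1), central_mul_neighbour, height, colNorm,
    alpha_mul_upper_val]
  simpa using (one_lt_inv₀ h0).mpr hϖ.norm_lt_one

/-- A neighbour of `neighbour hϖ c` is the base vertex or has height greater than `1`. -/
theorem alpha_mul_neighbour {c : F} (hc : ‖c‖ ≤ 1) {k : G F} (hk : k ∈ maxCompact F) :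
    hϖ.alpha * k * neighbour hϖ c ∈ KZ F ∨ 1 < height (hϖ.alpha * k * neighbour hϖ c) := by
  have h0 : 0 < ‖ϖ‖ := norm_pos_iff.mpr hϖ.ne_zero
  set g := hϖ.alpha * k * (hϖ.alpha * upper c) with hg
  have hgn : hϖ.alpha * k * neighbour hϖ c = hϖ.central (-1) * g := by
    rw [hg, ← central_mul_neighbour, ← mul_assoc, central_comm, mul_assoc, mul_assoc,
      ← mul_assoc (hϖ.central (-1)), ← central_add, neg_add_cancel, central_zero, one_mul,
      mul_assoc]
  have hval : g.val = !![k.val 0 0, k.val 0 0 * c + k.val 0 1 * ϖ;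
      ϖ * k.val 1 0, ϖ * (k.val 1 0 * c + k.val 1 1 * ϖ)] := by
    rw [hg, Units.val_mul, Units.val_mul, alpha_mul_upper_val, alpha_val]
    ext i j
    fin_cases i <;> fin_cases j <;>
      simp [Matrix.mul_apply, Matrix.vecMul, dotProduct, Fin.sum_univ_two, mul_assoc, mul_add]
  have hdet : ‖g.val.det‖ = ‖ϖ‖ ^ 2 := by
    rw [hg, Units.val_mul, Units.val_mul, Matrix.det_mul, Matrix.det_mul, norm_mul, norm_mul,
      norm_det_eq_one hk, alpha_mul_upper_val, alpha_val]
    simp [sq]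
  have hk1 := (mem_maxCompact.mp hk).1
  rw [hgn]
  -- If `k 0 0` is not a unit, `ϖ` divides all entries of `g`, and the walk returns to the base
  -- vertex. Otherwise the first column has norm at least 1 while the determinant has norm `‖ϖ‖ ^
  -- 2`.
  by_cases h1 : ‖k.val 0 0‖ < 1
  · left
    refine maxCompact_le_KZ (mem_maxCompact_of_norm_det (fun i j => ?_) ?_)
    · have he : (hϖ.central (-1) * g).val i j = ϖ⁻¹ * g.val i j := by
        rw [Units.val_mul, central_val, zpow_neg_one, Matrix.scalar_apply, Matrix.diagonal_mul]
      have h2 := hϖ.norm_le _ h1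
      have hle : ∀ x : F, ‖x‖ ≤ ‖ϖ‖ → ‖ϖ⁻¹ * x‖ ≤ 1 := by
        intro x hx
        rw [norm_mul, norm_inv]
        exact (inv_mul_le_one₀ h0).mpr hx
      have hadd : ∀ x y : F, ‖x‖ ≤ ‖ϖ‖ → ‖y‖ ≤ ‖ϖ‖ → ‖x + y‖ ≤ ‖ϖ‖ := fun x y hx hy =>
        (IsUltrametricDist.norm_add_le_max _ _).trans (max_le hx hy)
      have hm1 : ∀ x y : F, ‖x‖ ≤ ‖ϖ‖ → ‖y‖ ≤ 1 → ‖x * y‖ ≤ ‖ϖ‖ := by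
        intro x y hx hy
        rw [norm_mul]
        exact (mul_le_of_le_one_right (norm_nonneg _) hy).trans hx
      have hm2 : ∀ x : F, ‖x‖ ≤ 1 → ‖ϖ * x‖ ≤ ‖ϖ‖ := fun x hx => hm1 _ _ le_rfl hx
      have hm3 : ∀ x : F, ‖x‖ ≤ 1 → ‖x * ϖ‖ ≤ ‖ϖ‖ := fun x hx => mul_comm ϖ x ▸ hm2 x hx
      rw [he, hval]
      apply hle
      fin_cases i <;> fin_cases j
      · exact h2
      · exact hadd _ _ (hm1 _ _ h2 hc) (hm3 _ (hk1 _ _))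
      · exact hm2 _ (hk1 _ _)
      · refine hm2 _ ((IsUltrametricDist.norm_add_le_max _ _).trans (max_le ?_ ?_)) <;>
          rw [norm_mul]
        · exact mul_le_one₀ (hk1 _ _) (norm_nonneg _) hc
        · exact mul_le_one₀ (hk1 _ _) (norm_nonneg _) hϖ.norm_lt_one.le
    · rw [Units.val_mul, Matrix.det_mul, norm_mul, hdet, central_val, Matrix.scalar_apply,
        Matrix.det_diagonal, Fin.prod_univ_two, zpow_neg_one, norm_mul, norm_inv]
      field_simp
  · right
    rw [height_KZ_mul (central_mem_KZ hϖ _), height, hdet, one_lt_div (by positivity)]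
    have h2 : 1 ≤ colNorm g := by
      refine (not_lt.mp h1).trans ?_
      have := norm_entry_le_colNorm g 0
      rwa [hval] at this
    have h3 := hϖ.norm_lt_one
    nlinarith

end Neighbour

/-! ### Descent along the height, injectivity of `T - a`, and sufficiency -/

section HeckeOperator

variable {p : ℕ} [hp : Fact p.Prime]
variable {F : Type*} [NormedField F] [IsUltrametricDist F] [NormedAlgebra ℚ_[p] F]
variable [FiniteDimensional ℚ_[p] F]
variable {E : Type*} [NormedField E] [IsUltrametricDist E] [NormedAlgebra ℚ_[p] E]
variable {ϖ : F} (hϖ : IsUniformizer ϖ) {d : Emb p F E → ℕ}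

theorem exponent_of_mem_maxCompact {κ : KZ F} (hκ : κ.1 ∈ maxCompact F) : hϖ.exponent κ = 0 :=
  exponent_unique hϖ κ (by rwa [neg_zero, central_zero, one_mul])

theorem rho_of_mem_maxCompact {κ : KZ F} (hκ : κ.1 ∈ maxCompact F) :
    rho hϖ d κ = tensorMap d κ.1.val := by
  change tensorMap d (hϖ.central (-hϖ.exponent κ) * κ.1).val = _
  rw [exponent_of_mem_maxCompact hϖ hκ, neg_zero, central_zero, one_mul]

theorem psi_neighbour {c : F} (hc : ‖c‖ ≤ 1) :
    psi hϖ d (neighbour hϖ c) = tensorMap d !![1, c; 0, ϖ] := by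
  have h1 : swap F ∈ maxCompact F := swap_mem
  have h2 : swap F * upper c ∈ maxCompact F := mul_mem h1 (upper_mem hc)
  have h := psi_apply hϖ d ⟨_, maxCompact_le_KZ h1⟩ ⟨_, maxCompact_le_KZ h2⟩
  rw [rho_heckeU_rho, exponent_of_mem_maxCompact hϖ h1, exponent_of_mem_maxCompact hϖ h2,
    sub_zero, sub_zero] at h
  refine h.trans ?_
  change tensorMap d (hϖ.central 1 * neighbour hϖ c).val = _
  rw [central_mul_neighbour, alpha_mul_upper_val]

theorem heckeFun_isolate {f : G F → V d} (hf : f ∈ indRho hϖ d) (S : AddSubgroup (V d)) (x g : G F)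
    (hS : ∀ y : G F, (y : G F ⧸ KZ F) ≠ x → psi hϖ d y (f (y⁻¹ * g)) ∈ S)
    (h : heckeFun hϖ d f g ∈ S) : psi hϖ d x (f (x⁻¹ * g)) ∈ S := by
  classical
  have := properSpace_of_finiteDimensional p F
  have hfin := summand_finite hϖ f g
  let s : Finset (G F ⧸ KZ F) := insert (x : G F ⧸ KZ F) hfin.toFinset
  have hsub : (Function.support fun y : G F ⧸ KZ F => psi hϖ d y.out (f (y.out⁻¹ * g))) ⊆ s := by
    intro y hy
    exact Finset.mem_insert_of_mem (hfin.mem_toFinset.mpr hy)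
  rw [heckeFun, finsum_eq_sum_of_support_subset _ hsub,
    ← Finset.add_sum_erase _ _ (Finset.mem_insert_self _ _), summand_eq hϖ hf] at h
  refine (AddSubgroup.add_mem_cancel_right S ?_).mp h
  refine sum_mem fun y hy => hS y.out ?_
  rw [QuotientGroup.out_eq']
  exact Finset.ne_of_mem_erase hy

/-- The value of `T f` at a neighbour of greater height than the base vertex is governed by `f(1)`
and by the values of `f` at vertices of height greater than `1`. -/
theorem tensorMap_mem_of_height {f : G F → V d} (hf : f ∈ indRho hϖ d) (S : AddSubgroup (V d))
    (hψ : ∀ y, ∀ t ∈ S, psi hϖ d y t ∈ S) (hS : ∀ x, 1 < height x → f x ∈ S) {c : F}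
    (hc : ‖c‖ ≤ 1) (hT : heckeFun hϖ d f (neighbour hϖ c) ∈ S) :
    tensorMap d !![1, c; 0, ϖ] (f 1) ∈ S := by
  have h := heckeFun_isolate hϖ hf S (neighbour hϖ c) (neighbour hϖ c) (fun y hy => ?_) hT
  · rwa [inv_mul_cancel, psi_neighbour hϖ hc] at h
  · by_cases h0 : psi hϖ d y = 0
    · rw [h0, LinearMap.zero_apply]
      exact zero_mem S
    refine hψ _ _ (hS _ ?_)
    obtain ⟨⟨κ₁, κ₂⟩, hκ⟩ := exists_of_psi_ne_zero hϖ d h0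
    have hk := exponent_spec hϖ κ₁⁻¹
    set n := -hϖ.exponent κ₁⁻¹
    -- Up to `KZ` on the left, `y⁻¹ * neighbour hϖ c` is a neighbour of `neighbour hϖ c` in the form
    -- treated by `alpha_mul_neighbour`.
    have e : hϖ.alpha * (hϖ.central n * (κ₁⁻¹ : KZ F).1) * neighbour hϖ c =
        (hϖ.central n * κ₂.1) * (y⁻¹ * neighbour hϖ c) := by
      rw [hκ, ← mul_assoc hϖ.alpha, ← central_comm]
      simp only [Subgroup.coe_inv]
      group
    have hκz : hϖ.central n * κ₂.1 ∈ KZ F := mul_mem (central_mem_KZ hϖ _) κ₂.2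
    rcases alpha_mul_neighbour hϖ hc hk with h1 | h1
    · rw [e] at h1
      exact absurd (QuotientGroup.eq.mpr ((Subgroup.mul_mem_cancel_left _ hκz).mp h1)) hy
    · rwa [e, height_KZ_mul hκz] at h1

/-- By compactness the support meets only finitely many cosets of `KZ`, and both the height and
membership of the value in `S` depend only on the coset. -/
theorem exists_maximal_height {f : G F → V d} (hf : f ∈ indRho hϖ d) (S : AddSubgroup (V d))
    (hρ : ∀ κ, ∀ t ∈ S, rho hϖ d κ t ∈ S) (h : ∃ x, f x ∉ S) :
    ∃ g, f g ∉ S ∧ ∀ x, f x ∉ S → height x ≤ height g := by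
  classical
  obtain ⟨C, hC, hs⟩ := hf.2
  obtain ⟨t, ht⟩ := hC.elim_finite_subcover
    (fun c : G F => (fun x => x * c⁻¹) ⁻¹' (KZ F : Set (G F)))
    (fun c => isOpen_KZ.preimage (continuous_mul_const _))
    (fun c _ => Set.mem_iUnion.mpr ⟨c, by
      rw [Set.mem_preimage, mul_inv_cancel]
      exact one_mem _⟩)
  have hcover : ∀ x, f x ∉ S → ∃ c ∈ t, f c ∉ S ∧ height x = height c := by
    intro x hx
    obtain ⟨c', hc', z, hz, rfl⟩ := hs (show f x ≠ 0 from fun h0 => hx (h0 ▸ zero_mem S))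
    obtain ⟨c, hc, hcc⟩ := Set.mem_iUnion₂.mp (ht hc')
    have hκ : c' * c⁻¹ * z ∈ KZ F :=
      mul_mem hcc ((le_sup_right : Subgroup.center (G F) ≤ KZ F) hz)
    have e : c' * z = c' * c⁻¹ * z * c := by
      rw [mul_assoc _ z c, ← Subgroup.mem_center_iff.mp hz c]
      group
    refine ⟨c, hc, fun hc0 => hx ?_, ?_⟩
    · change f (c' * z) ∈ S
      rw [e, hf.1 ⟨_, hκ⟩]
      exact hρ _ _ hc0
    · change height (c' * z) = _
      rw [e, height_KZ_mul hκ]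
  obtain ⟨x₀, hx₀⟩ := h
  obtain ⟨c₀, hc₀, hc₀', -⟩ := hcover x₀ hx₀
  obtain ⟨g, hg, hmax⟩ := (t.filter fun c => f c ∉ S).exists_max_image height
    ⟨c₀, Finset.mem_filter.mpr ⟨hc₀, hc₀'⟩⟩
  refine ⟨g, (Finset.mem_filter.mp hg).2, fun x hx => ?_⟩
  obtain ⟨c, hc, hc', e⟩ := hcover x hx
  rw [e]
  exact hmax c (Finset.mem_filter.mpr ⟨hc, hc'⟩)

/-- The descent argument, for a general stable subgroup `S`: it is applied to the zero subgroup for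
the injectivity of `T - a`, and to the lattice for sufficiency. -/
theorem forall_mem_of_heckeFun {f : G F → V d} (hf : f ∈ indRho hϖ d) (S : AddSubgroup (V d))
    (hρ : ∀ κ, ∀ t ∈ S, rho hϖ d κ t ∈ S) (hψ : ∀ y, ∀ t ∈ S, psi hϖ d y t ∈ S)
    (hT : ∀ x, f x ∈ S → heckeFun hϖ d f x ∈ S)
    (hS : ∀ t, (∀ c : F, ‖c‖ ≤ 1 → tensorMap d !![1, c; 0, ϖ] t ∈ S) → t ∈ S) (x : G F) :
    f x ∈ S := by
  by_contra hx
  obtain ⟨g₀, hg₀, hmax⟩ := exists_maximal_height hϖ hf S hρ ⟨x, hx⟩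
  obtain ⟨k, hk, hup⟩ := exists_maxCompact_mul_upper g₀
  set g := k * g₀ with hg
  have hgS : f g ∉ S := by
    intro h
    apply hg₀
    have := hf.1 (⟨k, maxCompact_le_KZ hk⟩⁻¹ : KZ F) g
    rw [Subgroup.coe_inv, hg, inv_mul_cancel_left] at this
    rw [this]
    exact hρ _ _ h
  -- With `g` upper triangular, `y * g` is strictly higher than `g`, against maximality.
  have hgt : ∀ y, 1 < height y → f (y * g) ∈ S := by
    intro y hy
    by_contra hn
    have h1 := hmax _ hn
    rw [height_mul_of_upper y hup] at h1
    have h2 : height g = height g₀ := height_maxCompact_mul hk g₀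
    have h3 := height_pos_of_upper hup
    rw [← h2] at h1
    nlinarith
  apply hgS
  refine hS _ fun c hc => ?_
  have h := tensorMap_mem_of_height hϖ (f := fun y => f (y * g))
    (indRhoRep hϖ d g ⟨f, hf⟩).2 S hψ hgt hc ?_
  · rwa [one_mul] at h
  · have e : heckeFun hϖ d (fun y => f (y * g)) (neighbour hϖ c) =
        heckeFun hϖ d f (neighbour hϖ c * g) :=
      congrFun (congrArg Subtype.val (heckeT_comm hϖ d g ⟨f, hf⟩)) (neighbour hϖ c)
    rw [e]
    exact hT _ (hgt _ (one_lt_height_neighbour hϖ c))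

variable (a : integers E)

theorem heckeT_sub_apply (f : indRho hϖ d) (x : G F) :
    ((heckeT hϖ d - (a : E) • 1) f).1 x = heckeFun hϖ d f.1 x - (a : E) • f.1 x := rfl

/-- `T - a` is injective on `ind ρ_d`. -/
theorem heckeT_sub_injective :
    Function.Injective (heckeT hϖ d - (a : E) • 1 : Module.End E (indRho hϖ d)) := by
  rw [injective_iff_map_eq_zero]
  intro f hf
  ext x
  refine AddSubgroup.mem_bot.mp (forall_mem_of_heckeFun hϖ f.2 ⊥ ?_ ?_ ?_ ?_ x)
  · rintro κ _ rfl
    exact map_zero _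
  · rintro y _ rfl
    exact map_zero _
  · intro y hy
    have h := heckeT_sub_apply hϖ a f y
    rw [AddSubgroup.mem_bot] at hy ⊢
    rw [hf, hy, smul_zero, sub_zero] at h
    exact h.symm
  · intro t ht
    -- For the zero subgroup one neighbour suffices, since `diag(1, ϖ)` is invertible over `F`.
    have h := ht 0 (by simp)
    rw [AddSubgroup.mem_bot] at h ⊢
    have hM : !![1, 0; 0, ϖ⁻¹] * !![1, 0; 0, ϖ] = (1 : Matrix (Fin 2) (Fin 2) F) := by
      ext i j
      fin_cases i <;> fin_cases j <;> simp [hϖ.ne_zero]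
    have h2 := LinearMap.congr_fun (tensorMap_mul d !![1, 0; 0, ϖ⁻¹] !![1, 0; 0, ϖ]) t
    rw [hM, tensorMap_one, LinearMap.comp_apply, h, map_zero] at h2
    exact h2

theorem mem_indLattice_of_heckeT_sub {ι : Emb p F E}
    (h₁ : ∀ l < residueDegree F, (J ι d l).encard ≤ 1)
    (h₂ : ∀ l < residueDegree F, ∀ σ ∈ J ι d l, d σ + 1 ≤ p ^ v ι d l) {f : indRho hϖ d}
    (hf : (heckeT hϖ d - (a : E) • 1) f ∈ indLattice hϖ d) : f ∈ indLattice hϖ d := by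
  intro x
  refine forall_mem_of_heckeFun hϖ f.2 (lattice d).toAddSubgroup ?_ ?_ ?_ ?_ x
  · exact fun κ t ht => rho_mem_lattice hϖ d κ ht
  · exact fun y t ht => psi_mem_lattice hϖ d y ht
  · intro y hy
    have h := add_mem (hf y) ((lattice d).smul_mem a hy)
    rw [heckeT_sub_apply] at h
    change heckeFun hϖ d f.1 y ∈ lattice d
    convert h using 1
    exact (sub_add_cancel _ _).symm
  · intro t ht
    refine mem_lattice_of_ev h₁ h₂ fun c hc => ?_
    -- The first row of `!![1, c; 0, ϖ]` is `(1, c)`, so evaluation at `(1, 0)` after the matrix is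
    -- evaluation of `t` at `(1, c)`.
    have h := norm_ev_le_one (u := ![1, 0]) (by intro k; fin_cases k <;> simp) (ht c hc)
    have e : Matrix.vecMul ![1, 0] !![1, c; 0, ϖ] = ![1, c] := by
      ext k
      fin_cases k <;> simp
    rwa [ev_tensorMap, e] at h

/-- The kernel of `theta` is the set of integral elements of `(T - a)(ind ρ_d)` modulo `(T - a)(ind
ρ⁰_d)`; injectivity of `T - a` makes the preimage of such an element unique. -/
theorem theta_injective_iff :
    Function.Injective (theta hϖ d a) ↔
      ∀ f : indRho hϖ d, (heckeT hϖ d - (a : E) • 1) f ∈ indLattice hϖ d → f ∈ indLattice hϖ d := by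
  have hker : ∀ g : indLattice hϖ d, g ∈ LinearMap.ker (toPi hϖ d a).rangeRestrict ↔
      ∃ f, (heckeT hϖ d - (a : E) • 1) f = g.1 := by
    intro g
    rw [LinearMap.ker_rangeRestrict, LinearMap.mem_ker]
    exact Submodule.Quotient.mk_eq_zero (imageT hϖ d a)
  have himage : ∀ g : indLattice hϖ d, g ∈ imageTLattice hϖ d a ↔
      ∃ f ∈ indLattice hϖ d, (heckeT hϖ d - (a : E) • 1) f = g.1 := by
    intro g
    constructor
    · rintro ⟨f, rfl⟩
      exact ⟨f.1, f.2, rfl⟩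
    · rintro ⟨f, hf, h⟩
      exact ⟨⟨f, hf⟩, Subtype.ext h⟩
  change Function.Injective ((imageTLattice hϖ d a).liftQ (toPi hϖ d a).rangeRestrict
    (imageTLattice_le_ker hϖ d a)) ↔ _
  rw [← LinearMap.ker_eq_bot, Submodule.ker_liftQ, ← LinearMap.le_ker_iff_map,
    Submodule.ker_mkQ]
  constructor
  · intro h f hf
    obtain ⟨f₀, hf₀, e⟩ := (himage ⟨_, hf⟩).mp (h ((hker _).mpr ⟨f, rfl⟩))
    exact heckeT_sub_injective hϖ a e ▸ hf₀
  · intro h g hg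
    obtain ⟨f, hf⟩ := (hker g).mp hg
    exact (himage g).mpr ⟨f, h f (hf ▸ g.2), hf⟩

theorem theta_surjective : Function.Surjective (theta hϖ d a) := by
  rintro ⟨_, f, rfl⟩
  exact ⟨Submodule.Quotient.mk f, rfl⟩

end HeckeOperator

/-! ### Functions supported on one vertex and reduction modulo `𝔭_E` -/

section Delta

variable {p : ℕ} [hp : Fact p.Prime]
variable {F : Type*} [NormedField F] [IsUltrametricDist F] [NormedAlgebra ℚ_[p] F]
variable [FiniteDimensional ℚ_[p] F]
variable {E : Type*} [NormedField E] [IsUltrametricDist E] [NormedAlgebra ℚ_[p] E]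
variable {ϖ : F} (hϖ : IsUniformizer ϖ) {d : Emb p F E → ℕ}

open Classical in
/-- The function supported on `KZ` with value `t` at `1`. -/
def delta (t : V d) : indRho hϖ d :=
  ⟨fun g => if h : g ∈ KZ F then rho hϖ d ⟨g, h⟩ t else 0, by
    have := properSpace_of_finiteDimensional p F
    constructor
    · intro κ g
      dsimp only
      by_cases h : g ∈ KZ F
      · rw [dif_pos h, dif_pos (mul_mem κ.2 h)]
        exact LinearMap.congr_fun (rho_mul hϖ d κ ⟨g, h⟩) t
      · rw [dif_neg h, dif_neg fun h' => h ((Subgroup.mul_mem_cancel_left _ κ.2).mp h'), map_zero]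
    · refine ⟨maxCompact F, isCompact_maxCompact, fun g hg => ?_⟩
      have h : g ∈ KZ F := by
        by_contra h
        exact hg (dif_neg h)
      rw [KZ, Subgroup.mem_sup_of_normal_right] at h
      obtain ⟨k, hk, z, hz, e⟩ := h
      exact ⟨k, hk, z, hz, e⟩⟩

theorem delta_of_mem (t : V d) {g : G F} (h : g ∈ KZ F) :
    (delta hϖ t).1 g = rho hϖ d ⟨g, h⟩ t := dif_pos h

theorem delta_of_notMem (t : V d) {g : G F} (h : g ∉ KZ F) : (delta hϖ t).1 g = 0 := dif_neg h

theorem delta_one (t : V d) : (delta hϖ t).1 1 = t := by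
  rw [delta_of_mem hϖ t (one_mem _)]
  exact LinearMap.congr_fun (map_one (rho hϖ d)) t

theorem delta_mem_indLattice {t : V d} (ht : t ∈ lattice d) : delta hϖ t ∈ indLattice hϖ d := by
  intro g
  by_cases h : g ∈ KZ F
  · rw [delta_of_mem hϖ t h]
    exact rho_mem_lattice hϖ d _ ht
  · rw [delta_of_notMem hϖ t h]
    exact zero_mem _

theorem heckeFun_delta (t : V d) (g : G F) :
    heckeFun hϖ d (delta hϖ t).1 g = psi hϖ d g t := by
  rw [heckeFun, finsum_eq_single _ (g : G F ⧸ KZ F)]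
  · rw [summand_eq hϖ (delta hϖ t).2, inv_mul_cancel, delta_one]
  · intro y hy
    rw [delta_of_notMem, map_zero]
    intro h
    apply hy
    rw [← QuotientGroup.out_eq' y]
    exact QuotientGroup.eq.mpr h

/-- Divide by a uniformizer `π` of `E`: as `a` lies in `𝔭_E`, `(T - a)(π⁻¹ f)` is integral, hence so
is `π⁻¹ f`. -/
theorem mem_smallLattice_of_injective [FiniteDimensional ℚ_[p] E] {a : integers E}
    (ha : ‖(a : E)‖ < 1) (hinj : Function.Injective (theta hϖ d a)) {f : indRho hϖ d}
    (hf : f ∈ indLattice hϖ d) (hT : ∀ x, heckeFun hϖ d f.1 x ∈ smallLattice d) (x : G F) :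
    f.1 x ∈ smallLattice d := by
  have := properSpace_of_finiteDimensional p E
  have hp0 : (p : E) ≠ 0 := by
    rw [← map_natCast (algebraMap ℚ_[p] E)]
    exact (map_ne_zero _).mpr (mod_cast hp.out.ne_zero)
  obtain ⟨π, hπ⟩ := exists_isUniformizer hp0 (norm_natCast_prime_lt_one p E)
  rw [mem_smallLattice_iff_of_isUniformizer hπ]
  refine (theta_injective_iff hϖ a).mp hinj (π⁻¹ • f) (fun y => ?_) x
  rw [map_smul]
  change π⁻¹ • ((heckeT hϖ d - (a : E) • 1) f).1 y ∈ lattice d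
  rw [heckeT_sub_apply, ← mem_smallLattice_iff_of_isUniformizer hπ]
  exact sub_mem (hT y) (smul_mem_smallLattice ha (hf y))

theorem rho_mem_smallLattice (κ : KZ F) {t : V d} (ht : t ∈ smallLattice d) :
    rho hϖ d κ t ∈ smallLattice d :=
  map_mem_smallLattice (fun _ => rho_mem_lattice hϖ d κ) ht

theorem vecMul_zero_one (M : Matrix (Fin 2) (Fin 2) F) : Matrix.vecMul ![0, 1] M = M 1 := by
  ext k
  simp [Matrix.vecMul, dotProduct, Fin.sum_univ_two]

theorem psi_mem_smallLattice_of_ev (κ₁ κ₂ : KZ F) {t : V d} (ht : t ∈ lattice d)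
    (h : ‖ev d ((hϖ.central (-hϖ.exponent κ₂) * κ₂.1).val 1) t‖ < 1) :
    psi hϖ d (κ₁.1 * hϖ.alpha⁻¹ * κ₂.1) t ∈ smallLattice d := by
  rw [psi_apply]
  refine rho_mem_smallLattice hϖ κ₁ (heckeU_mem_smallLattice hϖ.norm_lt_one
    (rho_mem_lattice hϖ d κ₂ ht) ?_)
  change ‖ev d ![0, 1] (tensorMap d _ t)‖ < 1
  rwa [ev_tensorMap, vecMul_zero_one]

/-- The Hecke image of `delta hϖ t` has values `ψ(g) t`, which modulo `𝔭_E` only involve values of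
`t` at second rows of matrices in `K`. -/
theorem mem_smallLattice_of_injective_of_ev [FiniteDimensional ℚ_[p] E] {a : integers E}
    (ha : ‖(a : E)‖ < 1) (hinj : Function.Injective (theta hϖ d a)) {t : V d} (ht : t ∈ lattice d)
    (h : ∀ u : Fin 2 → F, (∀ k, ‖u k‖ ≤ 1) → ‖ev d u t‖ < 1) : t ∈ smallLattice d := by
  have := mem_smallLattice_of_injective hϖ ha hinj (delta_mem_indLattice hϖ ht) (fun g => ?_) 1
  · rwa [delta_one] at this
  rw [heckeFun_delta]
  by_cases h0 : psi hϖ d g = 0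
  · rw [h0]
    exact zero_mem _
  obtain ⟨κ, rfl⟩ := exists_of_psi_ne_zero hϖ d h0
  exact psi_mem_smallLattice_of_ev hϖ κ.1 κ.2 ht
    (h _ ((mem_maxCompact.mp (exponent_spec hϖ κ.2)).1 1))

theorem sub_notMem_smallLattice {i j : (σ : Emb p F E) → Fin (d σ + 1)} (hij : i ≠ j) :
    basisV d i - basisV d j ∉ smallLattice d := by
  intro h
  have := h i
  simp [hij.symm] at this

end Delta

/-! ### Distinct monomials with congruent values -/

section Monomials

variable {p : ℕ} [hp : Fact p.Prime]
variable {F : Type*} [NormedField F] [IsUltrametricDist F] [NormedAlgebra ℚ_[p] F]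
variable [FiniteDimensional ℚ_[p] F]
variable {E : Type*} [NormedField E] [IsUltrametricDist E] [NormedAlgebra ℚ_[p] E]
variable {d : Emb p F E → ℕ}

/-- The index of the monomial `x_σ ^ (d_σ - m) * y_σ ^ m * ∏ x_τ ^ d_τ`. -/
def singleIndex (σ : Emb p F E) (m : ℕ) (hm : m ≤ d σ) : (τ : Emb p F E) → Fin (d τ + 1) :=
  Function.update (fun _ => 0) σ ⟨m, Nat.lt_succ_iff.mpr hm⟩

theorem singleIndex_self (σ : Emb p F E) (m : ℕ) (hm : m ≤ d σ) :
    (singleIndex σ m hm σ : ℕ) = m := by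
  rw [singleIndex, Function.update_self]

theorem singleIndex_of_ne {σ τ : Emb p F E} (h : τ ≠ σ) (m : ℕ) (hm : m ≤ d σ) :
    singleIndex σ m hm τ = 0 := by
  rw [singleIndex, Function.update_of_ne h]

theorem ev_singleIndex (u : Fin 2 → F) (σ : Emb p F E) (m : ℕ) (hm : m ≤ d σ) :
    ev d u (basisV d (singleIndex σ m hm)) =
      σ (u 0) ^ (d σ - m) * σ (u 1) ^ m * ∏ τ ∈ Finset.univ.erase σ, τ (u 0) ^ d τ := by
  rw [ev_basisV, ← Finset.mul_prod_erase _ _ (Finset.mem_univ σ), singleIndex_self]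
  congr 1
  refine Finset.prod_congr rfl fun τ hτ => ?_
  rw [singleIndex_of_ne (Finset.ne_of_mem_erase hτ)]
  simp

theorem norm_prod_pow_le_one (s : Finset (Emb p F E)) {x : F} (hx : ‖x‖ ≤ 1) :
    ‖∏ τ ∈ s, τ x ^ d τ‖ ≤ 1 :=
  norm_prod_le_one _ fun τ _ => by
    rw [norm_pow]
    exact pow_le_one₀ (norm_nonneg _) (norm_emb_le_one τ hx)

/-- If `σ ^ (p ^ n) ≡ τ`, trading one `x_τ` for `y_τ` has the same effect on values as trading `p ^
n` copies of `x_σ` for `y_σ`. Both failures of (i), with `n = 0`, and failures of (ii) involving two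
embeddings come from this. -/
theorem norm_ev_sub_of_ne {σ τ : Emb p F E} (hne : σ ≠ τ) {n : ℕ} (hσ : p ^ n ≤ d σ)
    (hτ : 1 ≤ d τ) (h : ∀ x : F, ‖x‖ ≤ 1 → ‖σ x ^ p ^ n - τ x‖ < 1) (u : Fin 2 → F)
    (hu : ∀ k, ‖u k‖ ≤ 1) :
    ‖ev d u (basisV d (singleIndex τ 1 hτ) - basisV d (singleIndex σ (p ^ n) hσ))‖ < 1 := by
  rw [map_sub, ev_singleIndex, ev_singleIndex,
    ← Finset.mul_prod_erase _ _ (Finset.mem_erase.mpr ⟨hne, Finset.mem_univ σ⟩),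
    ← Finset.mul_prod_erase _ _ (Finset.mem_erase.mpr ⟨hne.symm, Finset.mem_univ τ⟩),
    Finset.erase_right_comm]
  have hR := norm_prod_pow_le_one (d := d) ((Finset.univ.erase σ).erase τ) (hu 0)
  set R := ∏ ρ ∈ (Finset.univ.erase σ).erase τ, ρ (u 0) ^ d ρ
  have hx := norm_emb_le_one σ (hu 0)
  have hx' := norm_emb_le_one τ (hu 0)
  have hy' := norm_emb_le_one τ (hu 1)
  have e : τ (u 0) ^ (d τ - 1) * τ (u 1) ^ 1 * (σ (u 0) ^ d σ * R) -
      σ (u 0) ^ (d σ - p ^ n) * σ (u 1) ^ p ^ n * (τ (u 0) ^ d τ * R) =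
      (τ (u 0) ^ (d τ - 1) * σ (u 0) ^ (d σ - p ^ n) * R) *
        (τ (u 1) * (σ (u 0) ^ p ^ n - τ (u 0)) +
          (-τ (u 0)) * (σ (u 1) ^ p ^ n - τ (u 1))) := by
    rw [← pow_sub_mul_pow (σ (u 0)) hσ, ← pow_sub_mul_pow (τ (u 0)) hτ]
    ring
  rw [e]
  refine mul_norm_lt_one ?_ ((IsUltrametricDist.norm_add_le_max _ _).trans_lt
    (max_lt (mul_norm_lt_one hy' (h _ (hu 0)))
      (mul_norm_lt_one (by rwa [norm_neg]) (h _ (hu 1)))))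
  rw [norm_mul, norm_mul, norm_pow, norm_pow]
  exact mul_le_one₀ (mul_le_one₀ (pow_le_one₀ (norm_nonneg _) hx') (by positivity)
    (pow_le_one₀ (norm_nonneg _) hx)) (norm_nonneg _) hR

/-- The relation `x ^ q * y ≡ x * y ^ q` on integers, multiplied by `x ^ (d_σ - q - 1)`; this needs
the strict inequality. -/
theorem norm_ev_sub_of_lt {σ : Emb p F E} (hσ : p ^ residueDegree F < d σ) (u : Fin 2 → F)
    (hu : ∀ k, ‖u k‖ ≤ 1) :
    ‖ev d u (basisV d (singleIndex σ 1 (Nat.one_le_of_lt hσ)) -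
      basisV d (singleIndex σ (p ^ residueDegree F) hσ.le))‖ < 1 := by
  rw [map_sub, ev_singleIndex, ev_singleIndex]
  have hR := norm_prod_pow_le_one (d := d) (Finset.univ.erase σ) (hu 0)
  set R := ∏ ρ ∈ Finset.univ.erase σ, ρ (u 0) ^ d ρ
  set q := p ^ residueDegree F with hq
  have hx := norm_emb_le_one σ (hu 0)
  have hy := norm_emb_le_one σ (hu 1)
  have e : σ (u 0) ^ (d σ - 1) * σ (u 1) ^ 1 * R - σ (u 0) ^ (d σ - q) * σ (u 1) ^ q * R =
      (σ (u 0) ^ (d σ - q - 1) * R) * (σ (u 1) * (σ (u 0) ^ q - σ (u 0)) +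
        (-σ (u 0)) * (σ (u 1) ^ q - σ (u 1))) := by
    rw [show d σ - 1 = (d σ - q - 1) + q by lia, show d σ - q = (d σ - q - 1) + 1 by lia]
    simp only [Nat.add_sub_cancel]
    ring
  rw [e]
  refine mul_norm_lt_one ?_ ((IsUltrametricDist.norm_add_le_max _ _).trans_lt
    (max_lt (mul_norm_lt_one hy (norm_emb_pow_card_sub_lt_one σ (hu 0)))
      (mul_norm_lt_one (by rwa [norm_neg]) (norm_emb_pow_card_sub_lt_one σ (hu 1)))))
  rw [norm_mul, norm_pow]
  exact mul_le_one₀ (pow_le_one₀ (norm_nonneg _) hx) (norm_nonneg _) hR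

/-- For degree exactly `q` one factor `x` must be cancelled from `x ^ q * y ≡ x * y ^ q`, so the
first coordinate has to be a unit. -/
theorem norm_ev_sub_of_eq {σ : Emb p F E} (hσ : p ^ residueDegree F = d σ) (h1 : 1 ≤ d σ)
    (u : Fin 2 → F) (hu : ∀ k, ‖u k‖ ≤ 1) (hu0 : ‖u 0‖ = 1) :
    ‖ev d u (basisV d (singleIndex σ (d σ) le_rfl) - basisV d (singleIndex σ 1 h1))‖ < 1 := by
  rw [map_sub, ev_singleIndex, ev_singleIndex]
  have hR := norm_prod_pow_le_one (d := d) (Finset.univ.erase σ) (hu 0)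
  set R := ∏ ρ ∈ Finset.univ.erase σ, ρ (u 0) ^ d ρ
  have hy := norm_emb_le_one σ (hu 1)
  have hX := norm_emb_eq_one σ hu0
  have hX0 : σ (u 0) ≠ 0 := norm_pos_iff.mp (hX ▸ one_pos)
  have e : σ (u 0) ^ (d σ - d σ) * σ (u 1) ^ d σ * R - σ (u 0) ^ (d σ - 1) * σ (u 1) ^ 1 * R =
      R * ((σ (u 1) ^ d σ - σ (u 1)) +
        (-σ (u 1) * (σ (u 0))⁻¹) * (σ (u 0) ^ d σ - σ (u 0))) := by
    rw [← pow_sub_mul_pow (σ (u 0)) h1, Nat.sub_self]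
    field_simp
    ring
  rw [e, ← hσ]
  refine mul_norm_lt_one hR ((IsUltrametricDist.norm_add_le_max _ _).trans_lt
    (max_lt (norm_emb_pow_card_sub_lt_one σ (hu 1))
      (mul_norm_lt_one ?_ (norm_emb_pow_card_sub_lt_one σ (hu 0)))))
  rwa [norm_mul, norm_neg, norm_inv, hX, inv_one, mul_one]

end Monomials

/-! ### The critical case: one nonzero degree, equal to `q` -/

section CriticalDegree

variable {p : ℕ} [hp : Fact p.Prime]
variable {F : Type*} [NormedField F] [IsUltrametricDist F] [NormedAlgebra ℚ_[p] F]
variable [FiniteDimensional ℚ_[p] F]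
variable {E : Type*} [NormedField E] [IsUltrametricDist E] [NormedAlgebra ℚ_[p] E]
variable {d : Emb p F E → ℕ}

theorem coeff_add_pow_sub_lt_one (n : ℕ) (m : Fin 2 →₀ ℕ) :
    ‖((MvPolynomial.X 1 : MvPolynomial (Fin 2) E) ^ p ^ n + MvPolynomial.X 0 ^ p ^ n -
      (MvPolynomial.X 1 + MvPolynomial.X 0) ^ p ^ n).coeff m‖ < 1 := by
  obtain ⟨r, hr⟩ := exists_add_pow_prime_pow_eq hp.out
    (MvPolynomial.X 1 : MvPolynomial (Fin 2) (integers E)) (MvPolynomial.X 0) n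
  have h := congrArg (MvPolynomial.map (integers E).subtype) hr
  simp only [map_add, map_pow, MvPolynomial.map_X, map_mul, map_natCast] at h
  have e : (MvPolynomial.X 1 : MvPolynomial (Fin 2) E) ^ p ^ n + MvPolynomial.X 0 ^ p ^ n -
      (MvPolynomial.X 1 + MvPolynomial.X 0) ^ p ^ n =
      MvPolynomial.C (-(p : E)) * MvPolynomial.map (integers E).subtype
        (MvPolynomial.X 1 * MvPolynomial.X 0 * r) := by
    rw [h]
    simp only [map_mul, MvPolynomial.map_X, map_neg, map_natCast]
    ring
  rw [e, MvPolynomial.coeff_C_mul, MvPolynomial.coeff_map, mul_comm]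
  exact mul_norm_lt_one
    (mem_integers.mp (MvPolynomial.coeff m (MvPolynomial.X 1 * MvPolynomial.X 0 * r)).2)
    (by rw [norm_neg]; exact norm_natCast_prime_lt_one p E)

theorem repr_tensorMap_last (M : Matrix (Fin 2) (Fin 2) F)
    (i : (σ : Emb p F E) → Fin (d σ + 1)) :
    (basisV d).repr (tensorMap d M (basisV d fun σ => Fin.last (d σ))) i =
      ∏ σ : Emb p F E, ((∑ k, MvPolynomial.C (σ (M k 1)) * MvPolynomial.X k) ^ d σ).coeff
        (expo (d σ) (i σ)) := by
  have h : tensorMap d M (basisV d fun σ => Fin.last (d σ)) =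
      pureTensor fun σ => symMap (d σ) (M.map σ) (symBasis (d σ) (Fin.last (d σ))) := by
    rw [basisV_apply]
    exact PiTensorProduct.map_tprod _ _
  rw [h, basisV_repr_pureTensor]
  refine Finset.prod_congr rfl fun σ _ => ?_
  congr 1
  rw [symBasis_apply]
  change substitution _ (MvPolynomial.monomial (expo (d σ) (d σ)) 1) = _
  rw [substitution, MvPolynomial.aeval_monomial, map_one, one_mul,
    Finsupp.prod_fintype _ _ (fun _ => pow_zero _), Fin.prod_univ_two, expo_zero, expo_one,
    Nat.sub_self, pow_zero, one_mul]
  rfl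

/-- The three matrices send `y` to `y`, `x` and `x + y`, and `p ^ n`-th powering is additive modulo
`p`. -/
theorem tensorMap_last_mem_smallLattice {σ : Emb p F E} {n : ℕ} (hσ : d σ = p ^ n)
    (h0 : ∀ τ, τ ≠ σ → d τ = 0) :
    tensorMap d 1 (basisV d fun τ => Fin.last (d τ)) +
        tensorMap d (swap F).val (basisV d fun τ => Fin.last (d τ)) -
      tensorMap d (upper (1 : F)).val (basisV d fun τ => Fin.last (d τ)) ∈ smallLattice d := by
  intro i
  rw [map_sub, map_add, Finsupp.sub_apply, Finsupp.add_apply, repr_tensorMap_last,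
    repr_tensorMap_last, repr_tensorMap_last]
  simp_rw [← Finset.mul_prod_erase _ _ (Finset.mem_univ σ)]
  have hprod : ∀ M : Matrix (Fin 2) (Fin 2) F,
      ∏ τ ∈ Finset.univ.erase σ, ((∑ k, MvPolynomial.C (τ (M k 1)) *
        (MvPolynomial.X k : MvPolynomial (Fin 2) E)) ^ d τ).coeff (expo (d τ) (i τ)) =
      ∏ τ ∈ Finset.univ.erase σ, (1 : MvPolynomial (Fin 2) E).coeff (expo (d τ) (i τ)) := by
    intro M
    refine Finset.prod_congr rfl fun τ hτ => ?_
    exact congrArg (MvPolynomial.coeff _) (by rw [h0 τ (Finset.ne_of_mem_erase hτ), pow_zero])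
  rw [hprod, hprod, hprod, ← add_mul, ← sub_mul, mul_comm, ← MvPolynomial.coeff_add,
    ← MvPolynomial.coeff_sub]
  refine mul_norm_lt_one (norm_prod_le_one _ fun τ _ => ?_) ?_
  · rw [MvPolynomial.coeff_one]
    split_ifs <;> simp
  · have h := coeff_add_pow_sub_lt_one (p := p) (E := E) n (expo (d σ) (i σ))
    rw [← hσ] at h
    have e1 : ∑ k, MvPolynomial.C (σ ((1 : Matrix (Fin 2) (Fin 2) F) k 1)) *
        (MvPolynomial.X k : MvPolynomial (Fin 2) E) = MvPolynomial.X 1 := by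
      simp [Fin.sum_univ_two]
    have e2 : ∑ k, MvPolynomial.C (σ ((swap F).val k 1)) *
        (MvPolynomial.X k : MvPolynomial (Fin 2) E) = MvPolynomial.X 0 := by
      simp [Fin.sum_univ_two, swap_val]
    have e3 : ∑ k, MvPolynomial.C (σ ((upper (1 : F)).val k 1)) *
        (MvPolynomial.X k : MvPolynomial (Fin 2) E) = MvPolynomial.X 1 + MvPolynomial.X 0 := by
      simp [Fin.sum_univ_two, upper_val, add_comm]
    rwa [e1, e2, e3]

variable {ϖ : F} (hϖ : IsUniformizer ϖ)

theorem mem_maxCompact_of_mem_KZ {ϖ : F} (hϖ : IsUniformizer ϖ) {g : G F} (hg : g ∈ KZ F) (hdet : ‖g.val.det‖ = 1) :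
    g ∈ maxCompact F := by
  have h := norm_det_KZ hϖ ⟨g, hg⟩
  rw [hdet, ← norm_zpow] at h
  have h2 := hϖ.zpow_injective h.symm
  have h3 := exponent_spec hϖ ⟨g, hg⟩
  rwa [show hϖ.exponent ⟨g, hg⟩ = 0 by lia, neg_zero, central_zero, one_mul] at h3

/-- Conjugation by `α` makes the upper right entry `ϖ⁻¹` while the determinant stays a unit. This
separates the supports of the translates used below. -/
theorem conj_notMem {k : G F} (hk : k ∈ maxCompact F) (h01 : k.val 0 1 = 1) :
    hϖ.alpha * (k * hϖ.alpha⁻¹) ∉ KZ F := by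
  intro h
  have h0 : 0 < ‖ϖ‖ := norm_pos_iff.mpr hϖ.ne_zero
  set g := hϖ.alpha * (k * hϖ.alpha⁻¹) with hg
  have hgα : g * hϖ.alpha = hϖ.alpha * k := by
    rw [hg]
    group
  have hdet : ‖g.val.det‖ = 1 := by
    have h1 := congrArg (fun x : G F => ‖x.val.det‖) hgα
    simp only [Units.val_mul, Matrix.det_mul, norm_mul, norm_det_eq_one hk, mul_one] at h1
    exact (mul_eq_right₀ (norm_det_pos hϖ.alpha).ne').mp h1
  have h2 := (mem_maxCompact.mp (mem_maxCompact_of_mem_KZ hϖ h hdet)).1 0 1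
  have h3 := congrArg (fun x : G F => x.val 0 1) hgα
  simp only [Units.val_mul, alpha_val, Matrix.mul_apply, Fin.sum_univ_two, h01] at h3
  have h4 : g.val 0 1 * ϖ = 1 := by simpa using h3
  have h5 : ‖g.val 0 1‖ * ‖ϖ‖ = 1 := by rw [← norm_mul, h4, norm_one]
  nlinarith [hϖ.norm_lt_one]

theorem alpha_inv_mul_mul_alpha_mem {k : G F} (hk : k ∈ maxCompact F) (h : ‖k.val 1 0‖ < 1) :
    hϖ.alpha⁻¹ * k * hϖ.alpha ∈ KZ F := by
  have h0 : 0 < ‖ϖ‖ := norm_pos_iff.mpr hϖ.ne_zero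
  set g := hϖ.alpha⁻¹ * k * hϖ.alpha with hg
  have hαg : hϖ.alpha * g = k * hϖ.alpha := by
    rw [hg]
    group
  have hdet : ‖g.val.det‖ = 1 := by
    have h1 := congrArg (fun x : G F => ‖x.val.det‖) hαg
    simp only [Units.val_mul, Matrix.det_mul, norm_mul, norm_det_eq_one hk, one_mul] at h1
    exact (mul_eq_left₀ (norm_det_pos hϖ.alpha).ne').mp h1
  have hk1 := (mem_maxCompact.mp hk).1
  have he : ∀ i j, (hϖ.alpha * g).val i j = (k * hϖ.alpha).val i j := fun i j => by rw [hαg]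
  simp only [Units.val_mul, alpha_val, Matrix.mul_apply, Fin.sum_univ_two] at he
  refine maxCompact_le_KZ (mem_maxCompact_of_norm_det (fun i j => ?_) hdet)
  have hij := he i j
  fin_cases i <;> fin_cases j <;> simp at hij ⊢
  · rw [hij]
    exact hk1 0 0
  · rw [hij, norm_mul]
    exact mul_le_one₀ (hk1 0 1) (norm_nonneg _) hϖ.norm_lt_one.le
  · have h1 := hϖ.norm_le _ h
    rw [← hij, norm_mul] at h1
    exact le_of_mul_le_mul_left (by rwa [mul_one]) h0
  · rw [mul_comm, mul_eq_mul_right_iff, or_iff_left hϖ.ne_zero] at hij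
    rw [hij]
    exact hk1 1 1

/-- The witness is a signed sum of three functions, each supported on a single neighbour of the base
vertex. Their Hecke images vanish modulo `𝔭_E` away from the base vertex, and there they cancel. -/
theorem not_injective_of_critical [FiniteDimensional ℚ_[p] E] {a : integers E}
    (ha : ‖(a : E)‖ < 1) {σ : Emb p F E} (hσ : p ^ residueDegree F = d σ)
    (h0 : ∀ τ, τ ≠ σ → d τ = 0) : ¬ Function.Injective (theta hϖ d a) := by
  intro hinj
  have := properSpace_of_finiteDimensional p F
  have hq : 1 < d σ := hσ ▸ Nat.one_lt_pow (residueDegree_pos F).ne' hp.out.one_lt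
  set t : V d := basisV d (singleIndex σ (d σ) le_rfl) - basisV d (singleIndex σ 1 hq.le) with ht
  have htl : t ∈ lattice d := sub_mem (basisV_mem_lattice _) (basisV_mem_lattice _)
  have hlast : singleIndex σ (d σ) le_rfl = fun τ => Fin.last (d τ) := by
    funext τ
    apply Fin.ext
    by_cases h : τ = σ
    · subst h
      exact singleIndex_self _ _ _
    · rw [singleIndex_of_ne h]
      exact (h0 τ h).symm
  have hne : singleIndex σ (d σ) le_rfl ≠ singleIndex σ 1 hq.le := by
    intro h
    have h2 := congrArg Fin.val (congrFun h σ)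
    rw [singleIndex_self, singleIndex_self] at h2
    lia
  have hts : t ∉ smallLattice d := sub_notMem_smallLattice hne
  have hev : ev d ![0, 1] t = 1 := by
    rw [← repr_last, ← hlast, ht, map_sub, Finsupp.sub_apply, Module.Basis.repr_self,
      Module.Basis.repr_self, Finsupp.single_eq_same, Finsupp.single_eq_of_ne hne, sub_zero]
  -- Since `t` has value 1 at `(0, 1)`, `U t ≡ ⨂ y_τ ^ d_τ`.
  have hU : ∀ k ∈ maxCompact F, psi hϖ d (k * hϖ.alpha⁻¹) t -
      tensorMap d k.val (basisV d fun τ => Fin.last (d τ)) ∈ smallLattice d := by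
    intro k hk
    have h1 := psi_apply hϖ d ⟨k, maxCompact_le_KZ hk⟩ 1
    rw [Subgroup.coe_one, mul_one, map_one, Module.End.one_eq_id, LinearMap.comp_id,
      rho_of_mem_maxCompact hϖ hk] at h1
    have h2 := map_mem_smallLattice (φ := tensorMap d k.val)
      (fun _ => tensorMap_mem_lattice d (mem_maxCompact.mp hk).1)
      (heckeU_sub_mem_smallLattice hϖ.norm_lt_one htl)
    rw [hev, one_smul, map_sub] at h2
    rw [h1]
    exact h2
  have hψ : ∀ g, g ∉ KZ F → psi hϖ d (g * hϖ.alpha⁻¹) t ∈ smallLattice d := by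
    intro g hg
    by_cases hz : psi hϖ d (g * hϖ.alpha⁻¹) = 0
    · rw [hz]
      exact zero_mem _
    obtain ⟨⟨κ₁, κ₂⟩, hκ⟩ := exists_of_psi_ne_zero hϖ d hz
    have hk := exponent_spec hϖ κ₂
    rw [hκ]
    refine psi_mem_smallLattice_of_ev hϖ κ₁ κ₂ htl ?_
    -- The value of `t` at the second row of `k` is small if its first entry is a unit. Otherwise
    -- `α⁻¹ k α` lies in `KZ`, forcing `g` into `KZ`.
    set k := hϖ.central (-hϖ.exponent κ₂) * κ₂.1 with hkdef
    refine norm_ev_sub_of_eq hσ hq.le _ ((mem_maxCompact.mp hk).1 1)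
      (le_antisymm ((mem_maxCompact.mp hk).1 1 0) (not_lt.mp fun hlt => hg ?_))
    have e : g = κ₁.1 * hϖ.central (hϖ.exponent κ₂) * (hϖ.alpha⁻¹ * k * hϖ.alpha) := by
      have h3 : κ₂.1 = hϖ.central (hϖ.exponent κ₂) * k := by
        rw [hkdef, ← mul_assoc, ← central_add, add_neg_cancel, central_zero, one_mul]
      calc g = (g * hϖ.alpha⁻¹) * hϖ.alpha := by group
        _ = κ₁.1 * (hϖ.alpha⁻¹ * hϖ.central (hϖ.exponent κ₂)) * k * hϖ.alpha := by
          rw [hκ]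
          conv_lhs => rw [h3]
          group
        _ = _ := by
          rw [← central_comm]
          group
    rw [e]
    exact mul_mem (mul_mem κ₁.2 (central_mem_KZ hϖ _)) (alpha_inv_mul_mul_alpha_mem hϖ hk hlt)
  let δ : G F → indRho hϖ d := fun k => indRhoRep hϖ d (k * hϖ.alpha⁻¹) (delta hϖ t)
  have hδ : ∀ k x, (δ k).1 x = (delta hϖ t).1 (x * (k * hϖ.alpha⁻¹)) := fun _ _ => rfl
  have hδl : ∀ k, δ k ∈ indLattice hϖ d := fun k x => delta_mem_indLattice hϖ htl _
  have hTδ : ∀ k x, (heckeT hϖ d (δ k)).1 x = psi hϖ d (x * k * hϖ.alpha⁻¹) t := by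
    intro k x
    rw [mul_assoc, ← heckeFun_delta]
    exact congrFun (congrArg Subtype.val (heckeT_comm hϖ d (k * hϖ.alpha⁻¹) (delta hϖ t))) x
  have hu : upper (1 : F) ∈ maxCompact F := upper_mem (by simp)
  let f : indRho hϖ d := δ 1 + δ (swap F) - δ (upper 1)
  have hTf : ∀ x, (heckeT hϖ d f).1 x = psi hϖ d (x * 1 * hϖ.alpha⁻¹) t +
      psi hϖ d (x * swap F * hϖ.alpha⁻¹) t - psi hϖ d (x * upper 1 * hϖ.alpha⁻¹) t := by
    intro x
    rw [← hTδ, ← hTδ, ← hTδ, map_sub, map_add]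
    rfl
  have hT1 : (heckeT hϖ d f).1 1 ∈ smallLattice d := by
    rw [hTf]
    have h := add_mem (sub_mem (add_mem (hU 1 (one_mem _)) (hU _ swap_mem)) (hU _ hu))
      (tensorMap_last_mem_smallLattice (F := F) hσ.symm h0)
    rw [Units.val_one] at h
    simp only [one_mul] at h ⊢
    convert h using 1
    abel
  have hT : ∀ x, (heckeT hϖ d f).1 x ∈ smallLattice d := by
    intro x
    by_cases hx : x ∈ KZ F
    · have h := (heckeT hϖ d f).2.1 ⟨x, hx⟩ 1
      rw [mul_one] at h
      rw [h]
      exact rho_mem_smallLattice hϖ _ hT1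
    · have hk : ∀ k ∈ maxCompact F, psi hϖ d (x * k * hϖ.alpha⁻¹) t ∈ smallLattice d :=
        fun k hk => hψ _ fun h =>
          hx ((Subgroup.mul_mem_cancel_right _ (maxCompact_le_KZ hk)).mp h)
      rw [hTf]
      exact sub_mem (add_mem (hk _ (one_mem _)) (hk _ swap_mem)) (hk _ hu)
  apply hts
  have h := mem_smallLattice_of_injective hϖ ha hinj (f := f)
    -- At `α` only the first of the three translates is nonzero, and its value there is `t`.
    (sub_mem (add_mem (hδl _) (hδl _)) (hδl _)) hT hϖ.alpha
  have hfα : f.1 hϖ.alpha = t := by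
    change (δ 1).1 hϖ.alpha + (δ (swap F)).1 hϖ.alpha - (δ (upper 1)).1 hϖ.alpha = t
    rw [hδ, hδ, hδ, delta_of_notMem hϖ t (conj_notMem hϖ swap_mem rfl),
      delta_of_notMem hϖ t (conj_notMem hϖ hu rfl), one_mul, mul_inv_cancel, delta_one, add_zero,
      sub_zero]
  rwa [hfα] at h

end CriticalDegree

/-! ### Necessity of the two conditions -/

section Necessity

variable {p : ℕ} [hp : Fact p.Prime]
variable {F : Type*} [NormedField F] [IsUltrametricDist F] [NormedAlgebra ℚ_[p] F]
variable [FiniteDimensional ℚ_[p] F]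
variable {E : Type*} [NormedField E] [IsUltrametricDist E] [NormedAlgebra ℚ_[p] E]
variable [FiniteDimensional ℚ_[p] E]
variable {ϖ : F} (hϖ : IsUniformizer ϖ) {d : Emb p F E → ℕ} {ι : Emb p F E}

theorem eq_of_pow_le_of_injective {a : integers E} (ha : ‖(a : E)‖ < 1)
    (hinj : Function.Injective (theta hϖ d a)) {l n : ℕ} {σ τ : Emb p F E} (hσ : σ ∈ J ι d l)
    (hτ : τ ∈ J ι d ((l + n) % residueDegree F)) (hn : p ^ n ≤ d σ) : σ = τ := by
  by_contra hne
  have hτ1 : 1 ≤ d τ := Nat.one_le_iff_ne_zero.mpr hτ.1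
  refine sub_notMem_smallLattice (i := singleIndex τ 1 hτ1) (j := singleIndex σ (p ^ n) hn) ?_
    (mem_smallLattice_of_injective_of_ev hϖ ha hinj
      (sub_mem (basisV_mem_lattice _) (basisV_mem_lattice _))
      (norm_ev_sub_of_ne hne hn hτ1 fun x hx => norm_emb_pow_sub_lt_one hσ hτ hx))
  intro h
  have h2 := congrArg Fin.val (congrFun h τ)
  rw [singleIndex_self, singleIndex_of_ne (Ne.symm hne)] at h2
  exact one_ne_zero h2

theorem encard_J_le_one_of_injective {a : integers E} (ha : ‖(a : E)‖ < 1)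
    (hinj : Function.Injective (theta hϖ d a)) {l : ℕ} (hl : l < residueDegree F) :
    (J ι d l).encard ≤ 1 := by
  refine Set.encard_le_one_iff.mpr fun σ τ hσ hτ => ?_
  refine eq_of_pow_le_of_injective hϖ ha hinj (n := 0) hσ ?_ ?_
  · rwa [add_zero, Nat.mod_eq_of_lt hl]
  · rw [pow_zero]
    exact Nat.one_le_iff_ne_zero.mpr hσ.1

/-- If `p ^ v ≤ d_σ`, the next nonempty `J` can contain only `σ` itself, so `v` equals the residue
degree. The cases `d_σ > q` and `d_σ = q` are then excluded separately. -/
theorem lt_pow_v_of_injective {a : integers E} (ha : ‖(a : E)‖ < 1)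
    (hinj : Function.Injective (theta hϖ d a)) {l : ℕ} (hl : l < residueDegree F)
    {σ : Emb p F E} (hσ : σ ∈ J ι d l) : d σ < p ^ v ι d l := by
  by_contra! hle
  obtain ⟨hv1, hvf, τ, hτ⟩ := v_spec hl ⟨σ, hσ⟩
  obtain rfl := eq_of_pow_le_of_injective hϖ ha hinj hσ hτ hle
  have hv : v ι d l = residueDegree F := by
    have h := eq_of_mem_J hl (Nat.mod_lt _ (by lia)) hσ hτ
    by_contra hne
    rcases lt_or_ge (l + v ι d l) (residueDegree F) with h1 | h1
    · rw [Nat.mod_eq_of_lt h1] at h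
      lia
    · rw [Nat.mod_eq_sub_mod h1, Nat.mod_eq_of_lt (by lia)] at h
      lia
  rw [hv] at hle
  rcases hle.lt_or_eq with hlt | heq
  · refine sub_notMem_smallLattice (i := singleIndex σ 1 (Nat.one_le_of_lt hlt))
      (j := singleIndex σ (p ^ residueDegree F) hlt.le) ?_
      (mem_smallLattice_of_injective_of_ev hϖ ha hinj
        (sub_mem (basisV_mem_lattice _) (basisV_mem_lattice _)) (norm_ev_sub_of_lt hlt))
    intro h
    have h2 := congrArg Fin.val (congrFun h σ)
    rw [singleIndex_self, singleIndex_self] at h2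
    have := Nat.one_lt_pow (show residueDegree F ≠ 0 by lia) hp.out.one_lt
    lia
  -- Any other `τ` with nonzero degree would lie in `J_l`, against (i), or in some `J_m` with `m ≠
  -- l`, making `v` smaller than the residue degree.
  · refine not_injective_of_critical hϖ ha heq (fun τ hτσ => ?_) hinj
    by_contra hd
    obtain ⟨m, hm, hτm⟩ := exists_mem_J ι hd
    by_cases hml : m = l
    · subst hml
      exact hτσ (Set.encard_le_one_iff.mp (encard_J_le_one_of_injective hϖ ha hinj hl) τ σ hτm hσ)
    · rcases lt_or_gt_of_ne hml with h | h
      · have := v_le (ι := ι) (d := d) (l := l) (i := residueDegree F - l + m) (by lia) (by lia) (by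
          rw [show l + (residueDegree F - l + m) = m + residueDegree F by lia, Nat.add_mod_right,
            Nat.mod_eq_of_lt hm]
          exact ⟨τ, hτm⟩)
        lia
      · have := v_le (ι := ι) (d := d) (l := l) (i := m - l) (by lia) (by lia) (by
          rw [show l + (m - l) = m by lia, Nat.mod_eq_of_lt hm]
          exact ⟨τ, hτm⟩)
        lia

end Necessity

end

end HeckeLattice

theorem mainTheorem1 (p : ℕ) [Fact p.Prime]
    (F : Type*) [NormedField F] [IsUltrametricDist F] [NormedAlgebra ℚ_[p] F]
    [FiniteDimensional ℚ_[p] F]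
    (E : Type*) [NormedField E] [IsUltrametricDist E] [NormedAlgebra ℚ_[p] E]
    [FiniteDimensional ℚ_[p] E]
    (hS : Nat.card (F →ₐ[ℚ_[p]] E) = Module.finrank ℚ_[p] F)
    (ϖ : F) (hϖ : HeckeLattice.IsUniformizer ϖ)
    (ι : F →ₐ[ℚ_[p]] E) (d : (F →ₐ[ℚ_[p]] E) → ℕ)
    (a : HeckeLattice.integers E)
    (ha : a ∈ IsLocalRing.maximalIdeal (HeckeLattice.integers E)) :
    Function.Surjective (HeckeLattice.theta hϖ d a) ∧
      (Function.Injective (HeckeLattice.theta hϖ d a) ↔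
        (∀ l < HeckeLattice.residueDegree F, (HeckeLattice.J ι d l).encard ≤ 1) ∧
        (∀ l < HeckeLattice.residueDegree F, ∀ σ ∈ HeckeLattice.J ι d l,
          d σ + 1 ≤ p ^ HeckeLattice.v ι d l)) := by
  have ha' := HeckeLattice.mem_maximalIdeal_iff.mp ha
  refine ⟨HeckeLattice.theta_surjective hϖ a, fun hinj => ⟨fun l hl => ?_, fun l hl σ hσ => ?_⟩,
    fun h => ?_⟩
  · exact HeckeLattice.encard_J_le_one_of_injective hϖ ha' hinj hl
  · exact HeckeLattice.lt_pow_v_of_injective hϖ ha' hinj hl hσ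
  · exact (HeckeLattice.theta_injective_iff hϖ a).mpr fun f hf =>
      HeckeLattice.mem_indLattice_of_heckeT_sub hϖ a h.1 h.2 hf
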